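/- **Setting.** All Hilbert spaces are nonzero and finite-dimensional. A channel is a completely positive trace-preserving linear map $\Phi$ from operators on $\mathcal H_{\rm in}$ to operators on $\mathcal H_{\rm out}$; a tangent vector at $\Phi$ is a Hermiticity-preserving linear map $\Delta$ with $\operatorname{tr}\Delta(X)=0$ for all $X$. Put $\Delta^{(n)}=\Delta\otimes\Phi^{\otimes n-1}+\Phi\otimes\Delta\otimes\Phi^{\otimes n-2}+\cdots+\Phi^{\otimes n-1}\otimes\Delta$, and let $\|\cdot\|_{\rm cb}=\sup_k\|\cdot\otimes\mathbf I_k\|_{1\to1}$ be the completely bounded norm with respect to the trace norm. For $\rho\ge0$ and $\delta=\delta^\dagger$ let $J^S_\rho(\delta)=\operatorname{tr}\rho L^2$, where $L=L^\dagger$ and $\delta=\tfrac12(L\rho+\rho L)$ (SLD Fisher information), and $J^R_\rho(\delta)=\Re\operatorname{tr}\rho L^\dagger L$, where $\delta=L\rho$ (RLD Fisher information); the value is $+\infty$ if the equation for $L$ has no solution. Define, with values in $[0,\infty]$, $$G^{p,\min}_\Phi(\Delta)=\lim_{n\to\infty}\frac1n\sup_\rho J^S_{(\Phi^{\otimes n}\otimes\mathbf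 I)(\rho)}\bigl((\Delta^{(n)}\otimes\mathbf I)(\rho)\bigr),\qquad G^{p,R}_\Phi(\Delta)=\lim_{n\to\infty}\frac1n\sup_\rho J^R_{(\Phi^{\otimes n}\otimes\mathbf I)(\rho)}\bigl((\Delta^{(n)}\otimes\mathbf I)(\rho)\bigr),$$ where $\rho$ runs over the states on $\mathcal H_{\rm in}^{\otimes n}\otimes\mathcal K$ for all finite-dimensional ancillas $\mathcal K$. The same definitions are used for channels whose output also has a classical part (a measure space $(\Omega,\mu)$): outputs are then matrix-valued densities on $\Omega$, and Fisher information is integrated over $\Omega$. A probability density $q$ and a tangent density $\delta'$ are regarded as the pair of maps $X\mapsto(\operatorname{tr}X)\,q$, $X\mapsto(\operatorname{tr}X)\,\delta'$. **Theorem.** For all finite-dimensional $\mathcal H_{\rm in},\mathcal H_{\rm out}$, and for the Gaussian pair in (N'), the limits above exist in $[0,\infty]$, and each of $G=G^{p,\min}$ and $G=G^{p,R}$ satisfies, for every channel $\Phi$ and every tangent vector $\Delta$ at it: * (M) $G_{\Phi\circ\Psi}(\Delta\circ\Psi)\le G_\Phi(\Delta)$ and $G_{\Psi\circ\Phi}(\Psi\circ\Delta)\le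 G_\Phi(\Delta)$ for all composable channels $\Psi$ between finite-dimensional systems; * (E) $G_{\Phi\otimes\mathbf I}(\Delta\otimes\mathbf I)=G_\Phi(\Delta)$ for the identity channel $\mathbf I$ of every finite-dimensional system; * (A1) $\frac1m G_{\Phi^{\otimes m}}(\Delta^{(m)})=G_\Phi(\Delta)$ for all $m\ge1$; * (C1) if $\Phi^n$ are channels from $\mathcal H_{\rm in}^{\otimes n}$ to $\mathcal H_{\rm out}^{\otimes n}$ and $\Delta^n$ tangent vectors at $\Phi^n$ with $\|\Phi^n-\Phi^{\otimes n}\|_{\rm cb}\to0$ and $\frac1{\sqrt n}\|\Delta^n-\Delta^{(n)}\|_{\rm cb}\to0$, then $$\liminf_{n\to\infty}\frac1n\bigl(G_{\Phi^n}(\Delta^n)-G_{\Phi^{\otimes n}}(\Delta^{(n)})\bigr)\ge0$$ provided that $G_{\Phi^{\otimes n}}(\Delta^{(n)})<\infty$ for all large $n$; if instead $G_{\Phi^{\otimes n}}(\Delta^{(n)})=\infty$ for infinitely many $n$, then $\frac1nG_{\Phi^n}(\Delta^n)\to\infty$; * (N') $G_q(\delta')=1$ for the standard Gaussian shift, i.e.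 $q(x)=\frac1{\sqrt{2\pi}}e^{-x^2/2}$ and $\delta'(x)=x\,q(x)$ on $\mathbb R$ with Lebesgue measure, for every finite-dimensional input space. -/

import Mathlib

open Filter Topology MeasureTheory
open scoped ENNReal NNReal ComplexOrder

noncomputable section

/-! ### Maps between matrix algebras

A Hilbert space of dimension `|a| < ∞` is `ℂ^a` for a finite index type `a`; the tensor product of
`ℂ^a` and `ℂ^c` is `ℂ^(a × c)` and the `n`-th tensor power of `ℂ^a` is `ℂ^(Fin n → a)`. -/

/-- Linear maps from operators on `ℂ^a` to operators on `ℂ^b`. -/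
abbrev SuperOp (a b : Type) : Type := Matrix a a ℂ →ₗ[ℂ] Matrix b b ℂ

/-- `Φ ⊗ Ψ`: the linear map with `(Φ ⊗ Ψ)(X ⊗ Y) = Φ(X) ⊗ Ψ(Y)`, written out on matrix units. -/
def SuperOp.tensor {a b c d : Type} [Fintype a] [DecidableEq a] [Fintype c] [DecidableEq c]
    (Φ : SuperOp a b) (Ψ : SuperOp c d) : SuperOp (a × c) (b × d) where
  toFun X := Matrix.of fun g g' => ∑ f : a × c, ∑ f' : a × c,
    X f f' * (Φ (Matrix.single f.1 f'.1 1) g.1 g'.1 * Ψ (Matrix.single f.2 f'.2 1) g.2 g'.2)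
  map_add' X Y := by
    ext g g'
    simp [add_mul, Finset.sum_add_distrib]
  map_smul' r X := by
    ext g g'
    simp [Finset.mul_sum, mul_assoc]

/-- `Φ₁ ⊗ ⋯ ⊗ Φₙ`, written out on matrix units. -/
def SuperOp.piTensor {a b : Type} [Fintype a] [DecidableEq a] {n : ℕ}
    (Φ : Fin n → SuperOp a b) : SuperOp (Fin n → a) (Fin n → b) where
  toFun X := Matrix.of fun g g' => ∑ f : Fin n → a, ∑ f' : Fin n → a,
    X f f' * ∏ i, Φ i (Matrix.single (f i) (f' i) 1) (g i) (g' i)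
  map_add' X Y := by
    ext g g'
    simp [add_mul, Finset.sum_add_distrib]
  map_smul' r X := by
    ext g g'
    simp [Finset.mul_sum, mul_assoc]

/-- `Φ ⊗ 𝐈`, where `𝐈` is the identity channel on `ℂ^c`. -/
def SuperOp.ampl {a b : Type} [Fintype a] [DecidableEq a] (c : Type) [Fintype c] [DecidableEq c]
    (Φ : SuperOp a b) : SuperOp (a × c) (b × c) :=
  Φ.tensor (LinearMap.id : SuperOp c c)

/-- `Φ^{⊗n}`. -/
def SuperOp.pow {a b : Type} [Fintype a] [DecidableEq a] (Φ : SuperOp a b) (n : ℕ) :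
    SuperOp (Fin n → a) (Fin n → b) :=
  SuperOp.piTensor fun _ => Φ

/-- `Δ^{(n)} = Δ ⊗ Φ^{⊗(n-1)} + Φ ⊗ Δ ⊗ Φ^{⊗(n-2)} + ⋯ + Φ^{⊗(n-1)} ⊗ Δ`. -/
def SuperOp.deriv {a b : Type} [Fintype a] [DecidableEq a] (Φ Δ : SuperOp a b) (n : ℕ) :
    SuperOp (Fin n → a) (Fin n → b) :=
  ∑ i, SuperOp.piTensor (Function.update (fun _ => Φ) i Δ)

/-- Completely positive and trace preserving maps. -/
structure IsChannel {a b : Type} [Fintype a] [DecidableEq a] [Fintype b]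
    (Φ : SuperOp a b) : Prop where
  completelyPositive : ∀ (k : ℕ) (X : Matrix (a × Fin k) (a × Fin k) ℂ),
    X.PosSemidef → (Φ.ampl (Fin k) X).PosSemidef
  trace_map : ∀ X, (Φ X).trace = X.trace

/-- Tangent vectors of the set of channels: Hermiticity preserving maps with traceless values. -/
structure IsTangent {a b : Type} [Fintype b] (Δ : SuperOp a b) : Prop where
  map_conjTranspose : ∀ X, Δ X.conjTranspose = (Δ X).conjTranspose
  trace_map : ∀ X, (Δ X).trace = 0

/-- Density matrices. -/
structure IsState {a : Type} [Fintype a] (ρ : Matrix a a ℂ) : Prop where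
  posSemidef : ρ.PosSemidef
  trace_eq : ρ.trace = 1

/-- The trace norm `‖X‖₁ = tr √(X†X)`, the sum of the singular values. -/
def traceNorm {a : Type} [Fintype a] [DecidableEq a] (X : Matrix a a ℂ) : ℝ :=
  ∑ i, √((Matrix.isHermitian_conjTranspose_mul_self X).eigenvalues i)

/-- The completely bounded norm `sup_k ‖Φ ⊗ 𝐈_k‖` of a map between trace classes, operators being
measured in the trace norm. -/
def cbNorm {a b : Type} [Fintype a] [DecidableEq a] [Fintype b] [DecidableEq b]
    (Φ : SuperOp a b) : ℝ≥0∞ :=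
  ⨆ (k : ℕ) (X : Matrix (a × Fin k) (a × Fin k) ℂ) (_ : traceNorm X ≤ 1),
    ENNReal.ofReal (traceNorm (Φ.ampl (Fin k) X))

/-! ### Fisher informations of quantum states -/

/-- A quantity attached to a (not necessarily normalized) positive matrix `ρ` and a Hermitian
matrix `δ`. -/
abbrev StateQuantity : Type 1 := ∀ (d : Type) [Fintype d], Matrix d d ℂ → Matrix d d ℂ → ℝ≥0∞

/-- SLD Fisher information `J^S_ρ(δ) = tr ρ L²` with `L` Hermitian and `δ = (Lρ + ρL)/2`. The value
does not depend on the solution `L`; it is `∞` if there is none. -/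
def sldInfo : StateQuantity := fun d _ ρ δ =>
  ⨅ (L : Matrix d d ℂ) (_ : L.IsHermitian) (_ : δ = (1 / 2 : ℂ) • (L * ρ + ρ * L)),
    ENNReal.ofReal (ρ * (L * L)).trace.re

/-- RLD Fisher information `J^R_ρ(δ) = Re tr ρ L†L` with `δ = Lρ`. The value does not depend on the
solution `L`; it is `∞` if there is none. -/
def rldInfo : StateQuantity := fun d _ ρ δ =>
  ⨅ (L : Matrix d d ℂ) (_ : δ = L * ρ), ENNReal.ofReal (ρ * (L.conjTranspose * L)).trace.re

/-! ### Quantities of channels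

The output of a channel is a classical-quantum system: a classical part `Ω` with reference measure
`μ`, and a quantum part `ℂ^b`. Its states are the densities `Ω → Matrix b b ℂ` with respect to `μ`,
and a channel from `ℂ^a` is given by its density `Ω → SuperOp a b`. Purely quantum outputs are the
case where `Ω` is one point, probability distributions the case where `b` is one point. -/

/-- A quantity attached to a pair `(Φ, Δ)` of a channel and a tangent vector at it. -/
abbrev ChannelQuantity : Type 1 :=
  ∀ (a b : Type) [Fintype a] [DecidableEq a] [Fintype b] [DecidableEq b]
    (Ω : Type) [MeasurableSpace Ω] (_μ : Measure Ω), (Ω → SuperOp a b) → (Ω → SuperOp a b) → ℝ≥0∞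

/-- `sup_ρ J_{(Φ ⊗ 𝐈)(ρ)}((Δ ⊗ 𝐈)(ρ))`, over all states `ρ` of the input system and an ancilla `𝒦`
of arbitrary finite dimension. The Fisher information of a classical-quantum state is the integral
over the classical part. For `J = J^S` this is `G^min`. -/
def inputSup (J : StateQuantity) : ChannelQuantity := fun a b _ _ _ _ _ _ μ Φ Δ =>
  ⨆ (k : ℕ) (ρ : Matrix (a × Fin k) (a × Fin k) ℂ) (_ : IsState ρ),
    ∫⁻ ω, J (b × Fin k) ((Φ ω).ampl (Fin k) ρ) ((Δ ω).ampl (Fin k) ρ) ∂μ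

/-- `(1/n) sup_ρ J_{(Φ^{⊗n} ⊗ 𝐈)(ρ)}((Δ^{(n)} ⊗ 𝐈)(ρ))`. -/
def parallelRate (J : StateQuantity) (n : ℕ) : ChannelQuantity := fun a b _ _ _ _ Ω _ μ Φ Δ =>
  inputSup J (Fin n → a) (Fin n → b) (Fin n → Ω) (Measure.pi fun _ => μ)
    (fun ω => SuperOp.piTensor fun i => Φ (ω i))
    (fun ω => ∑ i, SuperOp.piTensor (Function.update (fun j => Φ (ω j)) i (Δ (ω i)))) / n

/-- The limit of `parallelRate J n` as `n → ∞` (the theorem asserts that it is a limit). -/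
def regularized (J : StateQuantity) : ChannelQuantity := fun a b _ _ _ _ Ω _ μ Φ Δ =>
  limsup (fun n : ℕ => parallelRate J n a b Ω μ Φ Δ) atTop

/-- `G^{p,min}`. -/
def GpMin : ChannelQuantity := regularized sldInfo

/-- `G^{p,R}`. -/
def GpR : ChannelQuantity := regularized rldInfo

/-- The value `G_Φ(Δ)` for a channel with purely quantum output. -/
def ChannelQuantity.quantum (G : ChannelQuantity) {a b : Type} [Fintype a] [DecidableEq a]
    [Fintype b] [DecidableEq b] (Φ Δ : SuperOp a b) : ℝ≥0∞ :=
  G a b Unit (Measure.dirac ()) (fun _ => Φ) (fun _ => Δ)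

/-- A real density `p` on `Ω`, regarded as the (derivative of a) channel that has constant output
with density `p`. -/
def constOutput (a : Type) [Fintype a] {Ω : Type} (p : Ω → ℝ) : Ω → SuperOp a Unit := fun x =>
  { toFun := fun X => Matrix.of fun _ _ => (p x : ℂ) * X.trace
    map_add' := by
      intro X Y
      ext
      simp [mul_add]
    map_smul' := by
      intro r X
      ext
      simp [mul_left_comm] }

/-- The density of `N(0,1)`. -/
def gaussDensity : ℝ → ℝ := ProbabilityTheory.gaussianPDFReal 0 1

/-- The density of `δN(0,1)`. -/
def gaussTangentDensity : ℝ → ℝ := fun x => x * gaussDensity x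

/-! ### Axioms -/

/-- The limits that define `regularized J` exist. -/
def RegularizationConverges (J : StateQuantity) : Prop :=
  (∀ (a b : Type) [Fintype a] [DecidableEq a] [Nonempty a] [Fintype b] [DecidableEq b] [Nonempty b]
    (Φ Δ : SuperOp a b), IsChannel Φ → IsTangent Δ →
    Tendsto (fun n : ℕ => (parallelRate J n).quantum Φ Δ) atTop
      (𝓝 ((regularized J).quantum Φ Δ))) ∧
  ∀ (a : Type) [Fintype a] [DecidableEq a] [Nonempty a],
    Tendsto (fun n : ℕ => parallelRate J n a Unit ℝ volume (constOutput a gaussDensity)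
      (constOutput a gaussTangentDensity)) atTop
      (𝓝 (regularized J a Unit ℝ volume (constOutput a gaussDensity)
        (constOutput a gaussTangentDensity)))

/-- (M) monotonicity under composition with channels on either side. -/
def AxiomM (G : ChannelQuantity) : Prop :=
  ∀ (a b c : Type) [Fintype a] [DecidableEq a] [Nonempty a] [Fintype b] [DecidableEq b] [Nonempty b]
    [Fintype c] [DecidableEq c] [Nonempty c] (Φ Δ : SuperOp a b), IsChannel Φ → IsTangent Δ →
    (∀ Ψ : SuperOp c a, IsChannel Ψ → G.quantum (Φ ∘ₗ Ψ) (Δ ∘ₗ Ψ) ≤ G.quantum Φ Δ) ∧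
    (∀ Ψ : SuperOp b c, IsChannel Ψ → G.quantum (Ψ ∘ₗ Φ) (Ψ ∘ₗ Δ) ≤ G.quantum Φ Δ)

/-- (E) invariance under tensoring with an identity channel. -/
def AxiomE (G : ChannelQuantity) : Prop :=
  ∀ (a b c : Type) [Fintype a] [DecidableEq a] [Nonempty a] [Fintype b] [DecidableEq b] [Nonempty b]
    [Fintype c] [DecidableEq c] [Nonempty c] (Φ Δ : SuperOp a b), IsChannel Φ → IsTangent Δ →
    G.quantum (Φ.ampl c) (Δ.ampl c) = G.quantum Φ Δ

/-- (A1) parallel additivity, `(1/m) G_{Φ^{⊗m}}(Δ^{(m)}) = G_Φ(Δ)` for all `m ≥ 1`. -/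
def AxiomA1 (G : ChannelQuantity) : Prop :=
  ∀ (a b : Type) [Fintype a] [DecidableEq a] [Nonempty a] [Fintype b] [DecidableEq b] [Nonempty b]
    (Φ Δ : SuperOp a b), IsChannel Φ → IsTangent Δ →
    ∀ m : ℕ, 1 ≤ m → G.quantum (Φ.pow m) (Φ.deriv Δ m) / m = G.quantum Φ Δ

/-- (N') `G` is `1` at the standard Gaussian shift. -/
def AxiomN' (G : ChannelQuantity) : Prop :=
  ∀ (a : Type) [Fintype a] [DecidableEq a] [Nonempty a],
    G a Unit ℝ volume (constOutput a gaussDensity) (constOutput a gaussTangentDensity) = 1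

/-- (C1) parallel weak asymptotic continuity. The difference of the values is formed where the
subtracted value is finite; where it is infinite for arbitrarily large `n`, the claim is that
`(1/n) G_{Φⁿ}(Δⁿ)` tends to infinity. -/
def AxiomC1 (G : ChannelQuantity) : Prop :=
  ∀ (a b : Type) [Fintype a] [DecidableEq a] [Nonempty a] [Fintype b] [DecidableEq b] [Nonempty b]
    (Φ Δ : SuperOp a b), IsChannel Φ → IsTangent Δ →
    ∀ Φs Δs : (n : ℕ) → SuperOp (Fin n → a) (Fin n → b),
      (∀ n, IsChannel (Φs n)) → (∀ n, IsTangent (Δs n)) →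
      Tendsto (fun n => cbNorm (Φs n - Φ.pow n)) atTop (𝓝 0) →
      Tendsto (fun n : ℕ => cbNorm (Δs n - Φ.deriv Δ n) / ENNReal.ofReal √n) atTop (𝓝 0) →
      ((∀ᶠ n in atTop, G.quantum (Φ.pow n) (Φ.deriv Δ n) ≠ ⊤) →
        0 ≤ liminf (fun n : ℕ => ((G.quantum (Φs n) (Δs n) : EReal) -
          (G.quantum (Φ.pow n) (Φ.deriv Δ n) : EReal)) / (n : EReal)) atTop) ∧
      ((∃ᶠ n in atTop, G.quantum (Φ.pow n) (Φ.deriv Δ n) = ⊤) →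
        Tendsto (fun n : ℕ => G.quantum (Φs n) (Δs n) / n) atTop (𝓝 ⊤))

end

/-!
Both Fisher informations are quadratic and have a variational description: for a positive `ρ` and
a Hermitian `δ`, the value is the supremum of `2 Re tr X†δ - Re tr ρ X†X`, over all Hermitian `X`
for the SLD information and over all `X` for the RLD information (`isVariational_sldInfo`,
`isVariational_rldInfo`). The two cases differ only in the set of test matrices, so everything is
proved once, for a quantity `J` with `IsVariational h J`; the proposition `h` says whether the test
matrices are required to be Hermitian.

Pulling test matrices back along the adjoint of a channel, with the Kadison-Schwarz inequality,
shows that `J` is monotone under channels (`exists_test_of_channel`, `channelInfo_mono`).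

The key to the limits and to (C1) is that i.i.d. information can be witnessed by test matrices of
small operator norm. For `k` copies, the natural test matrix is the sum `∑ᵢ Xᵢ` of the one-copy
operators; it attains `k` times the value `v` of `X`, but its norm is of order `k`. It is replaced
by a combination `s⁻¹ ∑ₐ cₐ Uₐ^{⊗k}` of tensor powers of unitaries `Uₐ ≈ 1 + s Yₐ` (Cayley
transforms), with `∑ cₐ = 0`, `∑ cₐ Yₐ = X` and `s` a small multiple of `k^{-1/2}`. This has norm
`O(√k)`, and it still attains at least `k (v - ε)` for every `k ≥ 1` (`exists_collective_test`,
`exists_attains_piT`). The functional is linear in `(ρ, δ)`; a test matrix of norm `O(√n)` therefore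
responds to a perturbation of `Φ^{⊗n}` of cb-norm `o(1)` and of `Δ^{(n)}` of cb-norm `o(√n)` with a
change of `o(n)` only (`Attains.perturb`). Grouping the uses of `Φ` into blocks of length `m`
(`Attains.of_blocks`), channels close to `Φ^{⊗n}` thus have information at least `n t` for large
`n`, for every `t` below the supremum over `m` of the information per use of `Φ^{⊗m}`
(`eventually_attains`, `eventually_lt_channelInfo`).

Applied to `Φ^{⊗n}` itself, this shows that the rates converge to their supremum
(`tendsto_channelInfo_div`, `regularized_quantum`); applied to perturbed channels, it gives (C1).
(M), (E) and (A1) then follow from monotonicity and from relabelling tensor factors. For the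
Gaussian pair the logarithmic derivative is a number, so that the output information of `n` copies
is the second moment of a sum of `n` independent standard Gaussian variables, whatever the input.
-/

open scoped Matrix Kronecker

set_option linter.unusedSectionVars false
set_option linter.unusedFintypeInType false
set_option linter.unusedDecidableInType false

/-! ### The derivative of a product -/

/-- The derivative of `∏ i, p i` when each factor `p i` moves with velocity `d i`. -/
def prodDeriv {ι R : Type} [Fintype ι] [DecidableEq ι] [CommRing R] (p d : ι → R) : R :=
  ∑ i, ∏ j, Function.update p i (d i) j

section prodDeriv

variable {ι κ R : Type} [Fintype ι] [DecidableEq ι] [Fintype κ] [DecidableEq κ] [CommRing R]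

lemma prod_update_eq (p : ι → R) (i : ι) (x : R) :
    ∏ j, Function.update p i x j = x * ∏ j ∈ Finset.univ \ {i}, p j :=
  Finset.prod_update_of_mem (Finset.mem_univ i) p x

lemma prodDeriv_equiv (e : ι ≃ κ) (p d : κ → R) :
    prodDeriv (fun i => p (e i)) (fun i => d (e i)) = prodDeriv p d := by
  unfold prodDeriv
  refine Fintype.sum_equiv e _ _ fun i => Fintype.prod_equiv e _ _ fun j => ?_
  by_cases h : j = i
  · subst h; simp
  · simp [h]

lemma prodDeriv_sum (p d : ι ⊕ κ → R) :
    prodDeriv p d = prodDeriv (fun i => p (.inl i)) (fun i => d (.inl i)) * ∏ j, p (.inr j) +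
      (∏ i, p (.inl i)) * prodDeriv (fun j => p (.inr j)) (fun j => d (.inr j)) := by
  simp only [prodDeriv, Fintype.sum_sum_type, Fintype.prod_sum_type, Finset.sum_mul,
    Finset.mul_sum]
  congr 1
  · refine Finset.sum_congr rfl fun i _ => congrArg₂ _ (Finset.prod_congr rfl fun j _ => ?_)
      (Finset.prod_congr rfl fun j _ => ?_)
    · by_cases h : j = i
      · subst h; simp
      · simp [h]
    · simp
  · refine Finset.sum_congr rfl fun i _ => congrArg₂ _ (Finset.prod_congr rfl fun j _ => ?_)
      (Finset.prod_congr rfl fun j _ => ?_)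
    · simp
    · by_cases h : j = i
      · subst h; simp
      · simp [h]

lemma prodDeriv_prod (p d : ι × κ → R) :
    prodDeriv p d =
      prodDeriv (fun i => ∏ j, p (i, j)) (fun i => prodDeriv (fun j => p (i, j))
        (fun j => d (i, j))) := by
  simp only [prodDeriv, Fintype.sum_prod_type, Fintype.prod_prod_type]
  refine Finset.sum_congr rfl fun i _ => ?_
  rw [prod_update_eq, Finset.sum_mul]
  refine Finset.sum_congr rfl fun j _ => ?_
  rw [← prod_update_eq]
  refine Finset.prod_congr rfl fun i' _ => ?_
  by_cases h : i' = i
  · subst h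
    rw [Function.update_self]
    refine Finset.prod_congr rfl fun j' _ => ?_
    by_cases h' : j' = j
    · subst h'; simp
    · simp [h']
  · rw [Function.update_of_ne h]
    refine Finset.prod_congr rfl fun j' _ => ?_
    simp [h]

lemma prodDeriv_mul_right (p d q : ι → R) :
    prodDeriv (fun i => p i * q i) (fun i => d i * q i) = prodDeriv p d * ∏ i, q i := by
  simp only [prodDeriv, Finset.sum_mul, ← Finset.prod_mul_distrib]
  refine Finset.sum_congr rfl fun i _ => Finset.prod_congr rfl fun j _ => ?_
  by_cases h : j = i
  · subst h; simp
  · simp [h]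

lemma prodDeriv_const (x y : R) :
    prodDeriv (fun _ : ι => x) (fun _ => y) = Fintype.card ι * (y * x ^ (Fintype.card ι - 1)) := by
  simp only [prodDeriv, prod_update_eq]
  simp [Finset.card_sdiff]

end prodDeriv

/-! ### Matrix elements of maps between matrix algebras -/

namespace SuperOp

variable {a b c d a' b' e : Type} [Fintype a] [DecidableEq a] [Fintype b] [DecidableEq b]
  [Fintype c] [DecidableEq c] [Fintype d] [DecidableEq d] [Fintype a'] [DecidableEq a']
  [Fintype b'] [DecidableEq b'] [Fintype e] [DecidableEq e]
  {ι κ : Type} [Fintype ι] [DecidableEq ι] [Fintype κ] [DecidableEq κ]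

lemma apply_eq_sum (Φ : SuperOp a b) (X : Matrix a a ℂ) (g g' : b) :
    Φ X g g' = ∑ f, ∑ f', X f f' * Φ (Matrix.single f f' 1) g g' := by
  conv_lhs => rw [Matrix.matrix_eq_sum_single X]
  simp only [map_sum, Matrix.sum_apply]
  refine Finset.sum_congr rfl fun f _ => Finset.sum_congr rfl fun f' _ => ?_
  have : Matrix.single f f' (X f f') = X f f' • Matrix.single f f' (1 : ℂ) := by simp
  rw [this, map_smul, Matrix.smul_apply, smul_eq_mul]

lemma ext_single {Φ Ψ : SuperOp a b} (h : ∀ f f' g g',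
    Φ (Matrix.single f f' 1) g g' = Ψ (Matrix.single f f' 1) g g') : Φ = Ψ := by
  ext1 X
  ext g g'
  rw [apply_eq_sum Φ, apply_eq_sum Ψ]
  simp only [h]

lemma tensor_single (Φ : SuperOp a b) (Ψ : SuperOp c d) (f f' : a × c) (g g' : b × d) :
    Φ.tensor Ψ (Matrix.single f f' 1) g g' =
      Φ (Matrix.single f.1 f'.1 1) g.1 g'.1 * Ψ (Matrix.single f.2 f'.2 1) g.2 g'.2 := by
  simp only [tensor, LinearMap.coe_mk, AddHom.coe_mk, Matrix.of_apply]
  rw [Finset.sum_eq_single f, Finset.sum_eq_single f']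
  · simp
  · intro h _ hh; simp [Matrix.single, hh.symm]
  · simp
  · intro h _ hh; simp [Matrix.single, hh.symm]
  · simp

lemma ampl_single (Φ : SuperOp a b) (f f' : a × c) (g g' : b × c) :
    Φ.ampl c (Matrix.single f f' 1) g g' =
      Φ (Matrix.single f.1 f'.1 1) g.1 g'.1 * Matrix.single f.2 f'.2 1 g.2 g'.2 :=
  tensor_single _ _ _ _ _ _

/-- The tensor product of a family of maps over an arbitrary finite index set. -/
def piT (Φ : ι → SuperOp a b) : SuperOp (ι → a) (ι → b) where
  toFun X := Matrix.of fun g g' => ∑ f : ι → a, ∑ f' : ι → a,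
    X f f' * ∏ i, Φ i (Matrix.single (f i) (f' i) 1) (g i) (g' i)
  map_add' X Y := by
    ext g g'
    simp [add_mul, Finset.sum_add_distrib]
  map_smul' r X := by
    ext g g'
    simp [Finset.mul_sum, mul_assoc]

/-- The derivative of `piT Φ` in the direction `Δ`, given by the Leibniz rule. -/
def piTDeriv (Φ Δ : ι → SuperOp a b) : SuperOp (ι → a) (ι → b) :=
  ∑ i, piT (Function.update Φ i (Δ i))

lemma piT_apply (Φ : ι → SuperOp a b) (X : Matrix (ι → a) (ι → a) ℂ) (g g' : ι → b) :
    piT Φ X g g' = ∑ f : ι → a, ∑ f' : ι → a,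
      X f f' * ∏ i, Φ i (Matrix.single (f i) (f' i) 1) (g i) (g' i) := rfl

lemma piT_single (Φ : ι → SuperOp a b) (f f' : ι → a) (g g' : ι → b) :
    piT Φ (Matrix.single f f' 1) g g' =
      ∏ i, Φ i (Matrix.single (f i) (f' i) 1) (g i) (g' i) := by
  rw [piT_apply, Finset.sum_eq_single f, Finset.sum_eq_single f']
  · simp
  · intro h _ hh; simp [Matrix.single, hh.symm]
  · simp
  · intro h _ hh; simp [Matrix.single, hh.symm]
  · simp

lemma piTDeriv_single (Φ Δ : ι → SuperOp a b) (f f' : ι → a) (g g' : ι → b) :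
    piTDeriv Φ Δ (Matrix.single f f' 1) g g' =
      prodDeriv (fun i => Φ i (Matrix.single (f i) (f' i) 1) (g i) (g' i))
        (fun i => Δ i (Matrix.single (f i) (f' i) 1) (g i) (g' i)) := by
  simp only [piTDeriv, LinearMap.sum_apply, Matrix.sum_apply, piT_single, prodDeriv]
  refine Finset.sum_congr rfl fun i _ => Finset.prod_congr rfl fun j _ => ?_
  by_cases h : j = i
  · subst h; simp
  · simp [h]

lemma comp_single (Φ : SuperOp b c) (Ψ : SuperOp a b) (f f' : a) (g g' : c) :
    (Φ ∘ₗ Ψ) (Matrix.single f f' 1) g g' =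
      ∑ h, ∑ h', Ψ (Matrix.single f f' 1) h h' * Φ (Matrix.single h h' 1) g g' := by
  rw [LinearMap.comp_apply, apply_eq_sum]

lemma ampl_comp (Φ : SuperOp b c) (Ψ : SuperOp a b) :
    SuperOp.ampl e (Φ ∘ₗ Ψ) = Φ.ampl e ∘ₗ Ψ.ampl e := by
  refine ext_single fun f f' g g' => ?_
  rw [comp_single, ampl_single, comp_single]
  simp only [ampl_single, Fintype.sum_prod_type]
  rw [Finset.sum_mul]
  refine Finset.sum_congr rfl fun h _ => ?_
  rw [Finset.sum_eq_single f.2, Finset.sum_mul]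
  · refine Finset.sum_congr rfl fun h' _ => ?_
    rw [Finset.sum_eq_single f'.2]
    · simp; ring
    · intro y _ hy; simp [Matrix.single, hy.symm]
    · simp
  · intro y _ hy; simp [Matrix.single, hy.symm]
  · simp

lemma piT_comp (Φ : ι → SuperOp b c) (Ψ : ι → SuperOp a b) :
    piT (fun i => Φ i ∘ₗ Ψ i) = piT Φ ∘ₗ piT Ψ := by
  refine ext_single fun f f' g g' => ?_
  rw [comp_single, piT_single]
  simp only [piT_single, comp_single, ← Finset.prod_mul_distrib]
  rw [Finset.prod_univ_sum, Fintype.piFinset_univ]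
  refine Finset.sum_congr rfl fun h _ => ?_
  rw [Finset.prod_univ_sum, Fintype.piFinset_univ]

lemma piTDeriv_comp_right (Φ Δ : ι → SuperOp b c) (Ψ : ι → SuperOp a b) :
    piTDeriv (fun i => Φ i ∘ₗ Ψ i) (fun i => Δ i ∘ₗ Ψ i) = piTDeriv Φ Δ ∘ₗ piT Ψ := by
  ext1 X
  simp only [piTDeriv, LinearMap.sum_apply, LinearMap.comp_apply]
  refine Finset.sum_congr rfl fun i _ => ?_
  rw [← LinearMap.comp_apply, ← piT_comp]
  refine congrArg (fun T => piT T X) (funext fun j => ?_)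
  by_cases h : j = i
  · subst h; simp
  · simp [h]

lemma piTDeriv_comp_left (Φ Δ : ι → SuperOp a b) (Ψ : ι → SuperOp b c) :
    piTDeriv (fun i => Ψ i ∘ₗ Φ i) (fun i => Ψ i ∘ₗ Δ i) = piT Ψ ∘ₗ piTDeriv Φ Δ := by
  ext1 X
  simp only [piTDeriv, LinearMap.sum_apply, LinearMap.comp_apply, map_sum]
  refine Finset.sum_congr rfl fun i _ => ?_
  rw [← LinearMap.comp_apply, ← piT_comp]
  refine congrArg (fun T => piT T X) (funext fun j => ?_)
  by_cases h : j = i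
  · subst h; simp
  · simp [h]

/-- `Φ'` is `Φ` with the basis vectors of its input and output spaces renamed. -/
def Relabel (ea : a ≃ a') (eb : b ≃ b') (Φ : SuperOp a b) (Φ' : SuperOp a' b') : Prop :=
  ∀ X, (Φ' X).submatrix eb eb = Φ (X.submatrix ea ea)

lemma relabel_of_single {ea : a ≃ a'} {eb : b ≃ b'} {Φ : SuperOp a b} {Φ' : SuperOp a' b'}
    (h : ∀ f f' g g', Φ' (Matrix.single (ea f) (ea f') 1) (eb g) (eb g') =
      Φ (Matrix.single f f' 1) g g') : Relabel ea eb Φ Φ' := by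
  intro X
  ext g g'
  rw [Matrix.submatrix_apply, apply_eq_sum Φ', apply_eq_sum Φ]
  refine (Fintype.sum_equiv ea _ _ fun f => Fintype.sum_equiv ea _ _ fun f' => ?_).symm
  rw [h]; rfl

lemma Relabel.symm {ea : a ≃ a'} {eb : b ≃ b'} {Φ : SuperOp a b} {Φ' : SuperOp a' b'}
    (h : Relabel ea eb Φ Φ') : Relabel ea.symm eb.symm Φ' Φ := by
  intro X
  have := h (X.submatrix ea.symm ea.symm)
  simp only [Matrix.submatrix_submatrix, Equiv.symm_comp_self, Matrix.submatrix_id_id] at this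
  rw [← this]
  simp

lemma Relabel.single {ea : a ≃ a'} {eb : b ≃ b'} {Φ : SuperOp a b} {Φ' : SuperOp a' b'}
    (h : Relabel ea eb Φ Φ') (f f' : a) (g g' : b) :
    Φ' (Matrix.single (ea f) (ea f') 1) (eb g) (eb g') = Φ (Matrix.single f f' 1) g g' := by
  have := congrFun (congrFun (h (Matrix.single (ea f) (ea f') 1)) g) g'
  rw [Matrix.submatrix_apply] at this
  rw [this]
  have hX : (Matrix.single (ea f) (ea f') (1 : ℂ)).submatrix ea ea = Matrix.single f f' 1 := by
    ext x y
    simp [Matrix.single]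
  rw [hX]

lemma Relabel.ampl {ea : a ≃ a'} {eb : b ≃ b'} {Φ : SuperOp a b} {Φ' : SuperOp a' b'}
    (h : Relabel ea eb Φ Φ') (ec : c ≃ e) :
    Relabel (ea.prodCongr ec) (eb.prodCongr ec) (Φ.ampl c) (Φ'.ampl e) := by
  refine relabel_of_single fun f f' g g' => ?_
  rw [ampl_single, ampl_single]
  simp only [Equiv.prodCongr_apply, Prod.map_fst, Prod.map_snd, h.single]
  congr 1
  simp [Matrix.single]

lemma relabel_refl (Φ : SuperOp a b) : Relabel (Equiv.refl a) (Equiv.refl b) Φ Φ := fun _ => rfl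

lemma relabel_piT (e : ι ≃ κ) (Φ : κ → SuperOp a b) :
    Relabel (e.arrowCongr (Equiv.refl a)) (e.arrowCongr (Equiv.refl b))
      (piT fun i => Φ (e i)) (piT Φ) := by
  refine relabel_of_single fun f f' g g' => ?_
  rw [piT_single, piT_single]
  exact (Fintype.prod_equiv e _ _ fun i => by simp).symm

lemma relabel_piTDeriv (e : ι ≃ κ) (Φ Δ : κ → SuperOp a b) :
    Relabel (e.arrowCongr (Equiv.refl a)) (e.arrowCongr (Equiv.refl b))
      (piTDeriv (fun i => Φ (e i)) (fun i => Δ (e i))) (piTDeriv Φ Δ) := by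
  refine relabel_of_single fun f f' g g' => ?_
  rw [piTDeriv_single, piTDeriv_single, ← prodDeriv_equiv e]
  simp

lemma relabel_piT_sum (Φ : ι ⊕ κ → SuperOp a b) :
    Relabel (Equiv.sumArrowEquivProdArrow ι κ a) (Equiv.sumArrowEquivProdArrow ι κ b)
      (piT Φ) ((piT fun i => Φ (.inl i)).tensor (piT fun j => Φ (.inr j))) := by
  refine relabel_of_single fun f f' g g' => ?_
  rw [tensor_single, piT_single, piT_single, piT_single, Fintype.prod_sum_type]
  rfl

lemma relabel_piTDeriv_sum (Φ Δ : ι ⊕ κ → SuperOp a b) :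
    Relabel (Equiv.sumArrowEquivProdArrow ι κ a) (Equiv.sumArrowEquivProdArrow ι κ b)
      (piTDeriv Φ Δ)
      ((piTDeriv (fun i => Φ (.inl i)) fun i => Δ (.inl i)).tensor (piT fun j => Φ (.inr j)) +
        (piT fun i => Φ (.inl i)).tensor
          (piTDeriv (fun j => Φ (.inr j)) fun j => Δ (.inr j))) := by
  refine relabel_of_single fun f f' g g' => ?_
  rw [LinearMap.add_apply, Matrix.add_apply, tensor_single, tensor_single, piT_single, piT_single,
    piTDeriv_single, piTDeriv_single, piTDeriv_single, prodDeriv_sum]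
  rfl

lemma relabel_piT_prod (Φ : ι × κ → SuperOp a b) :
    Relabel (Equiv.curry ι κ a) (Equiv.curry ι κ b)
      (piT Φ) (piT fun i => piT fun j => Φ (i, j)) := by
  refine relabel_of_single fun f f' g g' => ?_
  simp only [piT_single, Fintype.prod_prod_type]
  rfl

lemma relabel_piTDeriv_prod (Φ Δ : ι × κ → SuperOp a b) :
    Relabel (Equiv.curry ι κ a) (Equiv.curry ι κ b)
      (piTDeriv Φ Δ)
      (piTDeriv (fun i => piT fun j => Φ (i, j))
        (fun i => piTDeriv (fun j => Φ (i, j)) fun j => Δ (i, j))) := by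
  refine relabel_of_single fun f f' g g' => ?_
  simp only [piTDeriv_single, piT_single, prodDeriv_prod]
  rfl

lemma prod_single (f f' g g' : ι → c) :
    ∏ i, Matrix.single (f i) (f' i) (1 : ℂ) (g i) (g' i) = Matrix.single f f' 1 g g' := by
  simp only [Matrix.single_apply, Finset.prod_ite_zero, Finset.prod_const_one, funext_iff]
  simp [forall_and]

lemma relabel_piT_ampl (Φ : ι → SuperOp a b) :
    Relabel (Equiv.arrowProdEquivProdArrow ι (fun _ => a) (fun _ => c))
      (Equiv.arrowProdEquivProdArrow ι (fun _ => b) (fun _ => c))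
      (piT fun i => (Φ i).ampl c) ((piT Φ).ampl (ι → c)) := by
  refine relabel_of_single fun f f' g g' => ?_
  simp only [piT_single, ampl_single, Finset.prod_mul_distrib]
  rw [prod_single]
  rfl

lemma relabel_piTDeriv_ampl (Φ Δ : ι → SuperOp a b) :
    Relabel (Equiv.arrowProdEquivProdArrow ι (fun _ => a) (fun _ => c))
      (Equiv.arrowProdEquivProdArrow ι (fun _ => b) (fun _ => c))
      (piTDeriv (fun i => (Φ i).ampl c) fun i => (Δ i).ampl c)
      ((piTDeriv Φ Δ).ampl (ι → c)) := by
  refine relabel_of_single fun f f' g g' => ?_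
  simp only [piTDeriv_single, ampl_single, prodDeriv_mul_right]
  rw [prod_single]
  rfl

lemma relabel_ampl_ampl (Φ : SuperOp a b) :
    Relabel (Equiv.prodAssoc a c e) (Equiv.prodAssoc b c e) ((Φ.ampl c).ampl e)
      (Φ.ampl (c × e)) := by
  refine relabel_of_single fun f f' g g' => ?_
  simp only [ampl_single, mul_assoc]
  congr 1
  simp only [Matrix.single_apply, Equiv.prodAssoc_apply, Prod.ext_iff]
  split_ifs <;> simp_all

/-- Exchanges the last two factors of a triple product. -/
def swapLast (a c e : Type) : (a × c) × e ≃ (a × e) × c :=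
  ((Equiv.prodAssoc a c e).trans ((Equiv.refl a).prodCongr (Equiv.prodComm c e))).trans
    (Equiv.prodAssoc a e c).symm

lemma relabel_tensor_ampl (Φ : SuperOp a b) (Ψ : SuperOp c d) :
    Relabel (swapLast a e c) (swapLast b e d) ((Φ.ampl e).tensor Ψ) ((Φ.tensor Ψ).ampl e) := by
  refine relabel_of_single fun f f' g g' => ?_
  simp only [ampl_single, tensor_single, swapLast]
  simp
  ring

lemma relabel_piT_unique [Unique ι] (Φ : SuperOp a b) :
    Relabel (Equiv.funUnique ι a) (Equiv.funUnique ι b) (piT fun _ => Φ) Φ := by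
  refine relabel_of_single fun f f' g g' => ?_
  simp [piT_single]

lemma relabel_piTDeriv_unique [Unique ι] (Φ Δ : SuperOp a b) :
    Relabel (Equiv.funUnique ι a) (Equiv.funUnique ι b) (piTDeriv (fun _ => Φ) fun _ => Δ) Δ := by
  refine relabel_of_single fun f f' g g' => ?_
  simp [piTDeriv_single, prodDeriv]

lemma Relabel.add {ea : a ≃ a'} {eb : b ≃ b'} {Φ Ψ : SuperOp a b} {Φ' Ψ' : SuperOp a' b'}
    (h : Relabel ea eb Φ Φ') (h' : Relabel ea eb Ψ Ψ') : Relabel ea eb (Φ + Ψ) (Φ' + Ψ') := by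
  intro X
  rw [LinearMap.add_apply, LinearMap.add_apply, ← h, ← h']
  rfl

lemma ampl_add (Φ Ψ : SuperOp a b) : (Φ + Ψ).ampl c = Φ.ampl c + Ψ.ampl c := by
  refine ext_single fun f f' g g' => ?_
  simp [ampl_single, add_mul]

lemma ampl_sub (Φ Ψ : SuperOp a b) : (Φ - Ψ).ampl c = Φ.ampl c - Ψ.ampl c := by
  refine ext_single fun f f' g g' => ?_
  simp [ampl_single, sub_mul]

end SuperOp

/-! ### Channels and Kraus operators -/

namespace SuperOp

variable {a b c d a' b' e : Type} [Fintype a] [DecidableEq a] [Fintype b] [DecidableEq b]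
  [Fintype c] [DecidableEq c] [Fintype d] [DecidableEq d] [Fintype a'] [DecidableEq a']
  [Fintype b'] [DecidableEq b'] [Fintype e] [DecidableEq e]
  {ι κ : Type} [Fintype ι] [DecidableEq ι] [Fintype κ] [DecidableEq κ]

/-- `Φ(X) = ∑ r, K r * X * (K r)ᴴ`, expressed on matrix units. -/
def HasKraus {R : Type} [Fintype R] (K : R → Matrix b a ℂ) (Φ : SuperOp a b) : Prop :=
  ∀ f f' g g', Φ (Matrix.single f f' 1) g g' = ∑ r, K r g f * star (K r g' f')

lemma HasKraus.apply {R : Type} [Fintype R] {K : R → Matrix b a ℂ} {Φ : SuperOp a b}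
    (h : HasKraus K Φ) (X : Matrix a a ℂ) : Φ X = ∑ r, K r * X * (K r)ᴴ := by
  ext g g'
  rw [apply_eq_sum, Matrix.sum_apply]
  simp only [h _ _ _ _, Matrix.mul_apply, Matrix.conjTranspose_apply, Finset.mul_sum,
    Finset.sum_mul]
  rw [Finset.sum_comm]
  simp_rw [Finset.sum_comm (s := (Finset.univ : Finset a)) (t := (Finset.univ : Finset R))]
  refine Finset.sum_congr rfl fun r _ => Finset.sum_congr rfl fun f' _ =>
    Finset.sum_congr rfl fun f _ => ?_
  ring

lemma HasKraus.posSemidef {R : Type} [Fintype R] {K : R → Matrix b a ℂ} {Φ : SuperOp a b}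
    (h : HasKraus K Φ) {X : Matrix a a ℂ} (hX : X.PosSemidef) : (Φ X).PosSemidef := by
  rw [h.apply]
  exact Matrix.posSemidef_sum _ fun r _ => hX.mul_mul_conjTranspose_same _

lemma HasKraus.tensor {R S : Type} [Fintype R] [Fintype S] {K : R → Matrix b a ℂ}
    {Φ : SuperOp a b} {T : S → Matrix d c ℂ} {Ψ : SuperOp c d}
    (h : HasKraus K Φ) (h' : HasKraus T Ψ) :
    HasKraus (fun r : R × S => K r.1 ⊗ₖ T r.2) (Φ.tensor Ψ) := by
  intro f f' g g'
  rw [tensor_single, h, h', Finset.sum_mul_sum, Fintype.sum_prod_type]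
  refine Finset.sum_congr rfl fun r _ => Finset.sum_congr rfl fun s _ => ?_
  simp only [Matrix.kroneckerMap_apply, star_mul']
  ring

lemma hasKraus_id : HasKraus (fun _ : Unit => (1 : Matrix a a ℂ)) (LinearMap.id : SuperOp a a) := by
  intro f f' g g'
  simp only [LinearMap.id_apply, Matrix.single_apply, Matrix.one_apply, Finset.univ_unique,
    Finset.sum_const, Finset.card_singleton, one_smul]
  split_ifs <;> simp_all

lemma HasKraus.piT {R : Type} [Fintype R] {K : ι → R → Matrix b a ℂ} {Φ : ι → SuperOp a b}
    (h : ∀ i, HasKraus (K i) (Φ i)) :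
    HasKraus (fun r : ι → R => Matrix.of fun g f => ∏ i, K i (r i) (g i) (f i))
      (piT Φ) := by
  intro f f' g g'
  rw [piT_single]
  simp only [h _ _ _ _ _, Finset.prod_univ_sum, Fintype.piFinset_univ, Matrix.of_apply,
    Finset.prod_mul_distrib, star_prod]

/-- The Choi matrix of a completely positive map is a sum of rank-one matrices, which are the Kraus
operators. -/
lemma exists_hasKraus {Φ : SuperOp a b} (h : IsChannel Φ) :
    ∃ (n : ℕ) (K : Fin n → Matrix b a ℂ), HasKraus K Φ := by
  let e := Fintype.equivFin a
  let v : a × Fin (Fintype.card a) → ℂ := fun x => if e x.1 = x.2 then 1 else 0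
  have hC := h.completelyPositive _ _ (Matrix.posSemidef_vecMulVec_self_star v)
  obtain ⟨n, w, hw⟩ := Matrix.posSemidef_iff_eq_sum_vecMulVec.mp hC
  refine ⟨n, fun r => Matrix.of fun g f => w r (g, e f), fun f f' g g' => ?_⟩
  have hE := congrFun (congrFun hw (g, e f)) (g', e f')
  rw [apply_eq_sum] at hE
  simp only [Matrix.sum_apply, Matrix.vecMulVec_apply, ampl_single, Fintype.sum_prod_type] at hE
  simp only [Matrix.of_apply]
  refine Eq.trans ?_ hE
  simp [v, Matrix.single_apply, ite_and]

lemma trace_apply_eq_sum (Φ : SuperOp a b) (X : Matrix a a ℂ) :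
    (Φ X).trace = ∑ f, ∑ f', X f f' * (Φ (Matrix.single f f' 1)).trace := by
  simp only [Matrix.trace, Matrix.diag_apply, Finset.mul_sum]
  simp_rw [apply_eq_sum Φ X]
  rw [Finset.sum_comm]
  simp_rw [Finset.sum_comm (s := (Finset.univ : Finset b)) (t := (Finset.univ : Finset a))]

lemma trace_tensor_single (Φ : SuperOp a b) (Ψ : SuperOp c d) (f f' : a × c) :
    (Φ.tensor Ψ (Matrix.single f f' 1)).trace =
      (Φ (Matrix.single f.1 f'.1 1)).trace * (Ψ (Matrix.single f.2 f'.2 1)).trace := by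
  simp only [Matrix.trace, Matrix.diag_apply, tensor_single, Fintype.sum_prod_type,
    Finset.sum_mul_sum]

lemma trace_piT_single (Φ : ι → SuperOp a b) (f f' : ι → a) :
    (piT Φ (Matrix.single f f' 1)).trace = ∏ i, (Φ i (Matrix.single (f i) (f' i) 1)).trace := by
  simp only [Matrix.trace, Matrix.diag_apply, piT_single, Finset.prod_univ_sum,
    Fintype.piFinset_univ]

lemma trace_map_of_single {Φ : SuperOp a b} (h : ∀ f f',
    (Φ (Matrix.single f f' 1)).trace = (Matrix.single f f' (1 : ℂ)).trace) (X : Matrix a a ℂ) :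
    (Φ X).trace = X.trace := by
  rw [trace_apply_eq_sum, ← LinearMap.id_apply (R := ℂ) X, trace_apply_eq_sum]
  simp [h]

lemma tensor_trace {Φ : SuperOp a b} {Ψ : SuperOp c d} (h : ∀ X, (Φ X).trace = X.trace)
    (h' : ∀ X, (Ψ X).trace = X.trace) (X : Matrix (a × c) (a × c) ℂ) :
    (Φ.tensor Ψ X).trace = X.trace := by
  refine trace_map_of_single (fun f f' => ?_) X
  rw [trace_tensor_single, h, h']
  by_cases h1 : f.1 = f'.1 <;> by_cases h2 : f.2 = f'.2 <;>
    simp [Matrix.trace_single_eq_of_ne, h1, h2, Prod.ext_iff]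
  obtain ⟨x, y⟩ := f
  obtain ⟨x', y'⟩ := f'
  obtain rfl : x = x' := h1
  obtain rfl : y = y' := h2
  simp

lemma piT_trace {Φ : ι → SuperOp a b} (h : ∀ i X, (Φ i X).trace = X.trace)
    (X : Matrix (ι → a) (ι → a) ℂ) : (piT Φ X).trace = X.trace := by
  refine trace_map_of_single (fun f f' => ?_) X
  rw [trace_piT_single]
  simp only [h]
  by_cases hf : f = f'
  · subst hf; simp
  · obtain ⟨i, hi⟩ := Function.ne_iff.mp hf
    rw [Matrix.trace_single_eq_of_ne _ _ _ hf]
    exact Finset.prod_eq_zero (Finset.mem_univ i) (Matrix.trace_single_eq_of_ne _ _ _ hi)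

lemma HasKraus.isChannel {R : Type} [Fintype R] {K : R → Matrix b a ℂ} {Φ : SuperOp a b}
    (h : HasKraus K Φ) (ht : ∀ X, (Φ X).trace = X.trace) : IsChannel Φ :=
  ⟨fun _ _ hX => (h.tensor hasKraus_id).posSemidef hX, ht⟩

lemma isChannel_id : IsChannel (LinearMap.id : SuperOp a a) :=
  hasKraus_id.isChannel fun _ => rfl

end SuperOp

open SuperOp

section IsChannel

variable {a b c d a' b' e : Type} [Fintype a] [DecidableEq a] [Fintype b] [DecidableEq b]
  [Fintype c] [DecidableEq c] [Fintype d] [DecidableEq d] [Fintype a'] [DecidableEq a']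
  [Fintype b'] [DecidableEq b'] [Fintype e] [DecidableEq e]
  {ι κ : Type} [Fintype ι] [DecidableEq ι] [Fintype κ] [DecidableEq κ]

lemma IsChannel.tensor {Φ : SuperOp a b} {Ψ : SuperOp c d} (h : IsChannel Φ) (h' : IsChannel Ψ) :
    IsChannel (Φ.tensor Ψ) := by
  obtain ⟨n, K, hK⟩ := exists_hasKraus h
  obtain ⟨m, T, hT⟩ := exists_hasKraus h'
  exact (hK.tensor hT).isChannel (tensor_trace h.trace_map h'.trace_map)

lemma IsChannel.ampl {Φ : SuperOp a b} (h : IsChannel Φ) : IsChannel (Φ.ampl c) :=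
  h.tensor isChannel_id

lemma IsChannel.piT {Φ : SuperOp a b} (h : IsChannel Φ) :
    IsChannel (SuperOp.piT fun _ : ι => Φ) := by
  obtain ⟨n, K, hK⟩ := exists_hasKraus h
  exact (HasKraus.piT fun _ => hK).isChannel (piT_trace fun _ => h.trace_map)

lemma IsChannel.comp {Φ : SuperOp b c} {Ψ : SuperOp a b} (h : IsChannel Φ) (h' : IsChannel Ψ) :
    IsChannel (Φ ∘ₗ Ψ) := by
  refine ⟨fun k X hX => ?_, fun X => ?_⟩
  · rw [ampl_comp]
    exact h.completelyPositive k _ (h'.completelyPositive k _ hX)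
  · rw [LinearMap.comp_apply, h.trace_map, h'.trace_map]

lemma IsChannel.posSemidef {Φ : SuperOp a b} (h : IsChannel Φ) {X : Matrix a a ℂ}
    (hX : X.PosSemidef) : (Φ X).PosSemidef := by
  obtain ⟨n, K, hK⟩ := exists_hasKraus h
  exact hK.posSemidef hX

lemma IsChannel.isState {Φ : SuperOp a b} (h : IsChannel Φ) {X : Matrix a a ℂ}
    (hX : IsState X) : IsState (Φ X) :=
  ⟨h.posSemidef hX.posSemidef, by rw [h.trace_map, hX.trace_eq]⟩

lemma conjTranspose_single_one (f f' : a) :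
    (Matrix.single f f' (1 : ℂ))ᴴ = Matrix.single f' f 1 := by
  rw [Matrix.conjTranspose_single, star_one]

lemma map_conjTranspose_of_single {Φ : SuperOp a b} (h : ∀ f f' g g',
    star (Φ (Matrix.single f f' 1) g g') = Φ (Matrix.single f' f 1) g' g) (X : Matrix a a ℂ) :
    Φ Xᴴ = (Φ X)ᴴ := by
  ext g g'
  rw [Matrix.conjTranspose_apply, apply_eq_sum, apply_eq_sum, star_sum, Finset.sum_comm]
  simp only [star_sum, star_mul', h, Matrix.conjTranspose_apply]

lemma IsChannel.map_conjTranspose {Φ : SuperOp a b} (h : IsChannel Φ) (X : Matrix a a ℂ) :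
    Φ Xᴴ = (Φ X)ᴴ := by
  obtain ⟨n, K, hK⟩ := exists_hasKraus h
  simp only [hK.apply, Matrix.conjTranspose_sum, Matrix.conjTranspose_mul,
    Matrix.conjTranspose_conjTranspose, Matrix.mul_assoc]

lemma star_apply_single {Φ : SuperOp a b} (h : ∀ X, Φ Xᴴ = (Φ X)ᴴ) (f f' : a) (g g' : b) :
    star (Φ (Matrix.single f f' 1) g g') = Φ (Matrix.single f' f 1) g' g := by
  rw [← Matrix.conjTranspose_apply, ← h, conjTranspose_single_one]

lemma IsTangent.tensor {Φ : SuperOp a b} {Ψ : SuperOp c d} (h : IsTangent Φ) (h' : IsChannel Ψ) :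
    IsTangent (Φ.tensor Ψ) := by
  refine ⟨map_conjTranspose_of_single fun f f' g g' => ?_, fun X => ?_⟩
  · rw [tensor_single, tensor_single, star_mul', star_apply_single h.map_conjTranspose,
      star_apply_single h'.map_conjTranspose]
  · rw [trace_apply_eq_sum]
    simp [trace_tensor_single, h.trace_map]

lemma IsTangent.ampl {Φ : SuperOp a b} (h : IsTangent Φ) : IsTangent (Φ.ampl c) :=
  h.tensor isChannel_id

lemma IsTangent.piTDeriv {Φ Δ : SuperOp a b} (hΦ : IsChannel Φ) (hΔ : IsTangent Δ) :
    IsTangent (SuperOp.piTDeriv (fun _ : ι => Φ) fun _ => Δ) := by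
  refine ⟨map_conjTranspose_of_single fun f f' g g' => ?_, fun X => ?_⟩
  · simp only [piTDeriv_single, prodDeriv, star_sum, star_prod]
    refine Finset.sum_congr rfl fun i _ => Finset.prod_congr rfl fun j _ => ?_
    by_cases h : j = i
    · subst h; simpa using star_apply_single hΔ.map_conjTranspose _ _ _ _
    · simpa [h] using star_apply_single hΦ.map_conjTranspose _ _ _ _
  · simp only [SuperOp.piTDeriv, LinearMap.sum_apply, Matrix.trace_sum]
    refine Finset.sum_eq_zero fun i _ => ?_
    rw [trace_apply_eq_sum]
    refine Finset.sum_eq_zero fun f _ => Finset.sum_eq_zero fun f' _ => ?_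
    rw [trace_piT_single, Finset.prod_eq_zero (Finset.mem_univ i), mul_zero]
    simp [hΔ.trace_map]

lemma IsTangent.comp_left {Δ : SuperOp a b} {Ψ : SuperOp b c} (h : IsTangent Δ)
    (h' : IsChannel Ψ) : IsTangent (Ψ ∘ₗ Δ) :=
  ⟨fun X => by simp [h.map_conjTranspose, h'.map_conjTranspose],
    fun X => by simp [h'.trace_map, h.trace_map]⟩

lemma IsTangent.comp_right {Δ : SuperOp b c} {Ψ : SuperOp a b} (h : IsTangent Δ)
    (h' : IsChannel Ψ) : IsTangent (Δ ∘ₗ Ψ) :=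
  ⟨fun X => by simp [h.map_conjTranspose, h'.map_conjTranspose],
    fun X => by simp [h.trace_map]⟩

lemma IsTangent.isHermitian {Δ : SuperOp a b} (h : IsTangent Δ) {X : Matrix a a ℂ}
    (hX : X.IsHermitian) : (Δ X).IsHermitian := by
  rw [Matrix.IsHermitian, ← h.map_conjTranspose, hX.eq]

lemma IsState.submatrix {ρ : Matrix a a ℂ} (h : IsState ρ) (e : b ≃ a) :
    IsState (ρ.submatrix e e) :=
  ⟨h.posSemidef.submatrix e, by
    rw [← h.trace_eq]
    exact Fintype.sum_equiv e _ _ fun _ => rfl⟩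

lemma IsState.kronecker {ρ : Matrix a a ℂ} {τ : Matrix b b ℂ} (h : IsState ρ) (h' : IsState τ) :
    IsState (ρ ⊗ₖ τ) :=
  ⟨h.posSemidef.kronecker h'.posSemidef, by
    rw [Matrix.trace_kronecker, h.trace_eq, h'.trace_eq, one_mul]⟩

lemma exists_isState [Nonempty a] : ∃ ρ : Matrix a a ℂ, IsState ρ := by
  obtain ⟨x⟩ := ‹Nonempty a›
  refine ⟨Matrix.diagonal (Pi.single x 1), Matrix.PosSemidef.diagonal fun y => ?_, ?_⟩
  · by_cases h : y = x
    · subst h; simp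
    · simp [h]
  · simp [Matrix.trace_diagonal]

lemma tensor_kronecker (Φ : SuperOp a b) (Ψ : SuperOp c d) (X : Matrix a a ℂ)
    (Y : Matrix c c ℂ) : Φ.tensor Ψ (X ⊗ₖ Y) = Φ X ⊗ₖ Ψ Y := by
  ext g g'
  rw [apply_eq_sum, Matrix.kroneckerMap_apply, apply_eq_sum Φ, apply_eq_sum Ψ]
  simp only [tensor_single, Fintype.sum_prod_type, Matrix.kroneckerMap_apply,
    Finset.sum_mul_sum]
  refine Finset.sum_congr rfl fun x _ => Finset.sum_congr rfl fun y _ =>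
    Finset.sum_congr rfl fun x' _ => Finset.sum_congr rfl fun y' _ => ?_
  ring

end IsChannel

/-! ### Variational formula for the Fisher informations -/

section Duality

variable {d : Type} [Fintype d]

/-- `2 Re tr X†δ - tr ρ X†X`, a lower bound of the Fisher information at `(ρ, δ)`. -/
noncomputable def fisherVal (ρ δ X : Matrix d d ℂ) : ℝ :=
  2 * (Xᴴ * δ).trace.re - (ρ * (Xᴴ * X)).trace.re

/-- The admissible test matrices: Hermitian ones if `h` holds, and all of them otherwise. The SLD
Fisher information is the case `h = True`, the RLD Fisher information the case `h = False`. -/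
def testSpace (h : Prop) (d : Type) [Fintype d] : Submodule ℝ (Matrix d d ℂ) where
  carrier := {X | h → X.IsHermitian}
  zero_mem' _ := Matrix.isHermitian_zero
  add_mem' hX hY H := (hX H).add (hY H)
  smul_mem' r X hX H := by
    rw [Matrix.IsHermitian, Matrix.conjTranspose_smul, (hX H).eq, star_trivial]

/-- The supremum of `fisherVal` over all admissible test matrices. -/
noncomputable def infoDual (h : Prop) (ρ δ : Matrix d d ℂ) : ℝ≥0∞ :=
  ⨆ X ∈ testSpace h d, ENNReal.ofReal (fisherVal ρ δ X)

/-- `J` is given by a variational formula over the test matrices `testSpace h`. -/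
def IsVariational (h : Prop) (J : StateQuantity) : Prop :=
  ∀ (d : Type) [Fintype d] (ρ δ : Matrix d d ℂ), ρ.PosSemidef → δ.IsHermitian →
    J d ρ δ = infoDual h ρ δ

/-- A linear functional that vanishes on the radical of a symmetric bilinear form is represented by
the form. -/
lemma exists_represents {V : Type} [AddCommGroup V] [Module ℝ V] [FiniteDimensional ℝ V]
    (B : V →ₗ[ℝ] V →ₗ[ℝ] ℝ) (hB : ∀ x y, B x y = B y x) (l : Module.Dual ℝ V)
    (hl : ∀ x, B x = 0 → l x = 0) : ∃ y, ∀ x, l x = B y x := by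
  have hmem : l ∈ (LinearMap.ker B).dualAnnihilator := by
    rw [Submodule.mem_dualAnnihilator]
    exact fun x hx => hl x hx
  rw [← LinearMap.range_dualMap_eq_dualAnnihilator_ker] at hmem
  obtain ⟨φ, hφ⟩ := hmem
  obtain ⟨y, rfl⟩ := (Module.evalEquiv ℝ V).surjective φ
  refine ⟨y, fun x => ?_⟩
  rw [← hφ, hB]
  simp

lemma trace_re_star (M : Matrix d d ℂ) : (Mᴴ).trace.re = M.trace.re := by
  rw [Matrix.trace_conjTranspose]
  simp

lemma trace_mul_self_re_nonneg {ρ : Matrix d d ℂ} (hρ : ρ.PosSemidef) (Y : Matrix d d ℂ) :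
    0 ≤ (ρ * (Yᴴ * Y)).trace.re := by
  rw [← Matrix.mul_assoc, Matrix.trace_mul_comm, ← Matrix.mul_assoc]
  exact (Complex.le_def.mp (hρ.mul_mul_conjTranspose_same Y).trace_nonneg).1

/-- The real form `Re tr ρ X†Y`. -/
noncomputable def rhoForm (h : Prop) (ρ : Matrix d d ℂ) :
    testSpace h d →ₗ[ℝ] testSpace h d →ₗ[ℝ] ℝ :=
  LinearMap.mk₂ ℝ (fun X Y => (ρ * ((X : Matrix d d ℂ)ᴴ * (Y : Matrix d d ℂ))).trace.re)
    (fun X X' Y => by simp [Matrix.conjTranspose_add, Matrix.add_mul, Matrix.mul_add])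
    (fun r X Y => by simp [Matrix.conjTranspose_smul])
    (fun X Y Y' => by simp [Matrix.mul_add])
    (fun r X Y => by simp)

/-- The real functional `Re tr X†δ`. -/
noncomputable def deltaFunctional (h : Prop) (δ : Matrix d d ℂ) : Module.Dual ℝ (testSpace h d) where
  toFun X := ((X : Matrix d d ℂ)ᴴ * δ).trace.re
  map_add' X Y := by simp [Matrix.conjTranspose_add, Matrix.add_mul]
  map_smul' r X := by simp [Matrix.conjTranspose_smul]

lemma rho_trace_comm {ρ : Matrix d d ℂ} (hρ : ρ.IsHermitian) (X Y : Matrix d d ℂ) :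
    (ρ * (Xᴴ * Y)).trace.re = (ρ * (Yᴴ * X)).trace.re := by
  rw [← trace_re_star (ρ * (Xᴴ * Y))]
  simp only [Matrix.conjTranspose_mul, Matrix.conjTranspose_conjTranspose, hρ.eq]
  rw [Matrix.trace_mul_comm]

/-- If the supremum is finite, the quadratic functional attains its critical point. -/
lemma exists_critical (h : Prop) {ρ δ : Matrix d d ℂ} (hρ : ρ.PosSemidef)
    (hfin : infoDual h ρ δ ≠ ⊤) :
    ∃ L ∈ testSpace h d, ∀ X ∈ testSpace h d,
      (Xᴴ * δ).trace.re = (ρ * (Lᴴ * X)).trace.re := by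
  have : FiniteDimensional ℝ (Matrix d d ℂ) := Module.Finite.trans ℂ _
  -- otherwise large multiples of `X` would make the supremum infinite
  have hrad : ∀ X, rhoForm h ρ X = 0 → deltaFunctional h δ X = 0 := by
    intro X hX
    have hXX : (ρ * ((X : Matrix d d ℂ)ᴴ * (X : Matrix d d ℂ))).trace.re = 0 :=
      congrArg (fun f => f X) hX
    have hbound : ∀ t : ℝ, 2 * (t * deltaFunctional h δ X) ≤ (infoDual h ρ δ).toReal := by
      intro t
      have h1 : ENNReal.ofReal (fisherVal ρ δ (t • X : testSpace h d)) ≤ infoDual h ρ δ :=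
        le_iSup₂ (f := fun (X : Matrix d d ℂ) (_ : X ∈ testSpace h d) =>
          ENNReal.ofReal (fisherVal ρ δ X)) _ (t • X).2
      have h2 := (ENNReal.ofReal_le_iff_le_toReal hfin).mp h1
      refine le_trans (le_of_eq ?_) h2
      simp [fisherVal, deltaFunctional, Matrix.conjTranspose_smul, hXX]
    by_contra hne
    have := hbound (((infoDual h ρ δ).toReal + 1) / deltaFunctional h δ X)
    rw [div_mul_cancel₀ _ hne] at this
    linarith [ENNReal.toReal_nonneg (a := infoDual h ρ δ)]
  obtain ⟨L, hL⟩ := exists_represents (rhoForm h ρ)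
    (fun X Y => rho_trace_comm hρ.isHermitian X Y) (deltaFunctional h δ) hrad
  exact ⟨L, L.2, fun X hX => hL ⟨X, hX⟩⟩

lemma eq_of_trace_re {D E : Matrix d d ℂ}
    (h : ((D - E)ᴴ * D).trace.re = ((D - E)ᴴ * E).trace.re) : D = E := by
  have h0 : ((D - E)ᴴ * (D - E)).trace.re = 0 := by
    rw [Matrix.mul_sub, Matrix.trace_sub, Complex.sub_re, h, sub_self]
  have h1 := (Matrix.posSemidef_conjTranspose_mul_self (D - E)).trace_nonneg
  have h2 : ((D - E)ᴴ * (D - E)).trace = 0 :=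
    Complex.ext h0 (Complex.le_def.mp h1).2.symm
  exact sub_eq_zero.mp (Matrix.trace_conjTranspose_mul_self_eq_zero_iff.mp h2)

/-- Completing the square: if `Re tr X†δ = Re tr ρ L†X`, then `fisherVal ρ δ X` differs from
`tr ρ L†L` by `tr ρ (X - L)†(X - L)`. -/
lemma fisherVal_le_of_critical {ρ δ L X : Matrix d d ℂ} (hρ : ρ.PosSemidef)
    (hL : (Xᴴ * δ).trace.re = (ρ * (Lᴴ * X)).trace.re) :
    fisherVal ρ δ X ≤ (ρ * (Lᴴ * L)).trace.re := by
  have h0 := trace_mul_self_re_nonneg hρ (X - L)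
  have h1 : ρ * ((X - L)ᴴ * (X - L)) =
      ρ * (Xᴴ * X) - ρ * (Xᴴ * L) - ρ * (Lᴴ * X) + ρ * (Lᴴ * L) := by
    rw [Matrix.conjTranspose_sub]; noncomm_ring
  rw [h1, Matrix.trace_add, Matrix.trace_sub, Matrix.trace_sub] at h0
  have h2 := rho_trace_comm hρ.isHermitian X L
  simp only [Complex.add_re, Complex.sub_re] at h0
  rw [fisherVal, hL]
  linarith

lemma fisherVal_eq_of_critical {ρ δ L : Matrix d d ℂ}
    (hL : (Lᴴ * δ).trace.re = (ρ * (Lᴴ * L)).trace.re) :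
    fisherVal ρ δ L = (ρ * (Lᴴ * L)).trace.re := by
  rw [fisherVal, hL]; ring

lemma le_infoDual {h : Prop} (ρ δ : Matrix d d ℂ) {X : Matrix d d ℂ} (hX : X ∈ testSpace h d) :
    ENNReal.ofReal (fisherVal ρ δ X) ≤ infoDual h ρ δ :=
  le_iSup₂ (f := fun (X : Matrix d d ℂ) (_ : X ∈ testSpace h d) =>
    ENNReal.ofReal (fisherVal ρ δ X)) X hX

lemma re_trace_rld (ρ X L : Matrix d d ℂ) :
    (Xᴴ * (L * ρ)).trace.re = (ρ * (Xᴴ * L)).trace.re := by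
  rw [← Matrix.mul_assoc, Matrix.trace_mul_comm]

lemma re_trace_sld {ρ X L : Matrix d d ℂ} (hρ : ρ.IsHermitian) (hX : X.IsHermitian)
    (hL : L.IsHermitian) :
    (Xᴴ * ((1 / 2 : ℂ) • (L * ρ + ρ * L))).trace.re = (ρ * (Lᴴ * X)).trace.re := by
  have h1 : (X * (L * ρ)).trace.re = (ρ * (L * X)).trace.re := by
    rw [← trace_re_star]
    simp only [Matrix.conjTranspose_mul, hρ.eq, hX.eq, hL.eq, Matrix.mul_assoc]
  have h2 : (X * (ρ * L)).trace.re = (ρ * (L * X)).trace.re := by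
    rw [Matrix.trace_mul_comm, Matrix.mul_assoc]
  rw [hX.eq, hL.eq, Matrix.mul_smul, Matrix.mul_add, Matrix.trace_smul, Matrix.trace_add,
    smul_eq_mul, show (1 / 2 : ℂ) = ((1 / 2 : ℝ) : ℂ) by norm_num, Complex.re_ofReal_mul,
    Complex.add_re, h1, h2]
  ring

lemma isVariational_rldInfo : IsVariational False rldInfo := by
  intro d _ ρ δ hρ hδ
  apply le_antisymm
  · by_cases hfin : infoDual False ρ δ = ⊤
    · rw [hfin]; exact le_top
    obtain ⟨L, hLt, hL⟩ := exists_critical False hρ hfin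
    -- the critical point equation, tested at `δ - Lρ`
    have hsol : δ = L * ρ := by
      refine eq_of_trace_re ?_
      rw [hL _ (fun h => h.elim), re_trace_rld, rho_trace_comm hρ.isHermitian]
    refine le_trans (iInf₂_le L hsol) ?_
    rw [← fisherVal_eq_of_critical (hL L hLt)]
    exact le_infoDual _ _ hLt
  · refine iSup₂_le fun X _ => le_iInf₂ fun L hL => ENNReal.ofReal_le_ofReal ?_
    refine fisherVal_le_of_critical hρ ?_
    rw [hL, re_trace_rld, rho_trace_comm hρ.isHermitian]

lemma isVariational_sldInfo : IsVariational True sldInfo := by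
  intro d _ ρ δ hρ hδ
  apply le_antisymm
  · by_cases hfin : infoDual True ρ δ = ⊤
    · rw [hfin]; exact le_top
    obtain ⟨L, hLt, hL⟩ := exists_critical True hρ hfin
    have hLH : L.IsHermitian := hLt trivial
    have hsH : ((1 / 2 : ℂ) • (L * ρ + ρ * L)).IsHermitian := by
      rw [Matrix.IsHermitian, Matrix.conjTranspose_smul, Matrix.conjTranspose_add,
        Matrix.conjTranspose_mul, Matrix.conjTranspose_mul, hLH.eq, hρ.isHermitian.eq, add_comm]
      simp
    -- the critical point equation, tested at the Hermitian matrix `δ - (Lρ + ρL) / 2`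
    have hsol : δ = (1 / 2 : ℂ) • (L * ρ + ρ * L) := by
      refine eq_of_trace_re ?_
      rw [hL _ (fun _ => hδ.sub hsH), re_trace_sld hρ.isHermitian (hδ.sub hsH) hLH]
    refine le_trans (iInf_le_of_le L (iInf₂_le hLH hsol)) ?_
    have := fisherVal_eq_of_critical (hL L hLt)
    rw [hLH.eq] at this
    rw [← this]
    exact le_infoDual _ _ hLt
  · refine iSup₂_le fun X hX => le_iInf fun L => le_iInf₂ fun hLH hL =>
      ENNReal.ofReal_le_ofReal ?_
    have := fisherVal_le_of_critical (L := L) (δ := δ) (X := X) hρ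
      (by rw [hL, re_trace_sld hρ.isHermitian (hX trivial) hLH])
    rwa [hLH.eq] at this

/-! ### Operations on test matrices -/

variable {c : Type} [Fintype c]

lemma fisherVal_submatrix (ρ δ X : Matrix d d ℂ) (e : c ≃ d) :
    fisherVal (ρ.submatrix e e) (δ.submatrix e e) (X.submatrix e e) = fisherVal ρ δ X := by
  have ht : ∀ M : Matrix d d ℂ, (M.submatrix e e).trace = M.trace := fun M =>
    Fintype.sum_equiv e _ _ fun _ => rfl
  simp only [fisherVal, Matrix.conjTranspose_submatrix, Matrix.submatrix_mul_equiv, ht]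

lemma testSpace_submatrix {h : Prop} {X : Matrix d d ℂ} (hX : X ∈ testSpace h d) (e : c ≃ d) :
    X.submatrix e e ∈ testSpace h c :=
  fun H => (hX H).submatrix e

variable [DecidableEq d]

/-- Tensoring the test matrix with `1` ignores a second system. -/
lemma fisherVal_kronecker_one [DecidableEq c] {ρ δ X : Matrix d d ℂ} {τ δ' : Matrix c c ℂ}
    (hτ : τ.trace = 1) (hδ' : δ'.trace = 0) :
    fisherVal (ρ ⊗ₖ τ) (δ ⊗ₖ τ + ρ ⊗ₖ δ') (X ⊗ₖ (1 : Matrix c c ℂ)) = fisherVal ρ δ X := by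
  simp only [fisherVal, Matrix.conjTranspose_kronecker, Matrix.conjTranspose_one, Matrix.mul_add,
    ← Matrix.mul_kronecker_mul, Matrix.trace_add, Matrix.trace_kronecker, one_mul, mul_one, hτ,
    hδ', mul_zero, add_zero]

lemma testSpace_kronecker_one [DecidableEq c] {h : Prop} {X : Matrix d d ℂ}
    (hX : X ∈ testSpace h d) : X ⊗ₖ (1 : Matrix c c ℂ) ∈ testSpace h (d × c) := by
  intro H
  rw [Matrix.IsHermitian, Matrix.conjTranspose_kronecker, (hX H).eq, Matrix.conjTranspose_one]

/-- Test matrices may be assumed to be centred. -/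
lemma exists_centred_test {h : Prop} {ρ δ X : Matrix d d ℂ} (hρ : IsState ρ) (hδ : δ.trace = 0)
    (hX : X ∈ testSpace h d) :
    ∃ Y ∈ testSpace h d, (ρ * Y).trace = 0 ∧ fisherVal ρ δ X ≤ fisherVal ρ δ Y := by
  set z : ℂ := (ρ * X).trace with hz
  have hz' : (ρ * Xᴴ).trace = star z := by
    rw [hz, ← Matrix.trace_conjTranspose, Matrix.conjTranspose_mul, hρ.posSemidef.isHermitian.eq,
      Matrix.trace_mul_comm]
  refine ⟨X - z • (1 : Matrix d d ℂ), fun H => ?_, ?_, ?_⟩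
  · have : star z = z := by rw [← hz', (hX H).eq]
    rw [Matrix.IsHermitian, Matrix.conjTranspose_sub, Matrix.conjTranspose_smul, this, (hX H).eq,
      Matrix.conjTranspose_one]
  · rw [Matrix.mul_sub, Matrix.trace_sub, Matrix.mul_smul, Matrix.mul_one, Matrix.trace_smul,
      hρ.trace_eq, ← hz]
    simp
  · have h1 : ρ * ((X - z • (1 : Matrix d d ℂ))ᴴ * (X - z • (1 : Matrix d d ℂ))) =
        ρ * (Xᴴ * X) - z • (ρ * Xᴴ) - star z • (ρ * X) + (star z * z) • ρ := by
      simp only [Matrix.conjTranspose_sub, Matrix.conjTranspose_smul, Matrix.conjTranspose_one,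
        Matrix.sub_mul, Matrix.mul_sub, Matrix.smul_mul, Matrix.mul_smul, Matrix.one_mul,
        Matrix.mul_one, smul_sub, smul_smul, mul_comm (star z) z]
      abel
    have h2 : (ρ * ((X - z • (1 : Matrix d d ℂ))ᴴ * (X - z • (1 : Matrix d d ℂ)))).trace.re =
        (ρ * (Xᴴ * X)).trace.re - Complex.normSq z := by
      rw [h1]
      simp only [Matrix.trace_add, Matrix.trace_sub, Matrix.trace_smul, hz', ← hz, hρ.trace_eq,
        smul_eq_mul, Complex.add_re, Complex.sub_re, Complex.star_def, Complex.mul_re,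
        Complex.conj_re, Complex.conj_im, Complex.one_re, Complex.one_im, Complex.normSq_apply]
      ring
    rw [fisherVal, fisherVal, h2, Matrix.conjTranspose_sub, Matrix.sub_mul, Matrix.trace_sub,
      Matrix.conjTranspose_smul, Matrix.conjTranspose_one, Matrix.smul_mul, Matrix.one_mul,
      Matrix.trace_smul, hδ, smul_zero, sub_zero]
    linarith [Complex.normSq_nonneg z]

/-- The Heisenberg picture of a channel sends test matrices to test matrices and, by the
Kadison-Schwarz inequality, does not decrease `fisherVal`. -/
lemma exists_test_of_channel [DecidableEq c] {h : Prop} {Ψ : SuperOp d c} (hΨ : IsChannel Ψ)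
    {ρ : Matrix d d ℂ} (hρ : ρ.PosSemidef) (δ : Matrix d d ℂ) {X : Matrix c c ℂ}
    (hX : X ∈ testSpace h c) :
    ∃ Z ∈ testSpace h d, fisherVal (Ψ ρ) (Ψ δ) X ≤ fisherVal ρ δ Z := by
  obtain ⟨n, K, hK⟩ := SuperOp.exists_hasKraus hΨ
  have hcomp : ∑ r, (K r)ᴴ * K r = 1 := by
    refine Matrix.ext_iff_trace_mul_right.mpr fun Y => ?_
    rw [Matrix.one_mul, ← hΨ.trace_map Y, hK.apply, Matrix.sum_mul, Matrix.trace_sum,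
      Matrix.trace_sum]
    refine Finset.sum_congr rfl fun r _ => ?_
    rw [Matrix.mul_assoc, Matrix.trace_mul_comm]
  set Z : Matrix d d ℂ := ∑ r, (K r)ᴴ * X * K r with hZ
  have hZH : Zᴴ = ∑ r, (K r)ᴴ * Xᴴ * K r := by
    simp only [hZ, Matrix.conjTranspose_sum, Matrix.conjTranspose_mul,
      Matrix.conjTranspose_conjTranspose, Matrix.mul_assoc]
  refine ⟨Z, fun H => ?_, ?_⟩
  · rw [Matrix.IsHermitian, hZH, (hX H).eq]
  -- the Kadison-Schwarz inequality `Z†Z ≤ ∑ᵣ Kᵣ† X†X Kᵣ`, tested on `ρ`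
  have hpos : 0 ≤ ∑ r, (ρ * ((X * K r - K r * Z)ᴴ * (X * K r - K r * Z))).trace.re := by
    refine Finset.sum_nonneg fun r _ => ?_
    have := ((hρ.mul_mul_conjTranspose_same (X * K r - K r * Z))).trace_nonneg
    rw [Matrix.trace_mul_comm, ← Matrix.mul_assoc, Matrix.trace_mul_comm] at this
    exact (Complex.le_def.mp this).1
  have hsum : ∑ r, ρ * ((X * K r - K r * Z)ᴴ * (X * K r - K r * Z)) =
      ρ * (∑ r, (K r)ᴴ * (Xᴴ * X) * K r) - ρ * (Zᴴ * Z) := by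
    have hexp : ∀ r, (X * K r - K r * Z)ᴴ * (X * K r - K r * Z) =
        (K r)ᴴ * (Xᴴ * X) * K r - (K r)ᴴ * Xᴴ * K r * Z - Zᴴ * ((K r)ᴴ * X * K r) +
          Zᴴ * ((K r)ᴴ * K r) * Z := fun r => by
      simp only [Matrix.conjTranspose_sub, Matrix.conjTranspose_mul, Matrix.sub_mul,
        Matrix.mul_sub, Matrix.mul_assoc]
      abel
    rw [← Matrix.mul_sum, ← Matrix.mul_sub]
    congr 1
    simp only [hexp, Finset.sum_add_distrib, Finset.sum_sub_distrib, ← Matrix.sum_mul,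
      ← Matrix.mul_sum, hcomp, ← hZH, ← hZ, Matrix.mul_one]
    abel
  have hX2 : (Ψ ρ * (Xᴴ * X)).trace = (ρ * (∑ r, (K r)ᴴ * (Xᴴ * X) * K r)).trace := by
    rw [hK.apply, Matrix.sum_mul, Matrix.mul_sum, Matrix.trace_sum, Matrix.trace_sum]
    refine Finset.sum_congr rfl fun r _ => ?_
    rw [Matrix.mul_assoc (K r), Matrix.mul_assoc (K r), Matrix.trace_mul_comm]
    simp only [Matrix.mul_assoc]
  have hX1 : (Xᴴ * Ψ δ).trace = (Zᴴ * δ).trace := by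
    rw [hK.apply, hZH, Matrix.sum_mul, Matrix.mul_sum, Matrix.trace_sum, Matrix.trace_sum]
    refine Finset.sum_congr rfl fun r _ => ?_
    rw [← Matrix.mul_assoc, Matrix.trace_mul_comm]
    simp only [Matrix.mul_assoc]
  rw [← Complex.re_sum, ← Matrix.trace_sum, hsum, Matrix.trace_sub, Complex.sub_re] at hpos
  rw [fisherVal, fisherVal, hX1, hX2]
  linarith

end Duality

/-! ### Operator norm and trace norm -/

open scoped Matrix.Norms.L2Operator

section Norms

variable {d c : Type} [Fintype d] [DecidableEq d] [Fintype c] [DecidableEq c]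

/-- Tensoring with the identity, as a homomorphism of star algebras. -/
def kroneckerOneHom (d c : Type) [Fintype d] [DecidableEq d] [Fintype c] [DecidableEq c] :
    Matrix d d ℂ →⋆ₐ[ℂ] Matrix (d × c) (d × c) ℂ where
  toFun X := X ⊗ₖ (1 : Matrix c c ℂ)
  map_one' := Matrix.one_kronecker_one
  map_mul' X Y := by rw [← Matrix.mul_kronecker_mul, Matrix.one_mul]
  map_zero' := Matrix.zero_kronecker _
  map_add' X Y := Matrix.add_kronecker _ _ _
  commutes' r := by
    rw [Algebra.algebraMap_eq_smul_one, Algebra.algebraMap_eq_smul_one, Matrix.smul_kronecker,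
      Matrix.one_kronecker_one]
  map_star' X := by
    rw [Matrix.star_eq_conjTranspose, Matrix.star_eq_conjTranspose, Matrix.conjTranspose_kronecker,
      Matrix.conjTranspose_one]

lemma norm_kronecker_one_le (X : Matrix d d ℂ) : ‖X ⊗ₖ (1 : Matrix c c ℂ)‖ ≤ ‖X‖ :=
  NonUnitalStarAlgHom.norm_apply_le (kroneckerOneHom d c) X

/-- Renaming the basis vectors, as a homomorphism of star algebras. -/
def submatrixHom (e : c ≃ d) : Matrix d d ℂ →⋆ₐ[ℂ] Matrix c c ℂ where
  toFun X := X.submatrix e e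
  map_one' := Matrix.submatrix_one_equiv e
  map_mul' X Y := (Matrix.submatrix_mul_equiv X Y e e e).symm
  map_zero' := rfl
  map_add' X Y := rfl
  commutes' r := by
    rw [Algebra.algebraMap_eq_smul_one, Algebra.algebraMap_eq_smul_one, Matrix.submatrix_smul]
    simp
  map_star' X := rfl

lemma norm_submatrix_le (X : Matrix d d ℂ) (e : c ≃ d) : ‖X.submatrix e e‖ ≤ ‖X‖ :=
  NonUnitalStarAlgHom.norm_apply_le (submatrixHom e) X

/-- The trace is the sum of the diagonal elements in any orthonormal basis. -/
lemma trace_eq_sum_inner (M : Matrix d d ℂ) (v : OrthonormalBasis d ℂ (EuclideanSpace ℂ d)) :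
    M.trace = ∑ i, inner ℂ (v i) (WithLp.toLp 2 (M *ᵥ (v i).ofLp)) := by
  have := LinearMap.trace_eq_sum_inner (Matrix.toLpLin 2 2 M) v
  rw [Matrix.toLpLin_eq_toLin, Matrix.trace_toLin_eq] at this
  rw [this]
  rfl

lemma norm_mulVec_eigenvector (Y : Matrix d d ℂ) (i : d) :
    ‖WithLp.toLp 2 (Y *ᵥ ((Matrix.isHermitian_conjTranspose_mul_self Y).eigenvectorBasis i).ofLp)‖ =
      √((Matrix.isHermitian_conjTranspose_mul_self Y).eigenvalues i) := by
  set hY := Matrix.isHermitian_conjTranspose_mul_self Y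
  set v := hY.eigenvectorBasis i with hv
  have h1 : star (Y *ᵥ v.ofLp) ⬝ᵥ (Y *ᵥ v.ofLp) = (hY.eigenvalues i : ℂ) := by
    rw [Matrix.star_mulVec, ← Matrix.dotProduct_mulVec, Matrix.mulVec_mulVec,
      hY.mulVec_eigenvectorBasis i, dotProduct_smul, ← hv, dotProduct_comm,
      ← EuclideanSpace.inner_eq_star_dotProduct, inner_self_eq_norm_sq_to_K,
      hv, OrthonormalBasis.norm_eq_one]
    simp
  rw [eq_comm, Real.sqrt_eq_iff_eq_sq (Matrix.eigenvalues_conjTranspose_mul_self_nonneg Y i)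
    (norm_nonneg _)]
  have h2 := inner_self_eq_norm_sq_to_K (𝕜 := ℂ) (WithLp.toLp 2 (Y *ᵥ v.ofLp))
  rw [EuclideanSpace.inner_eq_star_dotProduct, dotProduct_comm, h1] at h2
  exact Complex.ofReal_injective (h2.trans (by push_cast; rfl))

/-- Duality between the operator norm and the trace norm. -/
lemma norm_trace_mul_le (F Y : Matrix d d ℂ) : ‖(F * Y).trace‖ ≤ ‖F‖ * traceNorm Y := by
  rw [trace_eq_sum_inner _ (Matrix.isHermitian_conjTranspose_mul_self Y).eigenvectorBasis,
    traceNorm, Finset.mul_sum]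
  refine (norm_sum_le _ _).trans (Finset.sum_le_sum fun i _ => ?_)
  refine (norm_inner_le_norm _ _).trans ?_
  rw [OrthonormalBasis.norm_eq_one, one_mul, ← Matrix.mulVec_mulVec]
  refine (Matrix.l2_opNorm_mulVec F (WithLp.toLp 2 (Y *ᵥ _))).trans ?_
  rw [norm_mulVec_eigenvector]

lemma traceNorm_nonneg (Y : Matrix d d ℂ) : 0 ≤ traceNorm Y :=
  Finset.sum_nonneg fun _ _ => Real.sqrt_nonneg _

/-- An eigenvector `v` of `ρ†ρ = ρ²` with eigenvalue `s²`, where `s > 0`, satisfies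
`(ρ + s)(ρ - s)v = 0`, hence `ρ v = s v` as `ρ + s` is injective. So the trace norm of a state is
its trace. -/
lemma IsState.traceNorm_le {ρ : Matrix d d ℂ} (h : IsState ρ) : traceNorm ρ ≤ 1 := by
  set hY := Matrix.isHermitian_conjTranspose_mul_self ρ
  have hρ := h.posSemidef
  have key : ∀ i, ρ *ᵥ (hY.eigenvectorBasis i).ofLp =
      ((√(hY.eigenvalues i) : ℝ) : ℂ) • (hY.eigenvectorBasis i).ofLp := by
    intro i
    set v := (hY.eigenvectorBasis i).ofLp with hv
    have hn := norm_mulVec_eigenvector ρ i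
    have hl : 0 ≤ hY.eigenvalues i := Matrix.eigenvalues_conjTranspose_mul_self_nonneg ρ i
    rcases (Real.sqrt_nonneg (hY.eigenvalues i)).eq_or_lt with h0 | h0
    · change _ = √(hY.eigenvalues i) at hn
      rw [← h0, norm_eq_zero] at hn
      rw [← h0]
      simpa using congrArg WithLp.ofLp hn
    · set s : ℂ := ((√(hY.eigenvalues i) : ℝ) : ℂ) with hs
      have hs2 : s * s = (hY.eigenvalues i : ℂ) := by
        rw [hs, ← Complex.ofReal_mul, Real.mul_self_sqrt hl]
      set w := ρ *ᵥ v - s • v with hw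
      have h1 : ρ *ᵥ w + s • w = 0 := by
        have h2 : ρ *ᵥ (ρ *ᵥ v) = (s * s) • v := by
          have := hY.mulVec_eigenvectorBasis i
          rw [← hv, ← Matrix.mulVec_mulVec] at this
          calc ρ *ᵥ (ρ *ᵥ v) = ρᴴ *ᵥ (ρ *ᵥ v) := by rw [hρ.isHermitian.eq]
            _ = hY.eigenvalues i • v := this
            _ = (s * s) • v := by rw [hs2]; rfl
        rw [hw, Matrix.mulVec_sub, Matrix.mulVec_smul, h2, smul_sub, smul_smul]
        abel
      have h3 : star w ⬝ᵥ (ρ *ᵥ w) + s * (star w ⬝ᵥ w) = 0 := by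
        rw [← smul_eq_mul, ← dotProduct_smul, ← dotProduct_add, h1, dotProduct_zero]
      have h4 : 0 ≤ star w ⬝ᵥ (ρ *ᵥ w) := hρ.dotProduct_mulVec_nonneg w
      have h5 : 0 ≤ star w ⬝ᵥ w := dotProduct_star_self_nonneg w
      have hs0 : 0 < s := by rw [hs]; exact_mod_cast h0
      have h6 : s * (star w ⬝ᵥ w) = 0 :=
        le_antisymm (h3 ▸ le_add_of_nonneg_left h4) (mul_nonneg hs0.le h5)
      have h7 : w = 0 := dotProduct_star_self_eq_zero.mp
        ((mul_eq_zero.mp h6).resolve_left hs0.ne')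
      exact sub_eq_zero.mp h7
  have ht := trace_eq_sum_inner ρ hY.eigenvectorBasis
  rw [h.trace_eq] at ht
  have : (traceNorm ρ : ℂ) = 1 := by
    rw [ht, traceNorm, Complex.ofReal_sum]
    refine Finset.sum_congr rfl fun i _ => ?_
    rw [key, WithLp.toLp_smul, inner_smul_right, WithLp.toLp_ofLp, inner_self_eq_norm_sq_to_K,
      OrthonormalBasis.norm_eq_one]
    simp
  exact le_of_eq (by exact_mod_cast this)

end Norms

/-! ### Attainable values -/

section Attains

variable {a b c d a' b' e x y : Type} [Fintype a] [DecidableEq a] [Fintype b] [DecidableEq b]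
  [Fintype c] [DecidableEq c] [Fintype d] [DecidableEq d] [Fintype a'] [DecidableEq a']
  [Fintype b'] [DecidableEq b'] [Fintype e] [DecidableEq e] [Fintype x] [DecidableEq x]
  [Fintype y] [DecidableEq y]

/-- Some input state with an ancilla and some test matrix of operator norm at most `B` give a lower
bound of at least `v` for the Fisher information of the output. -/
def Attains (h : Prop) (Φ Δ : SuperOp a b) (v B : ℝ) : Prop :=
  ∃ (k : ℕ) (ρ : Matrix (a × Fin k) (a × Fin k) ℂ) (F : Matrix (b × Fin k) (b × Fin k) ℂ),
    IsState ρ ∧ F ∈ testSpace h (b × Fin k) ∧ ‖F‖ ≤ B ∧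
      v ≤ fisherVal (Φ.ampl (Fin k) ρ) (Δ.ampl (Fin k) ρ) F

lemma SuperOp.Relabel.exists_transport {h : Prop} {ea : x ≃ a} {eb : y ≃ b} {Φ Δ : SuperOp x y}
    {Φ' Δ' : SuperOp a b} (hΦ : Relabel ea eb Φ Φ') (hΔ : Relabel ea eb Δ Δ')
    {ρ : Matrix x x ℂ} {F : Matrix y y ℂ} (hρ : IsState ρ) (hF : F ∈ testSpace h y) :
    ∃ (ρ' : Matrix a a ℂ) (F' : Matrix b b ℂ), IsState ρ' ∧ F' ∈ testSpace h b ∧ ‖F'‖ ≤ ‖F‖ ∧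
      fisherVal (Φ' ρ') (Δ' ρ') F' = fisherVal (Φ ρ) (Δ ρ) F := by
  refine ⟨ρ.submatrix ea.symm ea.symm, F.submatrix eb.symm eb.symm, hρ.submatrix _,
    testSpace_submatrix hF _, norm_submatrix_le _ _, ?_⟩
  rw [← fisherVal_submatrix _ _ _ eb, hΦ, hΔ]
  simp

lemma attains_of_ancilla {h : Prop} {Φ Δ : SuperOp a b} {ρ : Matrix (a × c) (a × c) ℂ}
    {F : Matrix (b × c) (b × c) ℂ} {B : ℝ} (hρ : IsState ρ) (hF : F ∈ testSpace h (b × c))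
    (hB : ‖F‖ ≤ B) : Attains h Φ Δ (fisherVal (Φ.ampl c ρ) (Δ.ampl c ρ) F) B := by
  obtain ⟨ρ', F', hρ', hF', hn, hv⟩ :=
    ((relabel_refl Φ).ampl (Fintype.equivFin c)).exists_transport
      ((relabel_refl Δ).ampl (Fintype.equivFin c)) hρ hF
  exact ⟨_, ρ', F', hρ', hF', hn.trans hB, hv.ge⟩

lemma Attains.mono {h : Prop} {Φ Δ : SuperOp a b} {v v' B B' : ℝ} (H : Attains h Φ Δ v B)
    (hv : v' ≤ v) (hB : B ≤ B') : Attains h Φ Δ v' B' := by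
  obtain ⟨k, ρ, F, hρ, hF, hn, h1⟩ := H
  exact ⟨k, ρ, F, hρ, hF, hn.trans hB, hv.trans h1⟩

/-- Renaming basis vectors, with an ancilla already present. -/
lemma attains_of_relabel_ampl {h : Prop} {ea : x ≃ a × c} {eb : y ≃ b × c} {Φ Δ : SuperOp x y}
    {Φ' Δ' : SuperOp a b} (hΦ : Relabel ea eb Φ (Φ'.ampl c)) (hΔ : Relabel ea eb Δ (Δ'.ampl c))
    {ρ : Matrix x x ℂ} {F : Matrix y y ℂ} {B : ℝ} (hρ : IsState ρ) (hF : F ∈ testSpace h y)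
    (hB : ‖F‖ ≤ B) : Attains h Φ' Δ' (fisherVal (Φ ρ) (Δ ρ) F) B := by
  obtain ⟨ρ', F', hρ', hF', hn, hv⟩ := hΦ.exists_transport hΔ hρ hF
  rw [← hv]
  exact attains_of_ancilla hρ' hF' (hn.trans hB)

lemma attains_of_state {h : Prop} {Φ Δ : SuperOp a b} {ρ : Matrix a a ℂ}
    {F : Matrix b b ℂ} {B : ℝ} (hρ : IsState ρ) (hF : F ∈ testSpace h b)
    (hB : ‖F‖ ≤ B) : Attains h Φ Δ (fisherVal (Φ ρ) (Δ ρ) F) B := by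
  have key : ∀ Ψ : SuperOp a b, Relabel (Equiv.prodPUnit a).symm (Equiv.prodPUnit b).symm Ψ
      (Ψ.ampl PUnit) := fun Ψ => relabel_of_single fun f f' g g' => by simp [ampl_single]
  exact attains_of_relabel_ampl (key Φ) (key Δ) hρ hF hB

lemma Attains.relabel {h : Prop} {ea : a ≃ a'} {eb : b ≃ b'} {Φ Δ : SuperOp a b}
    {Φ' Δ' : SuperOp a' b'} {v B : ℝ} (H : Attains h Φ Δ v B) (hΦ : Relabel ea eb Φ Φ')
    (hΔ : Relabel ea eb Δ Δ') : Attains h Φ' Δ' v B := by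
  obtain ⟨k, ρ, F, hρ, hF, hn, h1⟩ := H
  exact (attains_of_relabel_ampl (hΦ.ampl (Equiv.refl _)) (hΔ.ampl (Equiv.refl _)) hρ hF hn).mono
    h1 le_rfl

lemma Attains.of_ampl {h : Prop} {Φ Δ : SuperOp a b} {v B : ℝ}
    (H : Attains h (Φ.ampl c) (Δ.ampl c) v B) : Attains h Φ Δ v B := by
  obtain ⟨k, ρ, F, hρ, hF, hn, h1⟩ := H
  exact (attains_of_relabel_ampl (relabel_ampl_ampl Φ) (relabel_ampl_ampl Δ) hρ hF hn).mono
    h1 le_rfl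

/-- A second channel that is run in parallel and ignored does not change the attained value. -/
lemma Attains.tensor [Nonempty c] {h : Prop} {Φ Δ : SuperOp a b} {Ψ E : SuperOp c d} {v B : ℝ}
    (H : Attains h Φ Δ v B) (hΨ : IsChannel Ψ) (hE : IsTangent E) :
    Attains h (Φ.tensor Ψ) (Δ.tensor Ψ + Φ.tensor E) v B := by
  obtain ⟨k, ρ, F, hρ, hF, hn, h1⟩ := H
  obtain ⟨τ, hτ⟩ := exists_isState (a := c)
  have h2 : Relabel (swapLast a (Fin k) c) (swapLast b (Fin k) d)
      ((Δ.ampl (Fin k)).tensor Ψ + (Φ.ampl (Fin k)).tensor E)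
      ((Δ.tensor Ψ + Φ.tensor E).ampl (Fin k)) := by
    rw [ampl_add]
    exact (relabel_tensor_ampl Δ Ψ).add (relabel_tensor_ampl Φ E)
  refine (attains_of_relabel_ampl (relabel_tensor_ampl Φ Ψ) h2 (hρ.kronecker hτ)
    (testSpace_kronecker_one (c := d) hF) ((norm_kronecker_one_le F).trans hn)).mono ?_ le_rfl
  rw [LinearMap.add_apply, tensor_kronecker, tensor_kronecker, tensor_kronecker,
    fisherVal_kronecker_one (hΨ.isState hτ).trace_eq (hE.trace_map _)]
  exact h1

lemma Attains.of_comp_right {h : Prop} {Φ Δ : SuperOp b c} {Ψ : SuperOp a b} {v B : ℝ}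
    (H : Attains h (Φ ∘ₗ Ψ) (Δ ∘ₗ Ψ) v B) (hΨ : IsChannel Ψ) : Attains h Φ Δ v B := by
  obtain ⟨k, ρ, F, hρ, hF, hn, h1⟩ := H
  rw [ampl_comp, ampl_comp] at h1
  exact ⟨k, _, F, hΨ.ampl.isState hρ, hF, hn, h1⟩

lemma Attains.of_comp_left {h : Prop} {Φ Δ : SuperOp a b} {Ψ : SuperOp b c} {v B : ℝ}
    (H : Attains h (Ψ ∘ₗ Φ) (Ψ ∘ₗ Δ) v B) (hΨ : IsChannel Ψ) (hΦ : IsChannel Φ) :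
    ∃ B', Attains h Φ Δ v B' := by
  obtain ⟨k, ρ, F, hρ, hF, hn, h1⟩ := H
  rw [ampl_comp, ampl_comp] at h1
  obtain ⟨Z, hZ, hle⟩ := exists_test_of_channel (hΨ.ampl (c := Fin k))
    (hΦ.ampl.posSemidef hρ.posSemidef) (Δ.ampl (Fin k) ρ) hF
  exact ⟨‖Z‖, k, ρ, Z, hρ, hZ, le_rfl, h1.trans hle⟩

lemma traceNorm_ampl_le {Φ : SuperOp a b} {t : ℝ} (ht : cbNorm Φ ≤ ENNReal.ofReal t) (h0 : 0 ≤ t)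
    {k : ℕ} {ρ : Matrix (a × Fin k) (a × Fin k) ℂ} (hρ : IsState ρ) :
    traceNorm (Φ.ampl (Fin k) ρ) ≤ t := by
  rw [← ENNReal.ofReal_le_ofReal_iff h0]
  refine le_trans ?_ ht
  exact le_iSup_of_le k (le_iSup₂_of_le ρ hρ.traceNorm_le le_rfl)

/-- A bounded test matrix is insensitive to small perturbations in the completely bounded norm. -/
lemma Attains.perturb {h : Prop} {Φ Δ Φ' Δ' : SuperOp a b} {v B s t : ℝ}
    (H : Attains h Φ Δ v B) (hs : cbNorm (Φ' - Φ) ≤ ENNReal.ofReal s) (hs0 : 0 ≤ s)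
    (ht : cbNorm (Δ' - Δ) ≤ ENNReal.ofReal t) (ht0 : 0 ≤ t) :
    Attains h Φ' Δ' (v - 2 * (B * t) - B ^ 2 * s) B := by
  obtain ⟨k, ρ, F, hρ, hF, hn, h1⟩ := H
  refine ⟨k, ρ, F, hρ, hF, hn, ?_⟩
  have hB : 0 ≤ B := (norm_nonneg F).trans hn
  have hs' := traceNorm_ampl_le hs hs0 hρ
  have ht' := traceNorm_ampl_le ht ht0 hρ
  rw [ampl_sub, LinearMap.sub_apply] at hs' ht'
  have e1 := norm_trace_mul_le Fᴴ ((Δ'.ampl (Fin k)) ρ - (Δ.ampl (Fin k)) ρ)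
  have e2 := norm_trace_mul_le (Fᴴ * F) ((Φ'.ampl (Fin k)) ρ - (Φ.ampl (Fin k)) ρ)
  rw [Matrix.l2_opNorm_conjTranspose] at e1
  rw [Matrix.l2_opNorm_conjTranspose_mul_self] at e2
  have e1' := (Complex.abs_re_le_norm _).trans (e1.trans
    (mul_le_mul hn ht' (traceNorm_nonneg _) hB))
  have e2' := (Complex.abs_re_le_norm _).trans (e2.trans
    (mul_le_mul (mul_le_mul hn hn (norm_nonneg _) hB) hs' (traceNorm_nonneg _)
      (mul_nonneg hB hB)))
  rw [Matrix.mul_sub, Matrix.trace_sub, Complex.sub_re] at e1' e2'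
  rw [Matrix.trace_mul_comm (Fᴴ * F), Matrix.trace_mul_comm (Fᴴ * F)] at e2'
  rw [abs_le] at e1' e2'
  rw [fisherVal] at h1 ⊢
  nlinarith [e1'.1, e2'.2]

/-! ### The optimized Fisher information of a channel -/

/-- The supremum of the Fisher information of the output over all inputs with ancilla, for a
channel with purely quantum output. -/
noncomputable def channelInfo (J : StateQuantity) (Φ Δ : SuperOp a b) : ℝ≥0∞ :=
  ⨆ (k : ℕ) (ρ : Matrix (a × Fin k) (a × Fin k) ℂ) (_ : IsState ρ),
    J (b × Fin k) (Φ.ampl (Fin k) ρ) (Δ.ampl (Fin k) ρ)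

variable {h : Prop} {J : StateQuantity}

lemma Attains.le_channelInfo (hJ : IsVariational h J) {Φ Δ : SuperOp a b} (hΦ : IsChannel Φ)
    (hΔ : IsTangent Δ) {v B : ℝ} (H : Attains h Φ Δ v B) :
    ENNReal.ofReal v ≤ channelInfo J Φ Δ := by
  obtain ⟨k, ρ, F, hρ, hF, -, h1⟩ := H
  refine le_iSup_of_le k (le_iSup₂_of_le ρ hρ ?_)
  rw [hJ _ _ _ (hΦ.ampl.posSemidef hρ.posSemidef)
    (hΔ.ampl.isHermitian hρ.posSemidef.isHermitian)]
  exact (ENNReal.ofReal_le_ofReal h1).trans (le_infoDual _ _ hF)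

lemma exists_state_of_lt_channelInfo (hJ : IsVariational h J) {Φ Δ : SuperOp a b}
    (hΦ : IsChannel Φ) (hΔ : IsTangent Δ) {t : ℝ≥0∞} (ht : t < channelInfo J Φ Δ) :
    ∃ (k : ℕ) (ρ : Matrix (a × Fin k) (a × Fin k) ℂ) (F : Matrix (b × Fin k) (b × Fin k) ℂ),
      IsState ρ ∧ F ∈ testSpace h (b × Fin k) ∧
        t < ENNReal.ofReal (fisherVal (Φ.ampl (Fin k) ρ) (Δ.ampl (Fin k) ρ) F) := by
  simp only [channelInfo, lt_iSup_iff] at ht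
  obtain ⟨k, ρ, hρ, hlt⟩ := ht
  rw [hJ _ _ _ (hΦ.ampl.posSemidef hρ.posSemidef)
    (hΔ.ampl.isHermitian hρ.posSemidef.isHermitian)] at hlt
  simp only [infoDual, lt_iSup_iff] at hlt
  obtain ⟨F, hF, hlt⟩ := hlt
  exact ⟨k, ρ, F, hρ, hF, hlt⟩

/-- The norm bound in `Attains` plays no role in the optimized information. -/
lemma channelInfo_mono (hJ : IsVariational h J) {Φ Δ : SuperOp a b} {Φ' Δ' : SuperOp a' b'}
    (hΦ : IsChannel Φ) (hΔ : IsTangent Δ) (hΦ' : IsChannel Φ') (hΔ' : IsTangent Δ')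
    (H : ∀ v B, Attains h Φ Δ v B → ∃ B', Attains h Φ' Δ' v B') :
    channelInfo J Φ Δ ≤ channelInfo J Φ' Δ' := by
  refine le_of_forall_lt fun t ht => ?_
  obtain ⟨k, ρ, F, hρ, hF, hlt⟩ := exists_state_of_lt_channelInfo hJ hΦ hΔ ht
  obtain ⟨B', hB'⟩ := H _ ‖F‖ ⟨k, ρ, F, hρ, hF, le_rfl, le_rfl⟩
  exact hlt.trans_le (hB'.le_channelInfo hJ hΦ' hΔ')

end Attains

/-! ### Tensor powers of matrices -/

section PiMatrix

variable {ι d b : Type} [Fintype ι] [DecidableEq ι] [Fintype d] [DecidableEq d] [Fintype b]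
  [DecidableEq b]

/-- The tensor product of a family of matrices. -/
def piMatrix (M : ι → Matrix d d ℂ) : Matrix (ι → d) (ι → d) ℂ :=
  Matrix.of fun f f' => ∏ i, M i (f i) (f' i)

/-- The derivative of the tensor power of `σ` in the direction `δ`. -/
def piMatrixDeriv (ι : Type) [Fintype ι] [DecidableEq ι] (σ δ : Matrix d d ℂ) :
    Matrix (ι → d) (ι → d) ℂ :=
  ∑ i : ι, piMatrix (Function.update (fun _ => σ) i δ)

lemma piMatrix_mul (M N : ι → Matrix d d ℂ) :
    piMatrix M * piMatrix N = piMatrix fun i => M i * N i := by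
  ext f f'
  simp only [piMatrix, Matrix.mul_apply, Matrix.of_apply, ← Finset.prod_mul_distrib,
    Finset.prod_univ_sum, Fintype.piFinset_univ]

lemma piMatrix_one : piMatrix (fun _ : ι => (1 : Matrix d d ℂ)) = 1 := by
  ext f f'
  simp only [piMatrix, Matrix.of_apply, Matrix.one_apply, Finset.prod_ite_zero,
    Finset.prod_const_one, funext_iff]
  simp

lemma piMatrix_conjTranspose (M : ι → Matrix d d ℂ) :
    (piMatrix M)ᴴ = piMatrix fun i => (M i)ᴴ := by
  ext f f'
  simp [piMatrix, Matrix.conjTranspose_apply]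

lemma trace_piMatrix (M : ι → Matrix d d ℂ) : (piMatrix M).trace = ∏ i, (M i).trace := by
  simp only [piMatrix, Matrix.trace, Matrix.diag_apply, Matrix.of_apply, Finset.prod_univ_sum,
    Fintype.piFinset_univ]

/-- The trace of `V^{⊗k}` against the derivative of `σ^{⊗k}` in the direction `δ`. -/
lemma trace_piMatrix_mul_deriv (V σ δ : Matrix d d ℂ) :
    (piMatrix (fun _ : ι => V) * piMatrixDeriv ι σ δ).trace =
      Fintype.card ι * ((V * δ).trace * (V * σ).trace ^ (Fintype.card ι - 1)) := by
  rw [← prodDeriv_const (ι := ι)]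
  simp only [piMatrixDeriv, Matrix.mul_sum, Matrix.trace_sum, piMatrix_mul, trace_piMatrix,
    prodDeriv]
  refine Finset.sum_congr rfl fun i _ => Finset.prod_congr rfl fun j _ => ?_
  by_cases h : j = i
  · subst h; simp
  · simp [h]

open scoped MatrixOrder in
lemma IsState.piMatrix {ρ : Matrix d d ℂ} (h : IsState ρ) :
    IsState (_root_.piMatrix fun _ : ι => ρ) := by
  refine ⟨?_, by simp [trace_piMatrix, h.trace_eq]⟩
  obtain ⟨A, rfl⟩ := CStarAlgebra.nonneg_iff_eq_star_mul_self.mp h.posSemidef.nonneg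
  rw [Matrix.star_eq_conjTranspose]
  rw [← piMatrix_mul, ← piMatrix_conjTranspose]
  exact Matrix.posSemidef_conjTranspose_mul_self _

lemma piT_piMatrix (Φ : ι → SuperOp d b) (M : ι → Matrix d d ℂ) :
    piT Φ (piMatrix M) = piMatrix fun i => Φ i (M i) := by
  ext g g'
  simp only [piT_apply, piMatrix, Matrix.of_apply, ← Finset.prod_mul_distrib]
  simp_rw [apply_eq_sum (Φ _) (M _)]
  rw [Finset.prod_univ_sum, Fintype.piFinset_univ]
  refine Finset.sum_congr rfl fun f _ => ?_
  rw [Finset.prod_univ_sum, Fintype.piFinset_univ]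

lemma piTDeriv_piMatrix (Φ Δ : SuperOp d b) (ρ : Matrix d d ℂ) :
    piTDeriv (fun _ : ι => Φ) (fun _ => Δ) (piMatrix fun _ => ρ) =
      piMatrixDeriv ι (Φ ρ) (Δ ρ) := by
  simp only [piTDeriv, LinearMap.sum_apply, piT_piMatrix, piMatrixDeriv]
  refine Finset.sum_congr rfl fun i _ => congrArg piMatrix (funext fun j => ?_)
  by_cases h : j = i
  · subst h; simp
  · simp [h]

lemma norm_le_one_of_unitary {U : Matrix d d ℂ} (hU : Uᴴ * U = 1) : ‖U‖ ≤ 1 := by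
  have h1 := Matrix.l2_opNorm_conjTranspose_mul_self U
  rw [hU] at h1
  have h2 : ‖(1 : Matrix d d ℂ)‖ ≤ 1 := by
    cases isEmpty_or_nonempty d
    · rw [Subsingleton.elim (1 : Matrix d d ℂ) 0]; simp
    · exact (CStarRing.norm_one (E := Matrix d d ℂ)).le
  nlinarith [norm_nonneg U]

lemma norm_piMatrix_le {U : Matrix d d ℂ} (hU : Uᴴ * U = 1) :
    ‖piMatrix fun _ : ι => U‖ ≤ 1 := by
  refine norm_le_one_of_unitary ?_
  rw [piMatrix_conjTranspose, piMatrix_mul, hU, piMatrix_one]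

/-- The Cayley transform: a unitary that agrees with `exp(isH)` to first order, with a quadratic
error bound that is uniform in `s`. -/
lemma exists_unitary_approx {H : Matrix d d ℂ} (hH : H.IsHermitian) (s : ℝ) :
    ∃ U : Matrix d d ℂ, Uᴴ * U = 1 ∧ ‖U - 1 - (s : ℂ) • (Complex.I • H)‖ ≤ s ^ 2 * ‖H‖ ^ 2 := by
  set A : Matrix d d ℂ := ((s : ℂ) * Complex.I / 2) • H with hA
  have hAH : Aᴴ = -A := by
    rw [hA, Matrix.conjTranspose_smul, hH.eq, ← neg_smul]
    congr 1
    simp [neg_div]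
  have hcomm : (1 + A) * (1 - A) = (1 - A) * (1 + A) := by noncomm_ring
  have hpd : ((1 : Matrix d d ℂ) + Aᴴ * A).PosDef :=
    Matrix.PosDef.one.add_posSemidef (Matrix.posSemidef_conjTranspose_mul_self A)
  have hfac : (1 : Matrix d d ℂ) + Aᴴ * A = (1 - A) * (1 + A) := by
    rw [hAH]; noncomm_ring
  rw [hfac] at hpd
  have hu : IsUnit (1 - A) := isUnit_of_mul_isUnit_left hpd.isUnit
  obtain ⟨R, hR1, hR2⟩ := isUnit_iff_exists.mp hu
  set U := (1 + A) * R with hUdef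
  have hU : Uᴴ * U = 1 := by
    have h1 : (1 - A)ᴴ = 1 + A := by
      rw [Matrix.conjTranspose_sub, hAH, Matrix.conjTranspose_one]; abel
    have h2 : (1 + A)ᴴ = 1 - A := by
      rw [Matrix.conjTranspose_add, hAH, Matrix.conjTranspose_one]; abel
    calc Uᴴ * U = Rᴴ * ((1 - A) * (1 + A)) * R := by
          rw [hUdef, Matrix.conjTranspose_mul, h2]; simp only [Matrix.mul_assoc]
      _ = Rᴴ * (1 + A) * ((1 - A) * R) := by rw [← hcomm]; simp only [Matrix.mul_assoc]
      _ = 1 := by rw [hR1, Matrix.mul_one, ← h1, ← Matrix.conjTranspose_mul, hR1,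
          Matrix.conjTranspose_one]
  have hAR : A * R = R - 1 := by
    rw [← hR1]; noncomm_ring
  have hUR : U = (2 : ℂ) • R - 1 := by
    rw [hUdef, Matrix.add_mul, hAR, Matrix.one_mul, two_smul]; abel
  have hRn : ‖R‖ ≤ 1 := by
    have h1 : R = (1 / 2 : ℂ) • (1 + U) := by
      rw [hUR, add_sub_cancel, smul_smul]; norm_num
    have h2 := norm_le_one_of_unitary (U := (1 : Matrix d d ℂ)) (by simp)
    have h3 := norm_add_le (1 : Matrix d d ℂ) U
    have h4 := norm_le_one_of_unitary hU
    rw [h1, norm_smul]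
    norm_num
    linarith
  refine ⟨U, hU, ?_⟩
  have h2A : (s : ℂ) • (Complex.I • H) = (2 : ℂ) • A := by
    rw [hA, smul_smul, smul_smul]; congr 1; ring
  have hfin : U - 1 - (s : ℂ) • (Complex.I • H) = (2 : ℂ) • (A * (A * R)) := by
    rw [h2A, hAR, Matrix.mul_sub, hAR, hUR, Matrix.mul_one]
    simp only [smul_sub, two_smul]; abel
  have hAn : ‖A‖ = |s| / 2 * ‖H‖ := by
    rw [hA, norm_smul]; simp
  rw [hfin, norm_smul]
  have h5 : ‖A * (A * R)‖ ≤ ‖A‖ * (‖A‖ * ‖R‖) :=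
    (norm_mul_le _ _).trans (mul_le_mul_of_nonneg_left (norm_mul_le _ _) (norm_nonneg _))
  have h6 : ‖A‖ * (‖A‖ * ‖R‖) ≤ ‖A‖ * (‖A‖ * 1) := by gcongr
  have h7 : ‖A‖ * (‖A‖ * 1) = s ^ 2 / 4 * ‖H‖ ^ 2 := by
    rw [hAn, ← sq_abs s]; ring
  rw [Complex.norm_two]
  nlinarith [mul_nonneg (sq_nonneg s) (sq_nonneg ‖H‖)]

end PiMatrix

/-! ### Powers of complex numbers close to one -/

lemma norm_pow_sub_one_le {z : ℂ} (hz : ‖z‖ ≤ 1) (n : ℕ) : ‖z ^ n - 1‖ ≤ n * ‖z - 1‖ := by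
  induction n with
  | zero => simp
  | succ n ih =>
    have : z ^ (n + 1) - 1 = z ^ n * (z - 1) + (z ^ n - 1) := by ring
    rw [this]
    refine (norm_add_le _ _).trans ?_
    rw [norm_mul, norm_pow]
    have h1 : ‖z‖ ^ n ≤ 1 := pow_le_one₀ (norm_nonneg _) hz
    push_cast
    nlinarith [norm_nonneg (z - 1)]

lemma norm_pow_sub_one_sub_le {z : ℂ} (hz : ‖z‖ ≤ 1) (n : ℕ) :
    ‖z ^ n - 1 - n * (z - 1)‖ ≤ n ^ 2 * ‖z - 1‖ ^ 2 := by
  induction n with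
  | zero => simp
  | succ n ih =>
    have : z ^ (n + 1) - 1 - ((n + 1 : ℕ) : ℂ) * (z - 1) =
        (z ^ n - 1) * (z - 1) + (z ^ n - 1 - n * (z - 1)) := by push_cast; ring
    rw [this]
    refine (norm_add_le _ _).trans ?_
    rw [norm_mul]
    have h1 := mul_le_mul_of_nonneg_right (norm_pow_sub_one_le hz n) (norm_nonneg (z - 1))
    push_cast
    nlinarith [sq_nonneg ‖z - 1‖, mul_nonneg (Nat.cast_nonneg (α := ℝ) n) (sq_nonneg ‖z - 1‖)]

/-! ### Collective test matrices

A test matrix `X` on one system gives rise to the collective test matrix `∑ᵢ Xᵢ` on `k` systems.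
Its norm grows like `k`; the bounded substitute `s⁻¹ ∑ₐ cₐ Uₐ^{⊗k}`, with unitaries
`Uₐ ≈ 1 + s Yₐ` and `s` of order `k^{-1/2}`, has norm of order `√k` only. -/

section Collective

variable {d A : Type} [Fintype d] [DecidableEq d] [Fintype A]

/-- Unitaries `U a ≈ 1 + s Y a` whose combination with coefficients `c a` is `s X` to first
order, the `Y a` being centred with respect to `σ`. -/
structure UnitaryFamily (σ X : Matrix d d ℂ) (c : A → ℂ) (Y U : A → Matrix d d ℂ) (s K : ℝ) :
    Prop where
  unitary : ∀ a, (U a)ᴴ * U a = 1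
  approx : ∀ a, ‖U a - 1 - (s : ℂ) • Y a‖ ≤ s ^ 2 * K
  norm_le : ∀ a, ‖Y a‖ ≤ K
  centred : ∀ a, (Y a * σ).trace = 0
  sum_coeff : ∑ a, c a = 0
  sum_norm_coeff : ∑ a, ‖c a‖ ≤ 2
  sum_smul : ∑ a, c a • Y a = X
  pos : 0 < s
  le_one : s ≤ 1

/-- The collective test matrix `s⁻¹ ∑ₐ cₐ Uₐ^{⊗ι}`. -/
noncomputable def collective (ι : Type) [Fintype ι] [DecidableEq ι] (c : A → ℂ)
    (U : A → Matrix d d ℂ) (s : ℝ) : Matrix (ι → d) (ι → d) ℂ :=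
  ((s⁻¹ : ℝ) : ℂ) • ∑ a, c a • piMatrix fun _ : ι => U a

variable {σ X δ : Matrix d d ℂ} {c : A → ℂ} {Y U : A → Matrix d d ℂ} {s K : ℝ}
  {ι : Type} [Fintype ι] [DecidableEq ι]

lemma UnitaryFamily.norm_collective_le (H : UnitaryFamily σ X c Y U s K) :
    ‖collective ι c U s‖ ≤ 2 / s := by
  have hs := H.pos
  rw [collective, norm_smul, Complex.norm_real, Real.norm_of_nonneg (by positivity), div_eq_mul_inv,
    mul_comm]
  gcongr
  refine (norm_sum_le _ _).trans (le_trans (Finset.sum_le_sum fun a _ => ?_) H.sum_norm_coeff)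
  rw [norm_smul]
  exact mul_le_of_le_one_right (norm_nonneg _) (norm_piMatrix_le (H.unitary a))

lemma norm_sum_mul_le (h : ∑ a, ‖c a‖ ≤ 2) {f : A → ℂ} {t : ℝ} (ht : 0 ≤ t)
    (hf : ∀ a, ‖f a‖ ≤ t) : ‖∑ a, star (c a) * f a‖ ≤ 2 * t := by
  refine (norm_sum_le _ _).trans ?_
  calc ∑ a, ‖star (c a) * f a‖ ≤ ∑ a, ‖c a‖ * t := Finset.sum_le_sum fun a _ => by
        rw [norm_mul, norm_star]; exact mul_le_mul_of_nonneg_left (hf a) (norm_nonneg _)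
    _ ≤ 2 * t := by rw [← Finset.sum_mul]; exact mul_le_mul_of_nonneg_right h ht

lemma norm_trace_mul_state_le (hσ : IsState σ) (M : Matrix d d ℂ) : ‖(M * σ).trace‖ ≤ ‖M‖ :=
  (norm_trace_mul_le M σ).trans (mul_le_of_le_one_right (norm_nonneg _) hσ.traceNorm_le)

lemma UnitaryFamily.norm_sub_one_le (H : UnitaryFamily σ X c Y U s K) (a : A) :
    ‖U a - 1‖ ≤ 2 * (s * K) := by
  have h1 : U a - 1 = (U a - 1 - (s : ℂ) • Y a) + (s : ℂ) • Y a := by abel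
  have hK : 0 ≤ K := (norm_nonneg _).trans (H.norm_le a)
  rw [h1]
  refine (norm_add_le _ _).trans ?_
  have h2 : ‖(s : ℂ) • Y a‖ ≤ s * K := by
    rw [norm_smul, Complex.norm_real, Real.norm_of_nonneg H.pos.le]
    exact mul_le_mul_of_nonneg_left (H.norm_le a) H.pos.le
  have h3 := H.approx a
  have h4 : s ^ 2 * K ≤ s * K := by
    have := H.pos; have := H.le_one
    exact mul_le_mul_of_nonneg_right (by nlinarith) hK
  linarith

lemma UnitaryFamily.norm_trace_sub_one_le (H : UnitaryFamily σ X c Y U s K) (hσ : IsState σ)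
    (a : A) : ‖((U a - 1) * σ).trace‖ ≤ s ^ 2 * K := by
  have h1 : ((U a - 1) * σ).trace = ((U a - 1 - (s : ℂ) • Y a) * σ).trace := by
    rw [Matrix.sub_mul (U a - 1), Matrix.trace_sub, Matrix.smul_mul, Matrix.trace_smul, H.centred,
      smul_zero, sub_zero]
  rw [h1]
  exact (norm_trace_mul_state_le hσ _).trans (H.approx a)

lemma trace_conjTranspose_mul_state (hσ : IsState σ) (M : Matrix d d ℂ) :
    (Mᴴ * σ).trace = star (M * σ).trace := by
  rw [← Matrix.trace_conjTranspose, Matrix.conjTranspose_mul, hσ.posSemidef.isHermitian.eq,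
    Matrix.trace_mul_comm]

/-- The linear term of `fisherVal` at the collective test matrix. -/
lemma UnitaryFamily.linear_term (H : UnitaryFamily σ X c Y U s K) (hσ : IsState σ)
    (hδ : δ.trace = 0) (hK : 0 ≤ K) :
    ‖((collective ι c U s)ᴴ * piMatrixDeriv ι σ δ).trace - Fintype.card ι * (Xᴴ * δ).trace‖ ≤
      Fintype.card ι * (2 * (traceNorm δ * K + 2 * traceNorm δ * K ^ 2) *
        (s + Fintype.card ι * s ^ 2)) := by
  set k := Fintype.card ι with hk
  set D := traceNorm δ with hD
  have hD0 : 0 ≤ D := traceNorm_nonneg δ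
  have hs := H.pos
  have hs' : (s : ℂ) ≠ 0 := by exact_mod_cast hs.ne'
  -- one term of the sum, compared with its value to first order in `s`
  have hterm : ∀ a, ‖((s⁻¹ : ℝ) : ℂ) * (((U a)ᴴ * δ).trace * ((U a)ᴴ * σ).trace ^ (k - 1)) -
      ((Y a)ᴴ * δ).trace‖ ≤ (D * K + 2 * D * K ^ 2) * (s + k * s ^ 2) := by
    intro a
    set z := ((U a)ᴴ * σ).trace with hz
    set w := ((U a)ᴴ * δ).trace with hw
    have hUn : ‖(U a)ᴴ‖ ≤ 1 := by
      rw [Matrix.l2_opNorm_conjTranspose]; exact norm_le_one_of_unitary (H.unitary a)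
    have hz1 : ‖z‖ ≤ 1 := (norm_trace_mul_state_le hσ _).trans hUn
    have hz2 : ‖z - 1‖ ≤ s ^ 2 * K := by
      have : z - 1 = star ((U a - 1) * σ).trace := by
        rw [← trace_conjTranspose_mul_state hσ, Matrix.conjTranspose_sub, Matrix.conjTranspose_one,
          Matrix.sub_mul, Matrix.trace_sub, Matrix.one_mul, hσ.trace_eq]
      rw [this, norm_star]
      exact H.norm_trace_sub_one_le hσ a
    have hz3 : ‖z ^ (k - 1) - 1‖ ≤ k * (s ^ 2 * K) := by
      refine (norm_pow_sub_one_le hz1 _).trans ?_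
      gcongr
      exact Nat.sub_le _ _
    have hw1 : ‖w‖ ≤ 2 * (s * K) * D := by
      have : w = ((U a - 1)ᴴ * δ).trace := by
        rw [Matrix.conjTranspose_sub, Matrix.conjTranspose_one, Matrix.sub_mul, Matrix.trace_sub,
          Matrix.one_mul, hδ, sub_zero]
      rw [this]
      refine (norm_trace_mul_le _ _).trans ?_
      rw [Matrix.l2_opNorm_conjTranspose]
      exact mul_le_mul_of_nonneg_right (H.norm_sub_one_le a) hD0
    have hw2 : ‖w - (s : ℂ) * ((Y a)ᴴ * δ).trace‖ ≤ s ^ 2 * K * D := by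
      have : w - (s : ℂ) * ((Y a)ᴴ * δ).trace = ((U a - 1 - (s : ℂ) • Y a)ᴴ * δ).trace := by
        rw [Matrix.conjTranspose_sub, Matrix.conjTranspose_sub, Matrix.conjTranspose_one,
          Matrix.conjTranspose_smul, Matrix.sub_mul, Matrix.sub_mul, Matrix.trace_sub,
          Matrix.trace_sub, Matrix.one_mul, hδ, sub_zero, Matrix.smul_mul, Matrix.trace_smul]
        simp [hw]
      rw [this]
      refine (norm_trace_mul_le _ _).trans ?_
      rw [Matrix.l2_opNorm_conjTranspose]
      exact mul_le_mul_of_nonneg_right (H.approx a) hD0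
    have hsplit : ((s⁻¹ : ℝ) : ℂ) * (w * z ^ (k - 1)) - ((Y a)ᴴ * δ).trace =
        ((s⁻¹ : ℝ) : ℂ) * (w * (z ^ (k - 1) - 1) + (w - (s : ℂ) * ((Y a)ᴴ * δ).trace)) := by
      push_cast
      field_simp
      ring
    rw [hsplit, norm_mul, Complex.norm_real, Real.norm_of_nonneg (by positivity)]
    have h1 : ‖w * (z ^ (k - 1) - 1) + (w - (s : ℂ) * ((Y a)ᴴ * δ).trace)‖ ≤
        2 * (s * K) * D * (k * (s ^ 2 * K)) + s ^ 2 * K * D := by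
      refine (norm_add_le _ _).trans (add_le_add ?_ hw2)
      rw [norm_mul]
      exact mul_le_mul hw1 hz3 (norm_nonneg _) (by positivity)
    refine (mul_le_mul_of_nonneg_left h1 (by positivity)).trans ?_
    have h2 : s⁻¹ * (2 * (s * K) * D * (k * (s ^ 2 * K)) + s ^ 2 * K * D) =
        2 * D * K ^ 2 * (k * s ^ 2) + D * K * s := by
      field_simp
    rw [h2]
    have h3 : 0 ≤ D * K := by positivity
    have h4 : 0 ≤ 2 * D * K ^ 2 := by positivity
    have h5 : 0 ≤ k * s ^ 2 := by positivity
    nlinarith [mul_nonneg h3 h5, mul_nonneg h4 hs.le]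
  have hsum : ((collective ι c U s)ᴴ * piMatrixDeriv ι σ δ).trace - k * (Xᴴ * δ).trace =
      k * ∑ a, star (c a) * (((s⁻¹ : ℝ) : ℂ) *
        (((U a)ᴴ * δ).trace * ((U a)ᴴ * σ).trace ^ (k - 1)) - ((Y a)ᴴ * δ).trace) := by
    rw [← H.sum_smul, collective, Matrix.conjTranspose_smul, Matrix.conjTranspose_sum,
      Matrix.conjTranspose_sum]
    simp only [Matrix.conjTranspose_smul, piMatrix_conjTranspose, Matrix.smul_mul, Matrix.sum_mul,
      Matrix.trace_smul, Matrix.trace_sum, trace_piMatrix_mul_deriv, smul_eq_mul, mul_sub,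
      Finset.sum_sub_distrib, Finset.mul_sum]
    congr 1
    refine Finset.sum_congr rfl fun a _ => ?_
    rw [← hk]
    simp
    ring
  rw [hsum, norm_mul, Complex.norm_natCast]
  refine mul_le_mul_of_nonneg_left ?_ (Nat.cast_nonneg _)
  refine (norm_sum_mul_le H.sum_norm_coeff (by positivity) hterm).trans (le_of_eq ?_)
  ring

/-- The quadratic term of `fisherVal` at the collective test matrix. -/
lemma UnitaryFamily.quadratic_term (H : UnitaryFamily σ X c Y U s K) (hσ : IsState σ)
    (hK : 0 ≤ K) :
    ‖(((collective ι c U s)ᴴ * collective ι c U s) * piMatrix fun _ : ι => σ).trace -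
        Fintype.card ι * ((Xᴴ * X) * σ).trace‖ ≤
      Fintype.card ι * ((4 * (4 * K ^ 2 + 2 * K) ^ 2 + 12 * K ^ 2) *
        (s + Fintype.card ι * s ^ 2)) := by
  set k := Fintype.card ι with hk
  have hs := H.pos
  have hs' : (s : ℂ) ≠ 0 := by exact_mod_cast hs.ne'
  set K₂ := 4 * K ^ 2 + 2 * K with hK₂
  have hK₂0 : 0 ≤ K₂ := by positivity
  set z : A → A → ℂ := fun a b => (((U a)ᴴ * U b) * σ).trace with hz
  set G : Matrix d d ℂ := ∑ a, c a • U a with hG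
  -- `z a b` is the overlap of `U a` and `U b`; the centring of `Y` makes it `1 + O(s²)`
  have hz1 : ∀ a b, ‖z a b‖ ≤ 1 := fun a b =>
    (norm_trace_mul_state_le hσ _).trans (norm_le_one_of_unitary (by
      rw [Matrix.conjTranspose_mul, Matrix.conjTranspose_conjTranspose]
      have := mul_eq_one_comm.mp (H.unitary a)
      calc (U b)ᴴ * U a * ((U a)ᴴ * U b) = (U b)ᴴ * (U a * (U a)ᴴ) * U b := by
            simp only [Matrix.mul_assoc]
        _ = 1 := by rw [this, Matrix.mul_one, H.unitary b]))
  have hz2 : ∀ a b, ‖z a b - 1‖ ≤ s ^ 2 * K₂ := by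
    intro a b
    have h1 : z a b - 1 = (((U a - 1)ᴴ * (U b - 1)) * σ).trace + star ((U a - 1) * σ).trace +
        ((U b - 1) * σ).trace := by
      rw [← trace_conjTranspose_mul_state hσ, ← Matrix.trace_add, ← Matrix.trace_add,
        ← Matrix.add_mul, ← Matrix.add_mul, hz, ← hσ.trace_eq, ← Matrix.trace_sub]
      congr 1
      rw [Matrix.conjTranspose_sub, Matrix.conjTranspose_one]
      noncomm_ring
    rw [h1]
    have h2 := H.norm_trace_sub_one_le hσ a
    have h3 := H.norm_trace_sub_one_le hσ b
    have h4 : ‖(((U a - 1)ᴴ * (U b - 1)) * σ).trace‖ ≤ 2 * (s * K) * (2 * (s * K)) := by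
      refine (norm_trace_mul_state_le hσ _).trans ((norm_mul_le _ _).trans ?_)
      rw [Matrix.l2_opNorm_conjTranspose]
      exact mul_le_mul (H.norm_sub_one_le a) (H.norm_sub_one_le b) (norm_nonneg _) (by positivity)
    refine (norm_add₃_le).trans ?_
    rw [norm_star]
    refine (add_le_add (add_le_add h4 h2) h3).trans (le_of_eq ?_)
    rw [hK₂]; ring
  -- the powers of the `z a b`, up to the linear terms
  have hfirst : ‖∑ a, star (c a) * ∑ b, c b * (z a b ^ k - 1 - k * (z a b - 1))‖ ≤
      4 * (k ^ 2 * (s ^ 2 * K₂) ^ 2) := by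
    have hin : ∀ a, ‖∑ b, c b * (z a b ^ k - 1 - k * (z a b - 1))‖ ≤
        2 * (k ^ 2 * (s ^ 2 * K₂) ^ 2) := by
      intro a
      have := norm_sum_mul_le (c := fun b => star (c b)) (by simpa using H.sum_norm_coeff)
        (f := fun b => z a b ^ k - 1 - k * (z a b - 1)) (t := k ^ 2 * (s ^ 2 * K₂) ^ 2)
        (by positivity) (fun b => (norm_pow_sub_one_sub_le (hz1 a b) k).trans (by
          gcongr; exact hz2 a b))
      simpa using this
    refine (norm_sum_mul_le H.sum_norm_coeff (by positivity) hin).trans (le_of_eq (by ring))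
  -- the linear terms, which involve one system only
  set R : Matrix d d ℂ := ((s⁻¹ : ℝ) : ℂ) • G - X with hR
  have hRn : ‖R‖ ≤ 2 * (s * K) := by
    have h1 : R = ((s⁻¹ : ℝ) : ℂ) • ∑ a, c a • (U a - 1 - (s : ℂ) • Y a) := by
      have h0 : ∑ a, c a • (U a - 1 - (s : ℂ) • Y a) = G - (s : ℂ) • X := by
        rw [← H.sum_smul, Finset.smul_sum, hG]
        simp only [smul_sub, Finset.sum_sub_distrib, ← Finset.sum_smul, H.sum_coeff, zero_smul,
          sub_zero]
        congr 1
        exact Finset.sum_congr rfl fun a _ => smul_comm _ _ _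
      rw [h0, smul_sub, smul_smul, Complex.ofReal_inv, inv_mul_cancel₀ hs', one_smul, hR,
        Complex.ofReal_inv]
    rw [h1, norm_smul, Complex.norm_real, Real.norm_of_nonneg (by positivity)]
    have h2 : ‖∑ a, c a • (U a - 1 - (s : ℂ) • Y a)‖ ≤ 2 * (s ^ 2 * K) := by
      refine (norm_sum_le _ _).trans ?_
      calc ∑ a, ‖c a • (U a - 1 - (s : ℂ) • Y a)‖ ≤ ∑ a, ‖c a‖ * (s ^ 2 * K) :=
            Finset.sum_le_sum fun a _ => by
              rw [norm_smul]; exact mul_le_mul_of_nonneg_left (H.approx a) (norm_nonneg _)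
        _ ≤ 2 * (s ^ 2 * K) := by
            rw [← Finset.sum_mul]; exact mul_le_mul_of_nonneg_right H.sum_norm_coeff (by positivity)
    refine (mul_le_mul_of_nonneg_left h2 (by positivity)).trans (le_of_eq ?_)
    field_simp
  have hXn : ‖X‖ ≤ 2 * K := by
    rw [← H.sum_smul]
    refine (norm_sum_le _ _).trans ?_
    calc ∑ a, ‖c a • Y a‖ ≤ ∑ a, ‖c a‖ * K := Finset.sum_le_sum fun a _ => by
          rw [norm_smul]; exact mul_le_mul_of_nonneg_left (H.norm_le a) (norm_nonneg _)
      _ ≤ 2 * K := by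
          rw [← Finset.sum_mul]; exact mul_le_mul_of_nonneg_right H.sum_norm_coeff hK
  have hsecond : ‖((s⁻¹ : ℝ) : ℂ) * ((s⁻¹ : ℝ) : ℂ) * ((Gᴴ * G) * σ).trace -
      ((Xᴴ * X) * σ).trace‖ ≤ 12 * K ^ 2 * s := by
    have h1 : ((s⁻¹ : ℝ) : ℂ) * ((s⁻¹ : ℝ) : ℂ) * ((Gᴴ * G) * σ).trace - ((Xᴴ * X) * σ).trace =
        ((Xᴴ * R + Rᴴ * X + Rᴴ * R) * σ).trace := by
      have h2 : ((s⁻¹ : ℝ) : ℂ) • G = X + R := by rw [hR]; abel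
      have h3 : (((s⁻¹ : ℝ) : ℂ) * ((s⁻¹ : ℝ) : ℂ)) • (Gᴴ * G) = (X + R)ᴴ * (X + R) := by
        rw [← h2, Matrix.conjTranspose_smul, Matrix.smul_mul, Matrix.mul_smul, smul_smul]
        simp
      rw [← smul_eq_mul, ← Matrix.trace_smul, ← Matrix.smul_mul, h3, ← Matrix.trace_sub,
        ← Matrix.sub_mul, Matrix.conjTranspose_add]
      congr 2
      noncomm_ring
    rw [h1]
    refine (norm_trace_mul_state_le hσ _).trans (norm_add₃_le.trans ?_)
    have h4 : ‖Xᴴ * R‖ ≤ 2 * K * (2 * (s * K)) := by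
      refine (norm_mul_le _ _).trans ?_
      rw [Matrix.l2_opNorm_conjTranspose]
      exact mul_le_mul hXn hRn (norm_nonneg _) (by positivity)
    have h5 : ‖Rᴴ * X‖ ≤ 2 * (s * K) * (2 * K) := by
      refine (norm_mul_le _ _).trans ?_
      rw [Matrix.l2_opNorm_conjTranspose]
      exact mul_le_mul hRn hXn (norm_nonneg _) (by positivity)
    have h6 : ‖Rᴴ * R‖ ≤ 2 * (s * K) * (2 * (s * K)) := by
      refine (norm_mul_le _ _).trans ?_
      rw [Matrix.l2_opNorm_conjTranspose]
      exact mul_le_mul hRn hRn (norm_nonneg _) (by positivity)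
    have h7 : s ^ 2 * K ^ 2 ≤ s * K ^ 2 := by
      have := H.le_one
      exact mul_le_mul_of_nonneg_right (by nlinarith) (by positivity)
    nlinarith
  have hpow : ((collective ι c U s)ᴴ * collective ι c U s) =
      (((s⁻¹ : ℝ) : ℂ) * ((s⁻¹ : ℝ) : ℂ)) •
        ∑ a, ∑ b, (star (c a) * c b) • piMatrix fun _ : ι => (U a)ᴴ * U b := by
    rw [collective, Matrix.conjTranspose_smul, Matrix.conjTranspose_sum, Matrix.smul_mul,
      Matrix.mul_smul, smul_smul, Matrix.sum_mul]
    simp only [Matrix.mul_sum, Matrix.conjTranspose_smul, piMatrix_conjTranspose, Matrix.smul_mul,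
      Matrix.mul_smul, piMatrix_mul, smul_smul]
    simp [mul_comm]
  have hGG : ((Gᴴ * G) * σ).trace = ∑ a, star (c a) * ∑ b, c b * z a b := by
    simp only [hG, Matrix.conjTranspose_sum, Matrix.conjTranspose_smul, Matrix.sum_mul,
      Matrix.smul_mul, Matrix.mul_smul, Matrix.trace_sum, Matrix.trace_smul,
      smul_eq_mul, Finset.mul_sum, hz]
    rw [Finset.sum_comm]
    refine Finset.sum_congr rfl fun a _ => Finset.sum_congr rfl fun b _ => ?_
    ring
  have hmain : (((collective ι c U s)ᴴ * collective ι c U s) *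
        piMatrix fun _ : ι => σ).trace - k * ((Xᴴ * X) * σ).trace =
      ((s⁻¹ : ℝ) : ℂ) * ((s⁻¹ : ℝ) : ℂ) *
        (∑ a, star (c a) * ∑ b, c b * (z a b ^ k - 1 - k * (z a b - 1))) +
      k * (((s⁻¹ : ℝ) : ℂ) * ((s⁻¹ : ℝ) : ℂ) * ((Gᴴ * G) * σ).trace - ((Xᴴ * X) * σ).trace) := by
    have h1 : ∑ a, star (c a) * ∑ b, c b * (z a b ^ k - 1 - k * (z a b - 1)) =
        (∑ a, ∑ b, star (c a) * c b * z a b ^ k) - k * ((Gᴴ * G) * σ).trace := by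
      rw [hGG]
      have h2 : ∀ a, ∑ b, c b * (z a b ^ k - 1 - k * (z a b - 1)) =
          ∑ b, c b * z a b ^ k - k * ∑ b, c b * z a b := by
        intro a
        have h3 : ∀ b, c b * (z a b ^ k - 1 - k * (z a b - 1)) =
            c b * z a b ^ k - k * (c b * z a b) + (k - 1) * c b := fun b => by ring
        simp only [h3, Finset.sum_add_distrib, Finset.sum_sub_distrib, ← Finset.mul_sum,
          H.sum_coeff, mul_zero, add_zero]
      simp only [h2]
      simp only [mul_sub (star _), Finset.sum_sub_distrib, Finset.mul_sum]
      congr 1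
      · exact Finset.sum_congr rfl fun a _ => Finset.sum_congr rfl fun b _ => by ring
      · exact Finset.sum_congr rfl fun a _ => Finset.sum_congr rfl fun b _ => by ring
    rw [h1, hpow, Matrix.smul_mul, Matrix.trace_smul, Matrix.sum_mul, Matrix.trace_sum]
    simp only [Matrix.sum_mul, Matrix.trace_sum, Matrix.smul_mul, Matrix.trace_smul, piMatrix_mul,
      trace_piMatrix, Finset.prod_const, Finset.card_univ, smul_eq_mul, ← hk, hz]
    ring
  rw [hmain]
  refine (norm_add_le _ _).trans ?_
  rw [norm_mul, norm_mul, norm_mul, Complex.norm_natCast, Complex.norm_real,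
    Real.norm_of_nonneg (show (0 : ℝ) ≤ s⁻¹ by positivity)]
  refine (add_le_add (mul_le_mul_of_nonneg_left hfirst (by positivity))
    (mul_le_mul_of_nonneg_left hsecond (Nat.cast_nonneg k))).trans ?_
  have h8 : s⁻¹ * s⁻¹ * (4 * ((k : ℝ) ^ 2 * (s ^ 2 * K₂) ^ 2)) =
      k * (4 * K₂ ^ 2 * (k * s ^ 2)) := by
    field_simp
  rw [h8, ← mul_add]
  refine mul_le_mul_of_nonneg_left ?_ (Nat.cast_nonneg k)
  have h9 : 0 ≤ (k : ℝ) * s ^ 2 := by positivity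
  have h10 : 0 ≤ 4 * K₂ ^ 2 := by positivity
  have h11 : 0 ≤ 12 * K ^ 2 := by positivity
  nlinarith [mul_nonneg h10 hs.le, mul_nonneg h11 h9]

end Collective

/-! ### Attaining the information of independent copies -/

section Collective

variable {d a b : Type} [Fintype d] [DecidableEq d] [Fintype a] [DecidableEq a] [Fintype b]
  [DecidableEq b]

/-- The unitary family for `X = H₁ + i H₂`, with the coefficients of `sin H₁ + i sin H₂`. -/
lemma exists_unitaryFamily {σ H₁ H₂ : Matrix d d ℂ} (h1 : H₁.IsHermitian) (h2 : H₂.IsHermitian)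
    (hc1 : (H₁ * σ).trace = 0) (hc2 : (H₂ * σ).trace = 0) {s : ℝ} (hs : 0 < s) (hs1 : s ≤ 1) :
    ∃ (c : Fin 4 → ℂ) (Y U : Fin 4 → Matrix d d ℂ),
      UnitaryFamily σ (H₁ + Complex.I • H₂) c Y U s
        (‖H₁‖ + ‖H₂‖ + ‖H₁‖ ^ 2 + ‖H₂‖ ^ 2) ∧
      ∀ (ι : Type) [Fintype ι] [DecidableEq ι], H₂ = 0 → (collective ι c U s).IsHermitian := by
  obtain ⟨U₁, hU1, hA1⟩ := exists_unitary_approx h1 s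
  obtain ⟨U₂, hU2, hA2⟩ := exists_unitary_approx h2 s
  have hadj : ∀ {U H : Matrix d d ℂ}, H.IsHermitian →
      ‖Uᴴ - 1 - (s : ℂ) • (-(Complex.I • H))‖ = ‖U - 1 - (s : ℂ) • (Complex.I • H)‖ := by
    intro U H hH
    rw [← Matrix.l2_opNorm_conjTranspose]
    simp only [Matrix.conjTranspose_sub, Matrix.conjTranspose_one, Matrix.conjTranspose_smul,
      Matrix.conjTranspose_neg, Matrix.conjTranspose_conjTranspose, hH.eq]
    simp
  have hn1 := norm_nonneg H₁
  have hn2 := norm_nonneg H₂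
  have hs2 : 0 ≤ s ^ 2 := sq_nonneg s
  have hK1 : s ^ 2 * ‖H₁‖ ^ 2 ≤ s ^ 2 * (‖H₁‖ + ‖H₂‖ + ‖H₁‖ ^ 2 + ‖H₂‖ ^ 2) :=
    mul_le_mul_of_nonneg_left (by nlinarith) hs2
  have hK2 : s ^ 2 * ‖H₂‖ ^ 2 ≤ s ^ 2 * (‖H₁‖ + ‖H₂‖ + ‖H₁‖ ^ 2 + ‖H₂‖ ^ 2) :=
    mul_le_mul_of_nonneg_left (by nlinarith) hs2
  have hU1' := mul_eq_one_comm.mp hU1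
  have hU2' := mul_eq_one_comm.mp hU2
  refine ⟨![-Complex.I / 2, Complex.I / 2, 1 / 2, -1 / 2],
    ![Complex.I • H₁, -(Complex.I • H₁), Complex.I • H₂, -(Complex.I • H₂)],
    ![U₁, U₁ᴴ, U₂, U₂ᴴ], ⟨?_, ?_, ?_, ?_, ?_, ?_, ?_, hs, hs1⟩, ?_⟩
  · intro i
    fin_cases i
    · simpa using hU1
    · simpa using hU1'
    · simpa using hU2
    · simpa using hU2'
  · intro i
    fin_cases i
    · exact hA1.trans hK1
    · exact (hadj h1).le.trans (hA1.trans hK1)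
    · exact hA2.trans hK2
    · exact (hadj h2).le.trans (hA2.trans hK2)
  · intro i
    fin_cases i <;> simp [norm_smul] <;> nlinarith
  · intro i
    fin_cases i <;> simp [Matrix.trace_smul, hc1, hc2]
  · simp [Fin.sum_univ_four]; ring
  · simp [Fin.sum_univ_four]; norm_num
  · simp only [Fin.sum_univ_four]
    simp only [Matrix.cons_val, smul_neg, smul_smul]
    have e1 : -Complex.I / 2 * Complex.I = 1 / 2 := by
      rw [div_mul_eq_mul_div, neg_mul, Complex.I_mul_I]; norm_num
    have e2 : Complex.I / 2 * Complex.I = -(1 / 2) := by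
      rw [div_mul_eq_mul_div, Complex.I_mul_I]; norm_num
    rw [e1, e2]
    module
  · intro ι _ _ hz
    -- the error bound for `U₂` vanishes with `H₂`
    have hU2one : U₂ = 1 := by
      rw [hz] at hA2
      simpa [sub_eq_zero] using hA2
    rw [Matrix.IsHermitian, collective]
    simp only [Fin.sum_univ_four, Matrix.cons_val, Matrix.conjTranspose_smul,
      Matrix.conjTranspose_add, piMatrix_conjTranspose, Matrix.conjTranspose_conjTranspose, hU2one,
      Matrix.conjTranspose_one]
    have e1 : star (-Complex.I / 2) = Complex.I / 2 := by simp
    have e2 : star (Complex.I / 2) = -Complex.I / 2 := by simp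
    have e3 : star (1 / 2 : ℂ) = 1 / 2 := by simp
    have e4 : star (-1 / 2 : ℂ) = -1 / 2 := by simp
    rw [e1, e2, e3, e4, Complex.star_def, Complex.conj_ofReal]
    congr 1
    abel

/-- In the i.i.d. situation, the value of `fisherVal` per system can be attained up to `ε` by test
matrices on `k` systems whose norm is of order `√k`. -/
lemma exists_collective_test {h : Prop} {σ δ X : Matrix d d ℂ} (hσ : IsState σ)
    (hδ : δ.trace = 0) (hX : X ∈ testSpace h d) {ε : ℝ} (hε : 0 < ε) :
    ∃ C : ℝ, 0 < C ∧ ∀ k : ℕ, 1 ≤ k → ∃ F ∈ testSpace h (Fin k → d), ‖F‖ ≤ C * √k ∧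
      k * (fisherVal σ δ X - ε) ≤
        fisherVal (piMatrix fun _ : Fin k => σ) (piMatrixDeriv (Fin k) σ δ) F := by
  -- Cartesian decomposition `Z = H₁ + i H₂` of a centred test matrix
  obtain ⟨Z, hZ, hZσ, hle⟩ := exists_centred_test hσ hδ hX
  set H₁ : Matrix d d ℂ := (1 / 2 : ℂ) • (Z + Zᴴ) with hH1
  set H₂ : Matrix d d ℂ := (-Complex.I / 2 : ℂ) • (Z - Zᴴ) with hH2
  have h1 : H₁.IsHermitian := by
    rw [Matrix.IsHermitian, hH1, Matrix.conjTranspose_smul, Matrix.conjTranspose_add,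
      Matrix.conjTranspose_conjTranspose, add_comm]
    simp
  have h2 : H₂.IsHermitian := by
    rw [Matrix.IsHermitian, hH2, Matrix.conjTranspose_smul, Matrix.conjTranspose_sub,
      Matrix.conjTranspose_conjTranspose, ← neg_sub Z, smul_neg, ← neg_smul]
    congr 1
    simp [neg_div]
  have hZ12 : H₁ + Complex.I • H₂ = Z := by
    rw [hH1, hH2, smul_smul]
    have : Complex.I * (-Complex.I / 2) = 1 / 2 := by
      rw [mul_div_assoc', mul_neg, Complex.I_mul_I, neg_neg]
    rw [this]
    module
  have hZσ' : (Z * σ).trace = 0 := by rw [Matrix.trace_mul_comm, hZσ]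
  have hZσ'' : (Zᴴ * σ).trace = 0 := by rw [trace_conjTranspose_mul_state hσ, hZσ', star_zero]
  have hc1 : (H₁ * σ).trace = 0 := by
    rw [hH1, Matrix.smul_mul, Matrix.trace_smul, Matrix.add_mul, Matrix.trace_add, hZσ', hZσ'']
    simp
  have hc2 : (H₂ * σ).trace = 0 := by
    rw [hH2, Matrix.smul_mul, Matrix.trace_smul, Matrix.sub_mul, Matrix.trace_sub, hZσ', hZσ'']
    simp
  set K := ‖H₁‖ + ‖H₂‖ + ‖H₁‖ ^ 2 + ‖H₂‖ ^ 2 with hK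
  have hK0 : 0 ≤ K := by positivity
  set C₁ := 2 * (traceNorm δ * K + 2 * traceNorm δ * K ^ 2) with hC1
  set C₂ := 4 * (4 * K ^ 2 + 2 * K) ^ 2 + 12 * K ^ 2 with hC2
  have hC10 : 0 ≤ C₁ := by have := traceNorm_nonneg δ; positivity
  have hC20 : 0 ≤ C₂ := by positivity
  -- with `s = t / √k` the error per system is at most `(2 C₁ + C₂) (s + k s²) ≤ (2 C₁ + C₂) 2 t`
  set t := min 1 (ε / (2 * (2 * C₁ + C₂ + 1))) with ht
  have ht0 : 0 < t := lt_min one_pos (by positivity)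
  have ht1 : t ≤ 1 := min_le_left _ _
  have htε : (2 * C₁ + C₂) * (t + t) ≤ ε := by
    have h3 : t * (2 * (2 * C₁ + C₂ + 1)) ≤ ε :=
      (le_div_iff₀ (by positivity)).mp (min_le_right _ _)
    nlinarith
  refine ⟨2 / t, by positivity, fun k hk => ?_⟩
  have hk0 : (0 : ℝ) < k := by exact_mod_cast hk
  have hsq : 0 < √(k : ℝ) := Real.sqrt_pos.mpr hk0
  have hsq1 : 1 ≤ √(k : ℝ) := by
    rw [Real.one_le_sqrt]; exact_mod_cast hk
  have hst : t / √(k : ℝ) ≤ t := div_le_self ht0.le hsq1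
  obtain ⟨c, Y, U, HF, hHerm⟩ := exists_unitaryFamily h1 h2 hc1 hc2
    (s := t / √(k : ℝ)) (by positivity) (hst.trans ht1)
  rw [hZ12, ← hK] at HF
  set s := t / √(k : ℝ) with hs
  have hks : (k : ℝ) * s ^ 2 = t ^ 2 := by
    rw [hs, div_pow, Real.sq_sqrt hk0.le]; field_simp
  refine ⟨collective (Fin k) c U s, fun H => hHerm _ ?_, ?_, ?_⟩
  · rw [hH2, (hZ H).eq, sub_self, smul_zero]
  · refine HF.norm_collective_le.trans (le_of_eq ?_)
    rw [hs]; field_simp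
  · have e1 := (Complex.abs_re_le_norm _).trans (HF.linear_term (ι := Fin k) hσ hδ hK0)
    have e2 := (Complex.abs_re_le_norm _).trans (HF.quadratic_term (ι := Fin k) hσ hK0)
    rw [Fintype.card_fin, ← hC1, hks, Complex.sub_re, ← Complex.ofReal_natCast,
      Complex.re_ofReal_mul, abs_le] at e1
    rw [Fintype.card_fin, ← hC2, hks, Complex.sub_re, ← Complex.ofReal_natCast,
      Complex.re_ofReal_mul, abs_le] at e2
    have e3 : s + t ^ 2 ≤ t + t :=
      add_le_add hst (by rw [sq]; exact mul_le_of_le_one_left ht0.le ht1)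
    have e4 : (k : ℝ) * ((2 * C₁ + C₂) * (s + t ^ 2)) ≤ k * ε :=
      mul_le_mul_of_nonneg_left ((mul_le_mul_of_nonneg_left e3 (by positivity)).trans htε) hk0.le
    have e5 : (k : ℝ) * fisherVal σ δ X ≤ k * fisherVal σ δ Z :=
      mul_le_mul_of_nonneg_left hle hk0.le
    have e6 : fisherVal σ δ Z = 2 * (Zᴴ * δ).trace.re - (Zᴴ * Z * σ).trace.re := by
      rw [fisherVal, Matrix.trace_mul_comm σ]
    rw [e6, mul_sub] at e5
    set F := collective (Fin k) c U s
    have e9 : fisherVal (piMatrix fun _ : Fin k => σ) (piMatrixDeriv (Fin k) σ δ) F =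
        2 * (Fᴴ * piMatrixDeriv (Fin k) σ δ).trace.re -
          (Fᴴ * F * piMatrix fun _ : Fin k => σ).trace.re := by
      rw [fisherVal, Matrix.trace_mul_comm (piMatrix fun _ : Fin k => σ)]
    rw [mul_sub, e9]
    have e7 := e1.1
    have e8 := e2.2
    linarith

/-- Parallel uses of a channel attain `k` times the value of a single use, up to `ε` per use, with
test matrices of norm `O(√k)`. -/
lemma exists_attains_piT {h : Prop} {Φ Δ : SuperOp a b} (hΦ : IsChannel Φ) (hΔ : IsTangent Δ)
    {ρ : Matrix a a ℂ} (hρ : IsState ρ) {F : Matrix b b ℂ} (hF : F ∈ testSpace h b) {ε : ℝ}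
    (hε : 0 < ε) :
    ∃ C : ℝ, 0 < C ∧ ∀ k : ℕ, 1 ≤ k →
      Attains h (piT fun _ : Fin k => Φ) (piTDeriv (fun _ => Φ) fun _ => Δ)
        (k * (fisherVal (Φ ρ) (Δ ρ) F - ε)) (C * √k) := by
  obtain ⟨C, hC, H⟩ := exists_collective_test (hΦ.isState hρ) (hΔ.trace_map ρ) hF hε
  refine ⟨C, hC, fun k hk => ?_⟩
  obtain ⟨F', hF', hn, hv⟩ := H k hk
  have := attains_of_state (Φ := piT fun _ : Fin k => Φ) (Δ := piTDeriv (fun _ => Φ) fun _ => Δ)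
    (hρ.piMatrix (ι := Fin k)) hF' hn
  rw [piT_piMatrix, piTDeriv_piMatrix] at this
  exact this.mono hv le_rfl

end Collective

/-! ### Lower bounds for channels close to a tensor power -/

section Regularization

variable {a b c d : Type} [Fintype a] [DecidableEq a] [Fintype b] [DecidableEq b]
  [Fintype c] [DecidableEq c] [Fintype d] [DecidableEq d] {h : Prop} {J : StateQuantity}
  {Φ Δ : SuperOp a b}

lemma IsChannel.pow (hΦ : IsChannel Φ) (n : ℕ) : IsChannel (Φ.pow n) := hΦ.piT

lemma IsTangent.deriv (hΦ : IsChannel Φ) (hΔ : IsTangent Δ) (n : ℕ) : IsTangent (Φ.deriv Δ n) :=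
  hΔ.piTDeriv hΦ

/-- Values attained by `k` blocks of `m` uses with ancilla are attained by `k * m + r` uses. -/
lemma Attains.of_blocks [Nonempty a] (hΦ : IsChannel Φ) (hΔ : IsTangent Δ) {k m r n : ℕ}
    (hn : k * m + r = n) {v B : ℝ}
    (H : Attains h (piT fun _ : Fin k => (Φ.pow m).ampl c)
      (piTDeriv (fun _ => (Φ.pow m).ampl c) fun _ => (Φ.deriv Δ m).ampl c) v B) :
    Attains h (Φ.pow n) (Φ.deriv Δ n) v B := by
  have h1 := (H.relabel (relabel_piT_ampl fun _ => Φ.pow m)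
    (relabel_piTDeriv_ampl (fun _ => Φ.pow m) fun _ => Φ.deriv Δ m)).of_ampl
  have h2 := h1.relabel (relabel_piT_prod fun _ : Fin k × Fin m => Φ).symm
    (relabel_piTDeriv_prod (fun _ : Fin k × Fin m => Φ) fun _ => Δ).symm
  have h3 := h2.tensor (hΦ.pow r) (hΔ.deriv hΦ r)
  have h4 := h3.relabel (relabel_piT_sum fun _ : (Fin k × Fin m) ⊕ Fin r => Φ).symm
    (relabel_piTDeriv_sum (fun _ : (Fin k × Fin m) ⊕ Fin r => Φ) fun _ => Δ).symm
  let e : (Fin k × Fin m) ⊕ Fin r ≃ Fin n := Fintype.equivOfCardEq (by simp [hn])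
  exact h4.relabel (relabel_piT e fun _ => Φ) (relabel_piTDeriv e (fun _ => Φ) fun _ => Δ)

/-- The value per use that is attained by `m` uses of `Φ` is attained, up to `ε`, by every sequence
of channels that is asymptotically close to the tensor powers of `Φ`. -/
lemma eventually_attains [Nonempty a] (hΦ : IsChannel Φ) (hΔ : IsTangent Δ) {m : ℕ} (hm : 1 ≤ m)
    {K : ℕ} {ρ : Matrix ((Fin m → a) × Fin K) ((Fin m → a) × Fin K) ℂ} (hρ : IsState ρ)
    {F : Matrix ((Fin m → b) × Fin K) ((Fin m → b) × Fin K) ℂ}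
    (hF : F ∈ testSpace h ((Fin m → b) × Fin K))
    {Φs Δs : (n : ℕ) → SuperOp (Fin n → a) (Fin n → b)}
    (hΦs : Tendsto (fun n => cbNorm (Φs n - Φ.pow n)) atTop (𝓝 0))
    (hΔs : Tendsto (fun n : ℕ => cbNorm (Δs n - Φ.deriv Δ n) / ENNReal.ofReal √n) atTop (𝓝 0))
    {ε : ℝ} (hε : 0 < ε) :
    ∀ᶠ n : ℕ in atTop, ∃ B, Attains h (Φs n) (Δs n)
      (n * (fisherVal ((Φ.pow m).ampl (Fin K) ρ) ((Φ.deriv Δ m).ampl (Fin K) ρ) F / m - ε)) B := by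
  set v := fisherVal ((Φ.pow m).ampl (Fin K) ρ) ((Φ.deriv Δ m).ampl (Fin K) ρ) F with hv
  obtain ⟨C, hC, HC⟩ := exists_attains_piT (h := h) (hΦ.pow m).ampl (hΔ.deriv hΦ m).ampl hρ hF
    (half_pos hε)
  rw [← hv] at HC
  -- `η` is chosen so that the perturbation costs at most `n ε / 4`
  set η := ε / (4 * (2 * C + C ^ 2)) with hη
  have hη0 : 0 < η := by positivity
  have hm0 : (0 : ℝ) < m := by exact_mod_cast hm
  -- the second condition absorbs the value of the block lost in rounding `n / m`
  filter_upwards [eventually_ge_atTop m,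
    eventually_ge_atTop ⌈|v - ε / 2| / (ε / 4)⌉₊,
    hΦs.eventually_le_const (ENNReal.ofReal_pos.mpr hη0),
    hΔs.eventually_le_const (ENNReal.ofReal_pos.mpr hη0)] with n hn1 hn2 hn3 hn4
  have hn0 : (0 : ℝ) < n := by exact_mod_cast (lt_of_lt_of_le hm hn1)
  have hk : 1 ≤ n / m := (Nat.one_le_div_iff hm).mpr hn1
  have hblock := (HC (n / m) hk).of_blocks hΦ hΔ (r := n % m) (n := n)
    (by rw [mul_comm]; exact Nat.div_add_mod n m)
  have hn4' : cbNorm (Δs n - Φ.deriv Δ n) ≤ ENNReal.ofReal (η * √n) := by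
    rw [ENNReal.ofReal_mul hη0.le]
    exact (ENNReal.div_le_iff (ENNReal.ofReal_pos.mpr (Real.sqrt_pos.mpr hn0)).ne'
      ENNReal.ofReal_ne_top).mp hn4
  refine ⟨_, (hblock.perturb hn3 hη0.le hn4' (by positivity)).mono ?_ le_rfl⟩
  set k := n / m with hkdef
  have hkn : (k : ℝ) ≤ n := by exact_mod_cast Nat.div_le_self n m
  have hk1 : (k : ℝ) * m ≤ n := by exact_mod_cast Nat.div_mul_le_self n m
  have hk2 : (n : ℝ) ≤ (k + 1) * m := by
    have e1 := Nat.div_add_mod n m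
    have e2 := (Nat.mod_lt n hm).le
    rw [← hkdef] at e1
    have e3 : n ≤ (k + 1) * m := by rw [add_mul, one_mul, mul_comm k m]; omega
    exact_mod_cast e3
  have hloss1 : C * √k * (η * √n) ≤ C * η * n := by
    have e1 : √(k : ℝ) * √n ≤ n := by
      calc √(k : ℝ) * √n ≤ √n * √n := by gcongr
        _ = n := Real.mul_self_sqrt hn0.le
    calc C * √k * (η * √n) = C * η * (√k * √n) := by ring
      _ ≤ C * η * n := by gcongr
  have hloss2 : (C * √k) ^ 2 * η ≤ C ^ 2 * η * n := by
    rw [mul_pow, Real.sq_sqrt (Nat.cast_nonneg k)]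
    calc C ^ 2 * k * η = C ^ 2 * η * k := by ring
      _ ≤ C ^ 2 * η * n := by gcongr
  have hη' : 2 * (C * η * n) + C ^ 2 * η * n = n * (ε / 4) := by
    rw [hη]; field_simp
  have hw : |v - ε / 2| ≤ n * (ε / 4) := by
    rw [← div_le_iff₀ (by positivity)]
    exact (Nat.le_ceil _).trans (by exact_mod_cast hn2)
  have hmain : (n : ℝ) / m * (v - ε / 2) - |v - ε / 2| ≤ k * (v - ε / 2) := by
    have e1 : (n : ℝ) / m - 1 ≤ k := by
      rw [sub_le_iff_le_add, div_le_iff₀ hm0]; exact hk2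
    have e2 : (k : ℝ) ≤ n / m := by rw [le_div_iff₀ hm0]; exact hk1
    rcases le_total 0 (v - ε / 2) with hs | hs
    · rw [abs_of_nonneg hs]; nlinarith
    · have := abs_nonneg (v - ε / 2); nlinarith
  have hdiv : (n : ℝ) / m * (v - ε / 2) ≥ n * (v / m) - n * (ε / 2) := by
    have e1 : (n : ℝ) / m ≤ n := div_le_self hn0.le (by exact_mod_cast hm)
    have e2 : (n : ℝ) / m * v = n * (v / m) := by ring
    nlinarith
  nlinarith

/-! ### Existence of the limit -/

/-- The supremum over `m ≥ 1` of the optimized Fisher information per use. -/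
noncomputable def rateSup (J : StateQuantity) (Φ Δ : SuperOp a b) : ℝ≥0∞ :=
  ⨆ (m : ℕ) (_ : 1 ≤ m), channelInfo J (Φ.pow m) (Φ.deriv Δ m) / m

lemma channelInfo_div_le_rateSup (J : StateQuantity) (Φ Δ : SuperOp a b) {m : ℕ} (hm : 1 ≤ m) :
    channelInfo J (Φ.pow m) (Φ.deriv Δ m) / m ≤ rateSup J Φ Δ :=
  le_iSup₂ (f := fun (m : ℕ) (_ : 1 ≤ m) => channelInfo J (Φ.pow m) (Φ.deriv Δ m) / m) m hm

/-- The lower semicontinuity behind both the existence of the limit and (C1). -/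
lemma eventually_lt_channelInfo [Nonempty a] (hJ : IsVariational h J) (hΦ : IsChannel Φ)
    (hΔ : IsTangent Δ) {Φs Δs : (n : ℕ) → SuperOp (Fin n → a) (Fin n → b)}
    (hΦsc : ∀ n, IsChannel (Φs n)) (hΔst : ∀ n, IsTangent (Δs n))
    (hΦs : Tendsto (fun n => cbNorm (Φs n - Φ.pow n)) atTop (𝓝 0))
    (hΔs : Tendsto (fun n : ℕ => cbNorm (Δs n - Φ.deriv Δ n) / ENNReal.ofReal √n) atTop (𝓝 0))
    {t : ℝ≥0∞} (ht : t < rateSup J Φ Δ) :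
    ∀ᶠ n : ℕ in atTop, t < channelInfo J (Φs n) (Δs n) / n := by
  simp only [rateSup, lt_iSup_iff] at ht
  obtain ⟨m, hm, ht⟩ := ht
  have hm0 : (0 : ℝ) < m := by exact_mod_cast hm
  have htop : t ≠ ⊤ := ht.ne_top
  rw [ENNReal.lt_div_iff_mul_lt (Or.inl (by exact_mod_cast hm0.ne'))
    (Or.inl (ENNReal.natCast_ne_top m))] at ht
  obtain ⟨K, ρ, F, hρ, hF, hlt⟩ :=
    exists_state_of_lt_channelInfo hJ (hΦ.pow m) (hΔ.deriv hΦ m) ht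
  set v := fisherVal ((Φ.pow m).ampl (Fin K) ρ) ((Φ.deriv Δ m).ampl (Fin K) ρ) F with hv
  have hvt : t.toReal < v / m := by
    rw [lt_div_iff₀ hm0]
    have h1 : ENNReal.ofReal (t.toReal * m) < ENNReal.ofReal v := by
      rwa [ENNReal.ofReal_mul ENNReal.toReal_nonneg, ENNReal.ofReal_toReal htop,
        ENNReal.ofReal_natCast]
    exact lt_of_not_ge fun hle => h1.not_ge (ENNReal.ofReal_le_ofReal hle)
  filter_upwards [eventually_ge_atTop 1, eventually_attains hΦ hΔ hm hρ hF hΦs hΔs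
    (half_pos (sub_pos.mpr hvt))] with n hn hatt
  obtain ⟨B, hB⟩ := hatt
  have hn0 : (0 : ℝ) < n := by exact_mod_cast hn
  rw [ENNReal.lt_div_iff_mul_lt (Or.inl (by exact_mod_cast hn0.ne'))
    (Or.inl (ENNReal.natCast_ne_top n))]
  refine lt_of_lt_of_le ?_ (hB.le_channelInfo hJ (hΦsc n) (hΔst n))
  have h1 : t * n = ENNReal.ofReal (t.toReal * n) := by
    rw [ENNReal.ofReal_mul ENNReal.toReal_nonneg, ENNReal.ofReal_toReal htop,
      ENNReal.ofReal_natCast]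
  rw [h1]
  have h2 : t.toReal * n < n * (v / m - (v / m - t.toReal) / 2) := by
    rw [mul_comm]
    exact mul_lt_mul_of_pos_left (by linarith) hn0
  exact (ENNReal.ofReal_lt_ofReal_iff
    (lt_of_le_of_lt (mul_nonneg ENNReal.toReal_nonneg hn0.le) h2)).mpr h2

lemma traceNorm_zero : traceNorm (0 : Matrix a a ℂ) = 0 := by
  refine Finset.sum_eq_zero fun i _ => ?_
  rw [← norm_mulVec_eigenvector]
  simp

lemma cbNorm_zero : cbNorm (0 : SuperOp a b) = 0 := by
  have h0 : ∀ k : ℕ, (0 : SuperOp a b).ampl (Fin k) = 0 := fun k =>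
    ext_single fun f f' g g' => by rw [ampl_single]; simp
  simp [cbNorm, h0, traceNorm_zero]

/-- No superadditivity argument is needed: the lower bound for channels close to the tensor powers
applies to the tensor powers themselves. -/
lemma tendsto_channelInfo_div [Nonempty a] (hJ : IsVariational h J) (hΦ : IsChannel Φ)
    (hΔ : IsTangent Δ) :
    Tendsto (fun n : ℕ => channelInfo J (Φ.pow n) (Φ.deriv Δ n) / n) atTop
      (𝓝 (rateSup J Φ Δ)) := by
  refine tendsto_order.mpr ⟨fun t ht => ?_, fun t ht => ?_⟩
  · refine eventually_lt_channelInfo hJ hΦ hΔ (fun n => hΦ.pow n) (fun n => hΔ.deriv hΦ n)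
      ?_ ?_ ht
    · simp [cbNorm_zero]
    · simp [cbNorm_zero]
  · filter_upwards [eventually_ge_atTop 1] with n hn
    exact (channelInfo_div_le_rateSup J Φ Δ hn).trans_lt ht

lemma parallelRate_quantum (J : StateQuantity) (n : ℕ) (Φ Δ : SuperOp a b) :
    (parallelRate J n).quantum Φ Δ = channelInfo J (Φ.pow n) (Φ.deriv Δ n) / n := by
  simp only [ChannelQuantity.quantum, parallelRate, inputSup, lintegral_const, measure_univ,
    mul_one]
  rfl

/-- The regularized quantity of a channel is the supremum of the rates of its finite powers. -/
lemma regularized_quantum [Nonempty a] (hJ : IsVariational h J) (hΦ : IsChannel Φ)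
    (hΔ : IsTangent Δ) : (regularized J).quantum Φ Δ = rateSup J Φ Δ := by
  have h1 : (regularized J).quantum Φ Δ =
      limsup (fun n : ℕ => (parallelRate J n).quantum Φ Δ) atTop := rfl
  simp only [h1, parallelRate_quantum]
  exact (tendsto_channelInfo_div hJ hΦ hΔ).limsup_eq

lemma channelInfo_le_rateSup (hJ : IsVariational h J) (hΦ : IsChannel Φ) (hΔ : IsTangent Δ) :
    channelInfo J Φ Δ ≤ rateSup J Φ Δ := by
  refine le_trans ?_ (channelInfo_div_le_rateSup J Φ Δ le_rfl)
  rw [Nat.cast_one, div_one]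
  exact channelInfo_mono hJ hΦ hΔ (hΦ.pow 1) (hΔ.deriv hΦ 1) fun v B H =>
    ⟨B, H.relabel (relabel_piT_unique Φ).symm (relabel_piTDeriv_unique Φ Δ).symm⟩

/-! ### The axioms -/

lemma axiomM_regularized (hJ : IsVariational h J) : AxiomM (regularized J) := by
  intro a b c _ _ _ _ _ _ _ _ _ Φ Δ hΦ hΔ
  refine ⟨fun Ψ hΨ => ?_, fun Ψ hΨ => ?_⟩
  · rw [regularized_quantum hJ (hΦ.comp hΨ) (hΔ.comp_right hΨ), regularized_quantum hJ hΦ hΔ]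
    refine iSup₂_mono fun m _ => ENNReal.div_le_div_right ?_ _
    have e1 : SuperOp.pow (Φ ∘ₗ Ψ) m = Φ.pow m ∘ₗ Ψ.pow m :=
      piT_comp (fun _ => Φ) fun _ => Ψ
    have e2 : SuperOp.deriv (Φ ∘ₗ Ψ) (Δ ∘ₗ Ψ) m = Φ.deriv Δ m ∘ₗ Ψ.pow m :=
      piTDeriv_comp_right (fun _ => Φ) (fun _ => Δ) fun _ => Ψ
    rw [e1, e2]
    exact channelInfo_mono hJ ((hΦ.pow m).comp (hΨ.pow m)) ((hΔ.deriv hΦ m).comp_right (hΨ.pow m))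
      (hΦ.pow m) (hΔ.deriv hΦ m) fun v B H => ⟨B, H.of_comp_right (hΨ.pow m)⟩
  · rw [regularized_quantum hJ (hΨ.comp hΦ) (hΔ.comp_left hΨ), regularized_quantum hJ hΦ hΔ]
    refine iSup₂_mono fun m _ => ENNReal.div_le_div_right ?_ _
    have e1 : SuperOp.pow (Ψ ∘ₗ Φ) m = Ψ.pow m ∘ₗ Φ.pow m :=
      piT_comp (fun _ => Ψ) fun _ => Φ
    have e2 : SuperOp.deriv (Ψ ∘ₗ Φ) (Ψ ∘ₗ Δ) m = Ψ.pow m ∘ₗ Φ.deriv Δ m :=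
      piTDeriv_comp_left (fun _ => Φ) (fun _ => Δ) fun _ => Ψ
    rw [e1, e2]
    exact channelInfo_mono hJ ((hΨ.pow m).comp (hΦ.pow m)) ((hΔ.deriv hΦ m).comp_left (hΨ.pow m))
      (hΦ.pow m) (hΔ.deriv hΦ m) fun v B H => H.of_comp_left (hΨ.pow m) (hΦ.pow m)

lemma axiomE_regularized (hJ : IsVariational h J) : AxiomE (regularized J) := by
  intro a b c _ _ _ _ _ _ _ _ _ Φ Δ hΦ hΔ
  rw [regularized_quantum hJ hΦ.ampl hΔ.ampl, regularized_quantum hJ hΦ hΔ]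
  refine iSup_congr fun m => iSup_congr fun _ => ?_
  congr 1
  refine le_antisymm ?_ ?_
  · exact channelInfo_mono hJ (hΦ.ampl.pow m) (hΔ.ampl.deriv hΦ.ampl m) (hΦ.pow m)
      (hΔ.deriv hΦ m) fun v B H => ⟨B, (H.relabel (relabel_piT_ampl fun _ => Φ)
        (relabel_piTDeriv_ampl (fun _ => Φ) fun _ => Δ)).of_ampl⟩
  · refine channelInfo_mono hJ (hΦ.pow m) (hΔ.deriv hΦ m) (hΦ.ampl.pow m)
      (hΔ.ampl.deriv hΦ.ampl m) fun v B H => ⟨B, ?_⟩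
    have h0 : IsTangent (0 : SuperOp (Fin m → c) (Fin m → c)) :=
      ⟨fun X => by simp, fun X => by simp⟩
    have h1 := H.tensor isChannel_id h0
    have h2 : (Φ.pow m).tensor (0 : SuperOp (Fin m → c) (Fin m → c)) = 0 :=
      ext_single fun f f' g g' => by rw [tensor_single]; simp
    rw [h2, add_zero] at h1
    exact h1.relabel (relabel_piT_ampl fun _ => Φ).symm
      (relabel_piTDeriv_ampl (fun _ => Φ) fun _ => Δ).symm

/-- The rates of `Φ^{⊗m}` form, up to the factor `m`, a subsequence of the rates of `Φ`. -/
lemma axiomA1_regularized (hJ : IsVariational h J) : AxiomA1 (regularized J) := by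
  intro a b _ _ _ _ _ _ Φ Δ hΦ hΔ m hm
  rw [regularized_quantum hJ (hΦ.pow m) (hΔ.deriv hΦ m), regularized_quantum hJ hΦ hΔ]
  have hm0 : (m : ℝ≥0∞) ≠ 0 := by exact_mod_cast (Nat.one_le_iff_ne_zero.mp hm)
  have hmt : (m : ℝ≥0∞) ≠ ⊤ := ENNReal.natCast_ne_top m
  have h1 := tendsto_channelInfo_div hJ (hΦ.pow m) (hΔ.deriv hΦ m)
  have heq : ∀ n : ℕ, channelInfo J ((Φ.pow m).pow n) ((Φ.pow m).deriv (Φ.deriv Δ m) n) =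
      channelInfo J (Φ.pow (n * m)) (Φ.deriv Δ (n * m)) := by
    intro n
    have r1 := relabel_piT_prod fun _ : Fin n × Fin m => Φ
    have r2 := relabel_piTDeriv_prod (fun _ : Fin n × Fin m => Φ) fun _ => Δ
    have r3 := relabel_piT (finProdFinEquiv (m := n) (n := m)) fun _ => Φ
    have r4 := relabel_piTDeriv (finProdFinEquiv (m := n) (n := m)) (fun _ => Φ) fun _ => Δ
    refine le_antisymm ?_ ?_
    · exact channelInfo_mono hJ ((hΦ.pow m).pow n) ((hΔ.deriv hΦ m).deriv (hΦ.pow m) n)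
        (hΦ.pow _) (hΔ.deriv hΦ _) fun v B H =>
          ⟨B, (H.relabel r1.symm r2.symm).relabel r3 r4⟩
    · exact channelInfo_mono hJ (hΦ.pow _) (hΔ.deriv hΦ _) ((hΦ.pow m).pow n)
        ((hΔ.deriv hΦ m).deriv (hΦ.pow m) n) fun v B H =>
          ⟨B, (H.relabel r3.symm r4.symm).relabel r1 r2⟩
  have h2 : Tendsto (fun n : ℕ => n * m) atTop atTop :=
    tendsto_id.atTop_mul_const' (by omega)
  have h3 := ENNReal.Tendsto.mul_const (b := (m : ℝ≥0∞))
    ((tendsto_channelInfo_div hJ hΦ hΔ).comp h2) (Or.inr hmt)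
  have h4 : rateSup J (Φ.pow m) (Φ.deriv Δ m) = rateSup J Φ Δ * m := by
    refine tendsto_nhds_unique h1 (h3.congr fun n => ?_)
    rw [heq]
    simp only [Function.comp_apply]
    rw [Nat.cast_mul, ENNReal.div_eq_inv_mul, ENNReal.div_eq_inv_mul,
      ENNReal.mul_inv (Or.inr hmt) (Or.inr hm0), mul_right_comm, mul_assoc _ _ (m : ℝ≥0∞),
      ENNReal.inv_mul_cancel hm0 hmt, mul_one]
  rw [h4, ENNReal.mul_div_cancel_right hm0 hmt]

/-- By (A1), the value at `Φ^{⊗n}` is `n` times the limit rate; the lower bound for the perturbed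
channels matches it up to `n ε`. -/
lemma axiomC1_regularized (hJ : IsVariational h J) : AxiomC1 (regularized J) := by
  intro a b _ _ _ _ _ _ Φ Δ hΦ hΔ Φs Δs hΦsc hΔst hΦs hΔs
  have hpow : ∀ n : ℕ, 1 ≤ n → (regularized J).quantum (Φ.pow n) (Φ.deriv Δ n) =
      rateSup J Φ Δ * n := by
    intro n hn
    have h1 := axiomA1_regularized hJ a b Φ Δ hΦ hΔ n hn
    rw [regularized_quantum hJ hΦ hΔ] at h1
    rw [← h1, ENNReal.div_mul_cancel (by exact_mod_cast (Nat.one_le_iff_ne_zero.mp hn))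
      (ENNReal.natCast_ne_top n)]
  have hlow : ∀ t < rateSup J Φ Δ, ∀ᶠ n : ℕ in atTop,
      t < (regularized J).quantum (Φs n) (Δs n) / n := by
    intro t ht
    filter_upwards [eventually_lt_channelInfo hJ hΦ hΔ hΦsc hΔst hΦs hΔs ht] with n hn
    refine hn.trans_le (ENNReal.div_le_div_right ?_ _)
    rw [regularized_quantum hJ (hΦsc n) (hΔst n)]
    exact channelInfo_le_rateSup hJ (hΦsc n) (hΔst n)
  refine ⟨fun hfin => ?_, fun htop => ?_⟩
  · have hL : rateSup J Φ Δ ≠ ⊤ := by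
      obtain ⟨n, hn, hn1⟩ := (hfin.and (eventually_ge_atTop 1)).exists
      rw [hpow n hn1] at hn
      intro htop
      rw [htop, ENNReal.top_mul (by exact_mod_cast (Nat.one_le_iff_ne_zero.mp hn1))] at hn
      exact hn rfl
    refine le_of_forall_lt fun x hx => ?_
    obtain ⟨y, hxy, hy⟩ := EReal.lt_iff_exists_real_btwn.mp hx
    refine hxy.trans_le (le_liminf_of_le (by isBoundedDefault) ?_)
    have hy0 : y < 0 := by exact_mod_cast hy
    set g := (rateSup J Φ Δ).toReal with hg
    have hev : ∀ᶠ n : ℕ in atTop,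
        ENNReal.ofReal (g + y) ≤ (regularized J).quantum (Φs n) (Δs n) / n := by
      rcases le_or_gt (g + y) 0 with h0 | h0
      · rw [ENNReal.ofReal_of_nonpos h0]
        exact Eventually.of_forall fun n => zero_le
      · have : ENNReal.ofReal (g + y) < rateSup J Φ Δ := by
          rw [← ENNReal.ofReal_toReal hL, ← hg]
          exact (ENNReal.ofReal_lt_ofReal_iff (by linarith)).mpr (by linarith)
        exact (hlow _ this).mono fun n hn => hn.le
    filter_upwards [hev, eventually_ge_atTop 1] with n hn hn1
    have hn0 : (0 : ℝ) < n := by exact_mod_cast hn1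
    rw [hpow n hn1]
    have hA : (((g + y) * n : ℝ) : EReal) ≤
        ((regularized J).quantum (Φs n) (Δs n) : EReal) := by
      have h1 : ENNReal.ofReal ((g + y) * n) ≤ (regularized J).quantum (Φs n) (Δs n) := by
        rw [ENNReal.ofReal_mul' hn0.le, ENNReal.ofReal_natCast]
        exact (ENNReal.le_div_iff_mul_le (Or.inl (by exact_mod_cast hn0.ne'))
          (Or.inl (ENNReal.natCast_ne_top n))).mp hn
      refine le_trans ?_ (EReal.coe_ennreal_le_coe_ennreal_iff.mpr h1)
      rw [EReal.coe_ennreal_ofReal]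
      exact_mod_cast le_max_left _ _
    have hB : ((rateSup J Φ Δ * n : ℝ≥0∞) : EReal) = ((g * n : ℝ) : EReal) := by
      rw [hg, ← ENNReal.toReal_natCast, ← ENNReal.toReal_mul,
        EReal.coe_ennreal_toReal (ENNReal.mul_ne_top hL (ENNReal.natCast_ne_top n))]
    rw [hB]
    have hsub : ((y * n : ℝ) : EReal) ≤
        ((regularized J).quantum (Φs n) (Δs n) : EReal) - ((g * n : ℝ) : EReal) := by
      refine le_trans (le_of_eq ?_) (EReal.sub_le_sub hA le_rfl)
      rw [← EReal.coe_sub]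
      congr 1
      ring
    have hdiv := EReal.div_le_div_right_of_nonneg (c := (n : EReal)) (by positivity) hsub
    refine le_trans (le_of_eq ?_) hdiv
    rw [← EReal.coe_coe_eq_natCast, ← EReal.coe_div, mul_div_cancel_right₀ _ hn0.ne']
  · have hL : rateSup J Φ Δ = ⊤ := by
      obtain ⟨n, hn, hn1⟩ := (htop.and_eventually (eventually_ge_atTop 1)).exists
      rw [hpow n hn1] at hn
      rcases ENNReal.mul_eq_top.mp hn with ⟨_, h2⟩ | ⟨h2, _⟩
      · exact absurd h2 (ENNReal.natCast_ne_top n)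
      · exact h2
    rw [ENNReal.tendsto_nhds_top_iff_nnreal]
    intro x
    exact hlow _ (hL ▸ ENNReal.coe_lt_top)

end Regularization

/-! ### The Gaussian shift -/

section Gaussian

/-- At the pair `(ρ, s ρ)` the logarithmic derivative is the number `s`. -/
lemma infoDual_smul_self {d : Type} [Fintype d] (h : Prop) {ρ : Matrix d d ℂ}
    (hρ : ρ.PosSemidef) (s : ℝ) :
    infoDual h ρ ((s : ℂ) • ρ) = ENNReal.ofReal (s ^ 2 * ρ.trace.re) := by
  classical
  have hval : (ρ * (((s : ℂ) • (1 : Matrix d d ℂ))ᴴ * ((s : ℂ) • (1 : Matrix d d ℂ)))).trace.re =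
      s ^ 2 * ρ.trace.re := by
    simp [Matrix.conjTranspose_smul, sq, mul_assoc]
  have hcrit : ∀ X : Matrix d d ℂ, (Xᴴ * ((s : ℂ) • ρ)).trace.re =
      (ρ * (((s : ℂ) • (1 : Matrix d d ℂ))ᴴ * X)).trace.re := by
    intro X
    have h1 := rho_trace_comm hρ.isHermitian X 1
    rw [Matrix.mul_one, Matrix.conjTranspose_one, Matrix.one_mul, Matrix.trace_mul_comm] at h1
    simp [Matrix.conjTranspose_smul, h1]
  rw [← hval]
  refine le_antisymm (iSup₂_le fun X _ => ENNReal.ofReal_le_ofReal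
    (fisherVal_le_of_critical hρ (hcrit X))) ?_
  rw [← fisherVal_eq_of_critical (hcrit _)]
  refine le_infoDual _ _ fun _ => ?_
  rw [Matrix.IsHermitian, Matrix.conjTranspose_smul, Matrix.conjTranspose_one]
  simp

lemma prodDeriv_mul_self {ι R : Type} [Fintype ι] [DecidableEq ι] [CommRing R] (p x : ι → R) :
    prodDeriv p (fun i => x i * p i) = (∑ i, x i) * ∏ i, p i := by
  simp only [prodDeriv, Finset.sum_mul]
  refine Finset.sum_congr rfl fun i _ => ?_
  rw [prod_update_eq, mul_assoc, ← prod_update_eq, Function.update_eq_self]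

variable {a : Type} [Fintype a] [DecidableEq a]

/-- The trace, as a channel to the trivial system. -/
def traceChannel (a : Type) [Fintype a] : SuperOp a Unit :=
  constOutput a (fun _ : Unit => 1) ()

lemma traceChannel_apply (X : Matrix a a ℂ) (g g' : Unit) : traceChannel a X g g' = X.trace := by
  simp [traceChannel, constOutput]

lemma isChannel_traceChannel : IsChannel (traceChannel a) := by
  have h : HasKraus (fun x : a => Matrix.of fun (_ : Unit) f => if f = x then (1 : ℂ) else 0)
      (traceChannel a) := by
    intro f f' g g'
    rw [traceChannel_apply]
    by_cases hf : f = f'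
    · subst hf; simp
    · rw [Matrix.trace_single_eq_of_ne _ _ _ hf]
      refine (Finset.sum_eq_zero fun x _ => ?_).symm
      by_cases hx : f = x
      · subst hx; simp [Ne.symm hf]
      · simp [hx]
  refine h.isChannel fun X => ?_
  simp [Matrix.trace, traceChannel_apply]

lemma constOutput_single {Ω : Type} (p : Ω → ℝ) (x : Ω) (f f' : a) (g g' : Unit) :
    constOutput a p x (Matrix.single f f' 1) g g' =
      p x * traceChannel a (Matrix.single f f' 1) g g' := by
  rw [traceChannel_apply]
  rfl

variable {ι : Type} [Fintype ι] [DecidableEq ι]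

lemma piT_constOutput {Ω : Type} (p : Ω → ℝ) (x : ι → Ω) :
    (piT fun i => constOutput a p (x i)) =
      ((∏ i, p (x i) : ℝ) : ℂ) • piT fun _ : ι => traceChannel a := by
  refine ext_single fun f f' g g' => ?_
  rw [LinearMap.smul_apply, Matrix.smul_apply, piT_single, piT_single, smul_eq_mul]
  simp only [constOutput_single, Finset.prod_mul_distrib]
  push_cast
  rfl

lemma piTDeriv_constOutput (p : ℝ → ℝ) (x : ι → ℝ) :
    (piTDeriv (fun i => constOutput a p (x i)) fun i => constOutput a (fun y => y * p y) (x i)) =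
      ((∑ i, x i : ℝ) : ℂ) • piT fun i => constOutput a p (x i) := by
  refine ext_single fun f f' g g' => ?_
  rw [LinearMap.smul_apply, Matrix.smul_apply, piTDeriv_single, piT_single, smul_eq_mul]
  push_cast
  rw [← prodDeriv_mul_self]
  congr 1
  funext i
  simp only [constOutput_single]
  push_cast
  ring

lemma ampl_smul {b c : Type} [Fintype b] [DecidableEq b] [Fintype c] [DecidableEq c] (r : ℂ)
    (Φ : SuperOp a b) : (r • Φ).ampl c = r • Φ.ampl c := by
  refine ext_single fun f f' g g' => ?_
  simp [ampl_single, mul_assoc]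

/-- At the classical output `x`, the quantum output is a multiple of the same state for
all inputs, and its derivative is `∑ᵢ xᵢ` times that. -/
lemma constOutput_info {h : Prop} {J : StateQuantity} (hJ : IsVariational h J) {p : ℝ → ℝ}
    (hp : ∀ y, 0 ≤ p y) (x : ι → ℝ) {k : ℕ} {ρ : Matrix ((ι → a) × Fin k) ((ι → a) × Fin k) ℂ}
    (hρ : IsState ρ) :
    J ((ι → Unit) × Fin k) ((piT fun i => constOutput a p (x i)).ampl (Fin k) ρ)
      ((piTDeriv (fun i => constOutput a p (x i))
        fun i => constOutput a (fun y => y * p y) (x i)).ampl (Fin k) ρ) =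
      ENNReal.ofReal ((∑ i, x i) ^ 2 * ∏ i, p (x i)) := by
  have hc : 0 ≤ ∏ i, p (x i) := Finset.prod_nonneg fun i _ => hp _
  have hB : IsState ((piT fun _ : ι => traceChannel a).ampl (Fin k) ρ) :=
    isChannel_traceChannel.piT.ampl.isState hρ
  have hσ : (((∏ i, p (x i) : ℝ) : ℂ) •
      (piT fun _ : ι => traceChannel a).ampl (Fin k) ρ).PosSemidef :=
    hB.posSemidef.smul (by exact_mod_cast hc)
  have hδ : (((∑ i, x i : ℝ) : ℂ) • ((∏ i, p (x i) : ℝ) : ℂ) •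
      (piT fun _ : ι => traceChannel a).ampl (Fin k) ρ).IsHermitian := by
    rw [Matrix.IsHermitian, Matrix.conjTranspose_smul, hσ.isHermitian.eq]
    simp
  rw [piTDeriv_constOutput, ampl_smul, piT_constOutput, ampl_smul, LinearMap.smul_apply,
    LinearMap.smul_apply, LinearMap.smul_apply, hJ _ _ _ hσ hδ, infoDual_smul_self h hσ,
    Matrix.trace_smul, hB.trace_eq, smul_eq_mul, mul_one, Complex.ofReal_re]

lemma gaussDensity_nonneg (x : ℝ) : 0 ≤ gaussDensity x :=
  ProbabilityTheory.gaussianPDFReal_nonneg 0 1 x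

lemma gaussianReal_eq :
    ProbabilityTheory.gaussianReal 0 1 =
      volume.withDensity fun x => ENNReal.ofReal (gaussDensity x) :=
  ProbabilityTheory.gaussianReal_of_var_ne_zero 0 one_ne_zero

lemma integrable_gauss_mul {f : ℝ → ℝ}
    (hf : Integrable f (ProbabilityTheory.gaussianReal 0 1)) :
    Integrable fun x => gaussDensity x * f x := by
  rw [gaussianReal_eq, integrable_withDensity_iff_integrable_smul'
    (show Measurable fun x => ENNReal.ofReal (gaussDensity x) from
      (ProbabilityTheory.measurable_gaussianPDFReal 0 1).ennreal_ofReal) (by simp)] at hf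
  refine hf.congr (Eventually.of_forall fun x => ?_)
  simp [ENNReal.toReal_ofReal (gaussDensity_nonneg x)]

lemma integral_gauss_mul (f : ℝ → ℝ) :
    ∫ x, gaussDensity x * f x = ∫ x, f x ∂ProbabilityTheory.gaussianReal 0 1 := by
  rw [ProbabilityTheory.integral_gaussianReal_eq_integral_smul one_ne_zero]
  rfl

lemma integral_sq_gaussian : ∫ x, x ^ 2 ∂ProbabilityTheory.gaussianReal 0 1 = 1 := by
  have h1 := ProbabilityTheory.variance_id_gaussianReal (μ := 0) (v := 1)
  rw [ProbabilityTheory.variance_of_integral_eq_zero aemeasurable_id (by simp)] at h1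
  simpa using h1

/-- The second moment of the sum of `n` independent standard Gaussian variables. -/
lemma lintegral_sum_sq_gauss (n : ℕ) :
    ∫⁻ x : Fin n → ℝ, ENNReal.ofReal ((∑ i, x i) ^ 2 * ∏ i, gaussDensity (x i))
      ∂Measure.pi (fun _ => volume) = n := by
  -- `(∑ xᵢ)² ∏ q(xₗ) = ∑ᵢⱼ ∏ₗ f i j l (xₗ)`, a sum of product functions
  set f : Fin n → Fin n → Fin n → ℝ → ℝ := fun i j l y =>
    gaussDensity y * ((if l = i then y else 1) * (if l = j then y else 1)) with hf
  have hint : ∀ i j l, Integrable (f i j l) := by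
    intro i j l
    refine integrable_gauss_mul ?_
    have hid : Integrable (fun y : ℝ => y) (ProbabilityTheory.gaussianReal 0 1) :=
      (ProbabilityTheory.memLp_id_gaussianReal (μ := 0) (v := 1) 1).integrable le_rfl
    split_ifs
    · have := (ProbabilityTheory.memLp_id_gaussianReal (μ := 0) (v := 1) 2).integrable_sq
      exact this.congr (Eventually.of_forall fun x => by simp [sq])
    · simpa using hid
    · simpa using hid
    · simp
  have hexp : ∀ x : Fin n → ℝ, (∑ i, x i) ^ 2 * ∏ i, gaussDensity (x i) =
      ∑ i, ∑ j, ∏ l, f i j l (x l) := by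
    intro x
    simp only [hf, Finset.prod_mul_distrib, Finset.prod_ite_eq']
    rw [sq, Finset.sum_mul_sum, Finset.sum_mul]
    refine Finset.sum_congr rfl fun i _ => ?_
    rw [Finset.sum_mul]
    refine Finset.sum_congr rfl fun j _ => ?_
    simp
    ring
  have hintp : ∀ i j, Integrable (fun x : Fin n → ℝ => ∏ l, f i j l (x l))
      (Measure.pi fun _ => volume) := fun i j => Integrable.fintype_prod (hint i j)
  have hval : ∀ i j, ∫ x : Fin n → ℝ, ∏ l, f i j l (x l) ∂(Measure.pi fun _ => volume) =
      if i = j then 1 else 0 := by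
    intro i j
    rw [integral_fintype_prod_eq_prod]
    split_ifs with hij
    · subst hij
      refine Finset.prod_eq_one fun l _ => ?_
      simp only [hf, integral_gauss_mul]
      split_ifs
      · simpa [sq] using integral_sq_gaussian
      · simp
    · refine Finset.prod_eq_zero (Finset.mem_univ i) ?_
      simp only [hf, integral_gauss_mul]
      simp [hij]
  simp only [hexp]
  rw [← ofReal_integral_eq_lintegral_ofReal]
  · rw [integral_finsetSum _ fun i _ => integrable_finsetSum _ fun j _ => hintp i j]
    simp_rw [integral_finsetSum _ fun j _ => hintp _ j, hval]
    simp
  · exact integrable_finsetSum _ fun i _ => integrable_finsetSum _ fun j _ => hintp i j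
  · refine Eventually.of_forall fun x => ?_
    simp only [Pi.zero_apply, ← hexp]
    exact mul_nonneg (sq_nonneg _) (Finset.prod_nonneg fun i _ => gaussDensity_nonneg _)

lemma parallelRate_gauss [Nonempty a] {h : Prop} {J : StateQuantity} (hJ : IsVariational h J)
    {n : ℕ} (hn : 1 ≤ n) :
    parallelRate J n a Unit ℝ volume (constOutput a gaussDensity)
      (constOutput a gaussTangentDensity) = 1 := by
  have hin : inputSup J (Fin n → a) (Fin n → Unit) (Fin n → ℝ) (Measure.pi fun _ => volume)
      (fun x => piTensor fun i => constOutput a gaussDensity (x i))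
      (fun x => ∑ i, piTensor (Function.update (fun j => constOutput a gaussDensity (x j)) i
        (constOutput a gaussTangentDensity (x i)))) = n := by
    have hval : ∀ (k : ℕ) (ρ : Matrix ((Fin n → a) × Fin k) ((Fin n → a) × Fin k) ℂ), IsState ρ →
        ∫⁻ x, J ((Fin n → Unit) × Fin k)
          ((piTensor fun i => constOutput a gaussDensity (x i)).ampl (Fin k) ρ)
          ((∑ i, piTensor (Function.update (fun j => constOutput a gaussDensity (x j)) i
            (constOutput a gaussTangentDensity (x i)))).ampl (Fin k) ρ)
          ∂(Measure.pi fun _ => volume) = n := by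
      intro k ρ hρ
      rw [← lintegral_sum_sq_gauss n]
      exact lintegral_congr fun x => constOutput_info hJ gaussDensity_nonneg x hρ
    refine le_antisymm (iSup_le fun k => iSup₂_le fun ρ hρ => (hval k ρ hρ).le) ?_
    obtain ⟨ρ, hρ⟩ := exists_isState (a := (Fin n → a) × Fin 1)
    exact le_iSup_of_le 1 (le_iSup₂_of_le ρ hρ (hval 1 ρ hρ).ge)
  rw [parallelRate, hin]
  exact ENNReal.div_self (by exact_mod_cast (Nat.one_le_iff_ne_zero.mp hn))
    (ENNReal.natCast_ne_top n)

lemma tendsto_parallelRate_gauss [Nonempty a] {h : Prop} {J : StateQuantity}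
    (hJ : IsVariational h J) :
    Tendsto (fun n : ℕ => parallelRate J n a Unit ℝ volume (constOutput a gaussDensity)
      (constOutput a gaussTangentDensity)) atTop (𝓝 1) :=
  tendsto_const_nhds.congr' <| (eventually_ge_atTop 1).mono fun _ hn =>
    (parallelRate_gauss hJ hn).symm

lemma axiomN'_regularized {h : Prop} {J : StateQuantity} (hJ : IsVariational h J) :
    AxiomN' (regularized J) :=
  fun _ _ _ _ => (tendsto_parallelRate_gauss hJ).limsup_eq

lemma regularizationConverges_of_isVariational {h : Prop} {J : StateQuantity}
    (hJ : IsVariational h J) : RegularizationConverges J := by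
  refine ⟨fun a b _ _ _ _ _ _ Φ Δ hΦ hΔ => ?_, fun a _ _ _ => ?_⟩
  · simp only [parallelRate_quantum, regularized_quantum hJ hΦ hΔ]
    exact tendsto_channelInfo_div hJ hΦ hΔ
  · rw [axiomN'_regularized hJ a]
    exact tendsto_parallelRate_gauss hJ

end Gaussian

theorem mainTheorem7 :
    (RegularizationConverges sldInfo ∧ AxiomM GpMin ∧ AxiomE GpMin ∧ AxiomA1 GpMin ∧
      AxiomC1 GpMin ∧ AxiomN' GpMin) ∧
    (RegularizationConverges rldInfo ∧ AxiomM GpR ∧ AxiomE GpR ∧ AxiomA1 GpR ∧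
      AxiomC1 GpR ∧ AxiomN' GpR) := by
  have key : ∀ {h : Prop} {J : StateQuantity}, IsVariational h J →
      RegularizationConverges J ∧ AxiomM (regularized J) ∧ AxiomE (regularized J) ∧
        AxiomA1 (regularized J) ∧ AxiomC1 (regularized J) ∧ AxiomN' (regularized J) :=
    fun hJ => ⟨regularizationConverges_of_isVariational hJ, axiomM_regularized hJ,
      axiomE_regularized hJ, axiomA1_regularized hJ, axiomC1_regularized hJ,
      axiomN'_regularized hJ⟩
  exact ⟨key isVariational_sldInfo, key isVariational_rldInfo⟩
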